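/- Let $d\ge 0$, $\Theta=\mathbb R^d$, and let $\mathcal F$ be a real Hilbert space. For $\alpha=\Theta$ or $\alpha=\Theta\times\Theta$ let $\mathcal P(\alpha)$ be the set of probability densities on $\alpha$ with respect to Lebesgue measure. Let $R:\mathcal F\to[0,\infty)$ be convex and Fréchet differentiable, let $\Psi:\Theta\to\mathcal F$ be Fréchet differentiable and such that $\langle\Psi,\rho\rangle:=\int_\Theta\Psi(\theta)\rho(\theta)\,d\theta$ exists (as a Bochner integral) for every $\rho\in L^1(\Theta)$, and let $g:\Theta\to[0,\infty)$ be differentiable with $g(\theta)\to\infty$ as $|\theta|\to\infty$ and $\int_\Theta e^{-\beta g}<\infty$ for all $\beta>0$. For $\lambda\in[0,1]$ put $$F_\lambda(\rho)=R(\langle\Psi,\rho\rangle)+\lambda\int_\Theta g\rho\,d\theta\in[0,\infty],\qquad F=F_1,$$ $$F_0'(\rho)(\theta)=\langle R'(\langle\Psi,\rho\rangle),\Psi(\theta)\rangle_{\mathcal F},\qquad F'(\rho)(\theta)=F_0'(\rho)(\theta)+g(\theta).$$ Assume that $\sup_{\rho\in\mathcal P(\Theta)}\|\nabla F'(\rho)\|_{L^\infty(\Theta)}<\infty$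 and that the family $\{F_0'(\rho):\rho\in L^1(\Theta),\ \|\rho\|_{1}\le1\}$ is uniformly equicontinuous and uniformly bounded. For $\beta,\gamma>0$, a density $\rho^\star\in\mathcal P(\Theta\times\Theta)$ with position marginal $[\rho^\star]^\theta(\theta)=\int\rho^\star(\theta,r)\,dr$ is called a stationary solution if the constant trajectory $\rho_t\equiv\rho^\star$, $t\ge0$, is a weak (distributional) solution of the nonlinear kinetic Fokker–Planck equation $$\partial_t\rho_t=-\nabla_{(\theta,r)}\cdot\left[\rho_t\begin{pmatrix} r\\ -\nabla F'([\rho_t]^\theta)(\theta)-\gamma r\end{pmatrix}\right]+\gamma\beta^{-1}\Delta_r\rho_t .$$ Then there is a constant $C\ge0$, depending only on $F$ (that is, on $R,\Psi,g$) and $d$, such that for all $\beta\ge1$, all $\gamma>0$ and every stationary solution $\rho^\star$ for $(\beta,\gamma)$, $$F_{1-1/\beta}([\rho^\star]^\theta)\le\inf_{\rho\in\mathcal P(\Theta)}F(\rho)+\frac{C+d\log\beta}{\beta}.$$ Consequently, for every $\varepsilon>0$ there is $\beta_0\ge1$ such that for all $\beta\ge\beta_0$, all $\gamma>0$ and every stationary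 solution $\rho^\star$ for $(\beta,\gamma)$, $F([\rho^\star]^\theta)\le\inf_{\rho\in\mathcal P(\Theta)}F(\rho)+\varepsilon$. -/

import Mathlib

open MeasureTheory Filter Topology
open scoped ENNReal ContDiff

noncomputable section

namespace HeavyBall

/-- The parameter space `Θ = ℝ^d` with its Euclidean norm. -/
abbrev Param (d : ℕ) : Type := EuclideanSpace ℝ (Fin d)

/-- The tangent bundle `ℝ^d × ℝ^d` of position-velocity pairs `(θ, r)`, with Lebesgue measure. -/
abbrev Phase (d : ℕ) : Type := Param d × Param d

/-- `ρ` is a probability density with respect to the reference (Lebesgue) measure. -/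
structure IsDensity {α : Type*} [MeasureSpace α] (ρ : α → ℝ) : Prop where
  integrable : Integrable ρ
  nonneg : ∀ᵐ x, 0 ≤ ρ x
  integral_eq_one : ∫ x, ρ x = 1

/-- The position marginal `[ρ]^θ` of a density on phase space. -/
def marginal {d : ℕ} (ρ : Phase d → ℝ) : Param d → ℝ :=
  fun θ => ∫ r, ρ (θ, r)

section Functional

variable {d : ℕ} {H : Type*} [NormedAddCommGroup H] [InnerProductSpace ℝ H]

/-- The model output `⟨Ψ, ρ⟩ = ∫ Ψ(θ) ρ(θ) dθ`. -/
def output (Ψ : Param d → H) (ρ : Param d → ℝ) : H :=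
  ∫ θ, ρ θ • Ψ θ

/-- The functional `F_lam(ρ) = R(⟨Ψ, ρ⟩) + lam ⟨g, ρ⟩` for nonnegative `R`, `g`, `lam`, with values
in `[0, ∞]`: it is infinite when `lam > 0` and `⟨g, ρ⟩ = ∞`. -/
def objective (R : H → ℝ) (Ψ : Param d → H) (g : Param d → ℝ) (lam : ℝ)
    (ρ : Param d → ℝ) : ℝ≥0∞ :=
  ENNReal.ofReal (R (output Ψ ρ)) + ENNReal.ofReal lam * ∫⁻ θ, ENNReal.ofReal (g θ * ρ θ)

/-- The differential `F₀'(ρ)(θ) = ⟨R'(⟨Ψ, ρ⟩), Ψ(θ)⟩` of `F₀(ρ) = R(⟨Ψ, ρ⟩)`. -/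
def dRisk (R : H → ℝ) (Ψ : Param d → H) (ρ : Param d → ℝ) (θ : Param d) : ℝ :=
  fderiv ℝ R (output Ψ ρ) (Ψ θ)

/-- The differential `F'(ρ)(θ) = F₀'(ρ)(θ) + g(θ)` of `F = F₁`. -/
def dObjective (R : H → ℝ) (Ψ : Param d → H) (g : Param d → ℝ) (ρ : Param d → ℝ)
    (θ : Param d) : ℝ :=
  dRisk R Ψ ρ θ + g θ

/-- The standing assumptions on the risk `R`, the features `Ψ` and the regularizer `g`. -/
structure Assumptions (R : H → ℝ) (Ψ : Param d → H) (g : Param d → ℝ) : Prop where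
  /-- The risk is nonnegative, convex and Fréchet differentiable. -/
  risk_nonneg : ∀ ψ, 0 ≤ R ψ
  risk_convex : ConvexOn ℝ Set.univ R
  risk_differentiable : Differentiable ℝ R
  /-- The feature map is Fréchet differentiable. -/
  feature_differentiable : Differentiable ℝ Ψ
  /-- The integral `⟨Ψ, ρ⟩` makes sense for every `ρ ∈ L¹`. -/
  feature_integrable : ∀ ρ : Param d → ℝ, Integrable ρ → Integrable (fun θ => ρ θ • Ψ θ)
  /-- `∇F'(ρ) ∈ L^∞`, with a bound that is uniform over probability densities `ρ`. -/
  gradient_bounded : ∃ L : ℝ, ∀ ρ : Param d → ℝ, IsDensity ρ →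
    ∀ᵐ θ, ‖gradient (dObjective R Ψ g ρ) θ‖ ≤ L
  /-- The functions `F₀'(ρ)`, `‖ρ‖₁ ≤ 1`, are uniformly equicontinuous and uniformly bounded. -/
  dRisk_equicontinuous : UniformEquicontinuous
    (fun ρ : {ρ : Param d → ℝ // Integrable ρ ∧ ∫ θ, |ρ θ| ≤ 1} => dRisk R Ψ ρ.1)
  dRisk_bounded : ∃ M : ℝ, ∀ ρ : Param d → ℝ, Integrable ρ → ∫ θ, |ρ θ| ≤ 1 →
    ∀ θ, |dRisk R Ψ ρ θ| ≤ M
  /-- The regularizer is nonnegative, differentiable and confining. -/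
  reg_nonneg : ∀ θ, 0 ≤ g θ
  reg_differentiable : Differentiable ℝ g
  reg_tendsto : Tendsto g (cocompact (Param d)) atTop
  reg_integrable : ∀ β : ℝ, 0 < β → Integrable (fun θ => Real.exp (-(β * g θ)))

/-- The generator of the mean field underdamped Langevin dynamics, for the interaction potential
`F'(η)`, applied to a test function `φ`:
`⟨r, ∇_θ φ⟩ + ⟨-∇F'(η)(θ) - γ r, ∇_r φ⟩ + γ β⁻¹ Δ_r φ`. -/
def generator (R : H → ℝ) (Ψ : Param d → H) (g : Param d → ℝ) (β γ : ℝ) (η : Param d → ℝ)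
    (φ : Phase d → ℝ) (x : Phase d) : ℝ :=
  inner ℝ x.2 (gradient (fun θ => φ (θ, x.2)) x.1)
    + inner ℝ (-gradient (dObjective R Ψ g η) x.1 - γ • x.2) (gradient (fun r => φ (x.1, r)) x.2)
    + γ * β⁻¹ * Laplacian.laplacian (fun r => φ (x.1, r)) x.2

/-- A trajectory `t ↦ ρ_t`, `t ≥ 0`, of probability densities on phase space, continuous for the
weak topology of measures, is a weak (distributional) solution of the nonlinear kinetic
Fokker-Planck equation
`∂_t ρ = -∇ · [ρ (r, -∇F'([ρ]^θ) - γ r)] + γ β⁻¹ Δ_r ρ`. -/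
structure IsWeakSolution (R : H → ℝ) (Ψ : Param d → H) (g : Param d → ℝ) (β γ : ℝ)
    (ρ : ℝ → Phase d → ℝ) : Prop where
  density : ∀ t, 0 ≤ t → IsDensity (ρ t)
  continuous : ∀ φ : BoundedContinuousFunction (Phase d) ℝ,
    ContinuousOn (fun t => ∫ x, φ x * ρ t x) (Set.Ici 0)
  evolution : ∀ φ : Phase d → ℝ, ContDiff ℝ ∞ φ → HasCompactSupport φ → ∀ t, 0 ≤ t →
    IntervalIntegrable
      (fun s => ∫ x, generator R Ψ g β γ (marginal (ρ s)) φ x * ρ s x) volume 0 t ∧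
    (∫ x, φ x * ρ t x) - (∫ x, φ x * ρ 0 x)
      = ∫ s in (0 : ℝ)..t, ∫ x, generator R Ψ g β γ (marginal (ρ s)) φ x * ρ s x

/-- `ρ` is a stationary solution: the trajectory that starts at `ρ` and stays there solves the
Fokker-Planck equation. -/
def IsStationary (R : H → ℝ) (Ψ : Param d → H) (g : Param d → ℝ) (β γ : ℝ)
    (ρ : Phase d → ℝ) : Prop :=
  IsWeakSolution R Ψ g β γ (fun _ => ρ)

end Functional

end HeavyBall

end

/-!
Freezing the interaction at the marginal of a stationary solution `ρ` makes `ρ` a weak stationary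
solution of a linear kinetic Fokker-Planck equation whose potential `V` is Lipschitz but has no
further regularity. Let `m` be its (possibly non-integrable) Gibbs weight `exp (-β (V + |r|² / 2))`.
Mollifying `ρ` to a smooth `u`, which solves the equation for a smooth potential up to errors small
in `L¹`, and testing with `exp (-l)`, where `l = log (1 + u / m)`, bounds the dissipation
`m |∇_r l|²`: the bounded multiplier `exp (-l)` tames the logarithm of the usual entropy method, so
that neither moments nor finite entropy of `ρ` are needed. Hence in the limit `ρ / m` does not
depend on the velocity. So `ρ` is the product of its position marginal and a Maxwellian, and testing
the equation with products `φ θ * a r`, where `a` has a prescribed first Maxwellian moment, shows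
that the position marginal is a multiple of `exp (-β V)`.

It remains to show that a self-consistent Gibbs density `η ∝ exp (-β F'(η))` is almost optimal. By
convexity of `R`, the excess risk is bounded by the linearization at `η`, which is compared with the
pointwise values of the potential `F'(η)`. Since `F'(η)` is Lipschitz, its partition function is at
least a constant times `β ^ (-d) exp (-β F'(η)(θ))` for every `θ`, by integrating over the ball of
radius `1 / β` around `θ`. This accounts for `d log β / β`.
-/

noncomputable section

namespace HeavyBall

/-! ### Directional derivatives -/

section DirDeriv

variable {G : Type*} [NormedAddCommGroup G] [NormedSpace ℝ G]

/-- The derivative of `f` in the direction `v`, as an operator on functions. -/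
def dirDeriv (v : G) (f : G → ℝ) (x : G) : ℝ := fderiv ℝ f x v

notation:max "∂[" v "]" => dirDeriv v

@[fun_prop]
theorem contDiff_dirDeriv {v : G} {f : G → ℝ} (hf : ContDiff ℝ ∞ f) : ContDiff ℝ ∞ (∂[v] f) :=
  (hf.fderiv_right (by simp)).clm_apply contDiff_const

theorem hasCompactSupport_dirDeriv {f : G → ℝ} (hf : HasCompactSupport f) (v : G) :
    HasCompactSupport (∂[v] f) :=
  hf.fderiv_apply ℝ v

theorem measurable_dirDeriv [MeasurableSpace G] [BorelSpace G] (v : G) (f : G → ℝ) :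
    Measurable (∂[v] f) :=
  measurable_fderiv_apply_const ℝ f v

theorem dirDeriv_clm (v : G) (ℓ : G →L[ℝ] ℝ) (x : G) : ∂[v] ℓ x = ℓ v := by
  rw [dirDeriv, ℓ.fderiv]

theorem dirDeriv_add {v x : G} {f g : G → ℝ} (hf : DifferentiableAt ℝ f x)
    (hg : DifferentiableAt ℝ g x) :
    ∂[v] (fun y => f y + g y) x = ∂[v] f x + ∂[v] g x := by
  simp [dirDeriv, fderiv_fun_add hf hg]

theorem dirDeriv_sub {v x : G} {f g : G → ℝ} (hf : DifferentiableAt ℝ f x)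
    (hg : DifferentiableAt ℝ g x) :
    ∂[v] (fun y => f y - g y) x = ∂[v] f x - ∂[v] g x := by
  simp [dirDeriv, fderiv_fun_sub hf hg]

theorem dirDeriv_mul {v x : G} {f g : G → ℝ} (hf : DifferentiableAt ℝ f x)
    (hg : DifferentiableAt ℝ g x) :
    ∂[v] (fun y => f y * g y) x = f x * ∂[v] g x + ∂[v] f x * g x := by
  simp [dirDeriv, fderiv_fun_mul hf hg, mul_comm]

theorem dirDeriv_const_mul {v x : G} {f : G → ℝ} (hf : DifferentiableAt ℝ f x) (c : ℝ) :
    ∂[v] (fun y => c * f y) x = c * ∂[v] f x := by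
  simp [dirDeriv, fderiv_const_mul hf]

theorem dirDeriv_comp {v x : G} {f : G → ℝ} {Φ : ℝ → ℝ} {c : ℝ} (hΦ : HasDerivAt Φ c (f x))
    (hf : DifferentiableAt ℝ f x) : ∂[v] (fun y => Φ (f y)) x = c * ∂[v] f x := by
  have := (hΦ.comp_hasFDerivAt x hf.hasFDerivAt).fderiv
  simpa [dirDeriv, Function.comp_def] using DFunLike.congr_fun this v

theorem dirDeriv_comp_const_sub {f : G → ℝ} (hf : Differentiable ℝ f) (v x y : G) :
    ∂[v] (fun z => f (x - z)) y = -∂[v] f (x - y) := by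
  have := ((hf (x - y)).hasFDerivAt.comp y ((hasFDerivAt_id y).const_sub x)).fderiv
  simpa [dirDeriv, Function.comp_def] using DFunLike.congr_fun this v

theorem dirDeriv_dirDeriv_comp_const_sub {f : G → ℝ} (hf : ContDiff ℝ ∞ f) (v x y : G) :
    ∂[v] (∂[v] fun z => f (x - z)) y = ∂[v] (∂[v] f) (x - y) := by
  have hf' : Differentiable ℝ (∂[v] f) := (contDiff_dirDeriv hf).differentiable (by simp)
  rw [funext (dirDeriv_comp_const_sub (hf.differentiable (by simp)) v x),
    dirDeriv_comp (hasDerivAt_neg _) (by fun_prop), dirDeriv_comp_const_sub hf', neg_mul_neg,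
    one_mul]

theorem dirDeriv_comp_smul {f : G → ℝ} (hf : Differentiable ℝ f) (s : ℝ) (v x : G) :
    ∂[v] (fun y => f (s • y)) x = s * ∂[v] f (s • x) := by
  have hchain := ((hf (s • x)).hasFDerivAt.comp x ((hasFDerivAt_id x).const_smul s)).fderiv
  simpa [dirDeriv, Function.comp_def] using DFunLike.congr_fun hchain v

theorem dirDeriv_mul_exp_neg {χ l : G → ℝ} (hχ : ContDiff ℝ ∞ χ) (hl : ContDiff ℝ ∞ l)
    (v x : G) : ∂[v] (fun y => χ y * Real.exp (-l y)) x
      = Real.exp (-l x) * (∂[v] χ x - χ x * ∂[v] l x) := by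
  have hdiff {f : G → ℝ} (hf : ContDiff ℝ ∞ f) : DifferentiableAt ℝ f x :=
    hf.differentiable (by simp) x
  rw [dirDeriv_mul (hdiff hχ) (hdiff (by fun_prop)),
    dirDeriv_comp (Φ := fun s => Real.exp (-s)) (by simpa using (hasDerivAt_neg (l x)).exp)
      (hdiff hl)]
  ring

theorem abs_dirDeriv_le {L : NNReal} {f : G → ℝ} (hf : LipschitzWith L f) (v x : G) :
    |∂[v] f x| ≤ L * ‖v‖ :=
  (fderiv ℝ f x).le_of_opNorm_le (norm_fderiv_le_of_lipschitz ℝ hf) v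

theorem apply_add_eq_of_dirDeriv_eq_zero {f : G → ℝ} (hf : Differentiable ℝ f) {v : G}
    (h : ∀ x, ∂[v] f x = 0) (x : G) : f (x + v) = f x := by
  have hline (t : ℝ) : HasDerivAt (fun t : ℝ => f (x + t • v)) 0 t := by
    have hg : HasDerivAt (fun t : ℝ => x + t • v) v t := by
      simpa using ((hasDerivAt_id t).smul_const v).const_add x
    have := (hf (x + t • v)).hasFDerivAt.comp_hasDerivAt t hg
    rwa [← dirDeriv, h] at this
  simpa using is_const_of_deriv_eq_zero (fun t => (hline t).differentiableAt)
    (fun t => (hline t).deriv) 1 0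

end DirDeriv

section IntegrationByParts

variable {G : Type*} [NormedAddCommGroup G] [NormedSpace ℝ G] [MeasureSpace G]
  [BorelSpace G]

theorem locallyIntegrable_dirDeriv_of_lipschitzWith
    [IsLocallyFiniteMeasure (volume : Measure G)]
    {L : NNReal} {f : G → ℝ} (hf : LipschitzWith L f) (v : G) : LocallyIntegrable (∂[v] f) :=
  (memLp_top_of_bound (measurable_dirDeriv v f).aestronglyMeasurable (L * ‖v‖)
    (ae_of_all _ (abs_dirDeriv_le hf v))).locallyIntegrable le_top

variable [FiniteDimensional ℝ G] [(volume : Measure G).IsAddHaarMeasure]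

theorem integral_mul_dirDeriv {v : G} {f g : G → ℝ} (hf : ContDiff ℝ ∞ f)
    (hfc : HasCompactSupport f) (hg : Differentiable ℝ g) (hg' : LocallyIntegrable (∂[v] g)) :
    ∫ x, f x * ∂[v] g x = -∫ x, ∂[v] f x * g x := by
  have hf' : Continuous (∂[v] f) := (contDiff_dirDeriv hf).continuous
  exact integral_mul_fderiv_eq_neg_fderiv_mul_of_integrable
    (hg.continuous.locallyIntegrable.integrable_smul_left_of_hasCompactSupport hf'
      (hasCompactSupport_dirDeriv hfc v))
    (hg'.integrable_smul_left_of_hasCompactSupport hf.continuous hfc)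
    (hg.continuous.locallyIntegrable.integrable_smul_left_of_hasCompactSupport hf.continuous hfc)
    (fun x _ => hf.differentiable (by simp) x) (fun x _ => hg x)

theorem integral_mul_dirDeriv_of_contDiff {v : G} {f g : G → ℝ} (hf : ContDiff ℝ ∞ f)
    (hfc : HasCompactSupport f) (hg : ContDiff ℝ ∞ g) :
    ∫ x, f x * ∂[v] g x = -∫ x, ∂[v] f x * g x :=
  integral_mul_dirDeriv hf hfc (hg.differentiable (by simp))
    (contDiff_dirDeriv hg).continuous.locallyIntegrable

end IntegrationByParts

/-! ### Mollification -/

section Mollify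

variable {G : Type*} [NormedAddCommGroup G] [MeasureSpace G]

/-- The convolution `k ⋆ f` of a kernel `k` with `f`. -/
def mollify (k f : G → ℝ) : G → ℝ := convolution k f (ContinuousLinearMap.lsmul ℝ ℝ) volume

theorem mollify_apply_comp_sub (k f : G → ℝ) (x : G) :
    mollify k f x = ∫ z, k z * f (x - z) := rfl

section Haar

variable [BorelSpace G]

theorem integrable_comp_sub_mul {k f : G → ℝ} (hk : Continuous k) (hc : HasCompactSupport k)
    (hf : LocallyIntegrable f) (x : G) : Integrable (fun y => k (x - y) * f y) :=
  hf.integrable_smul_left_of_hasCompactSupport (by fun_prop : Continuous fun y => k (x - y))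
    (hc.comp_homeomorph (Homeomorph.subLeft x))

variable [NormedSpace ℝ G] [FiniteDimensional ℝ G] [(volume : Measure G).IsAddHaarMeasure]
  {k f : G → ℝ}

theorem mollify_apply (k f : G → ℝ) (x : G) : mollify k f x = ∫ y, k (x - y) * f y :=
  convolution_lsmul_swap

theorem contDiff_mollify (hk : ContDiff ℝ ∞ k) (hc : HasCompactSupport k)
    (hf : LocallyIntegrable f) : ContDiff ℝ ∞ (mollify k f) :=
  hc.contDiff_convolution_left _ hk hf

theorem dirDeriv_mollify (hk : ContDiff ℝ ∞ k) (hc : HasCompactSupport k)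
    (hf : LocallyIntegrable f) (v : G) : ∂[v] (mollify k f) = mollify (∂[v] k) f := by
  ext x
  have hk1 : ContDiff ℝ 1 k := hk.of_le (by simp)
  have hex : ConvolutionExistsAt (fderiv ℝ k) f x
      ((ContinuousLinearMap.lsmul ℝ ℝ).precompL G) volume :=
    (hc.fderiv ℝ).convolutionExists_left _ (hk1.continuous_fderiv (by simp)) hf x
  rw [dirDeriv, mollify, (hc.hasFDerivAt_convolution_left _ hk1 hf x).fderiv, convolution_def,
    ContinuousLinearMap.integral_apply hex]
  rfl

theorem mollify_dirDeriv (hk : ContDiff ℝ ∞ k) (hc : HasCompactSupport k)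
    (hf : Differentiable ℝ f) {v : G} (hf' : LocallyIntegrable (∂[v] f)) :
    mollify k (∂[v] f) = mollify (∂[v] k) f := by
  ext x
  rw [mollify_apply, mollify_apply, integral_mul_dirDeriv (f := fun y => k (x - y))
    (by fun_prop) (hc.comp_homeomorph (Homeomorph.subLeft x)) hf hf']
  simp_rw [dirDeriv_comp_const_sub (hk.differentiable (by simp)), neg_mul, integral_neg, neg_neg]

theorem mollify_clm_mul (ℓ : G →L[ℝ] ℝ) (hk : Continuous k) (hc : HasCompactSupport k)
    (hf : LocallyIntegrable f) (x : G) :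
    mollify k (fun y => ℓ y * f y) x
      = ℓ x * mollify k f x - mollify (fun z => ℓ z * k z) f x := by
  simp_rw [mollify_apply]
  rw [← integral_const_mul, ← integral_sub
    ((integrable_comp_sub_mul hk hc hf x).const_mul _)
    (integrable_comp_sub_mul (k := fun z => ℓ z * k z) (by fun_prop) hc.mul_left hf x)]
  congr 1 with y
  rw [map_sub]
  ring

theorem abs_mollify_le {k' f' : G → ℝ} (hk' : Continuous k') (hc' : HasCompactSupport k')
    (hf' : LocallyIntegrable f') (hkk' : ∀ z, |k z| ≤ k' z) (hff' : ∀ᵐ y, |f y| ≤ f' y) (x : G) :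
    |mollify k f x| ≤ mollify k' f' x := by
  rw [mollify_apply, mollify_apply]
  refine norm_integral_le_of_norm_le (f := fun y => k (x - y) * f y)
    (integrable_comp_sub_mul hk' hc' hf' x) ?_
  filter_upwards [hff'] with y hy
  rw [norm_mul]
  exact mul_le_mul (hkk' _) hy (abs_nonneg _) ((abs_nonneg _).trans (hkk' _))

theorem mollify_const_mul_left (c : ℝ) (k f : G → ℝ) (x : G) :
    mollify (fun z => c * k z) f x = c * mollify k f x := by
  simp_rw [mollify_apply, mul_assoc, integral_const_mul]

theorem mollify_const_mul_right (c : ℝ) (k f : G → ℝ) (x : G) :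
    mollify k (fun y => c * f y) x = c * mollify k f x := by
  simp_rw [mollify_apply, mul_left_comm, integral_const_mul]

theorem integrable_mollify (hk : Integrable k) (hf : Integrable f) : Integrable (mollify k f) :=
  hk.integrable_convolution _ hf

theorem integral_abs_mollify_le (hk : Integrable k) (hf : Integrable f) :
    ∫ x, |mollify k f x| ≤ (∫ x, |k x|) * ∫ x, |f x| := by
  calc ∫ x, |mollify k f x| ≤ ∫ x, mollify (fun y => |k y|) (fun y => |f y|) x := by
        refine integral_mono (integrable_mollify hk hf).abs
          (integrable_mollify hk.abs hf.abs) fun x => ?_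
        simpa only [mollify_apply, abs_mul] using
          abs_integral_le_integral_abs (f := fun y => k (x - y) * f y)
    _ = (∫ x, |k x|) * ∫ x, |f x| := integral_convolution _ hk.abs hf.abs

end Haar

end Mollify

section Mollifier

variable {G : Type*} [NormedAddCommGroup G] [NormedSpace ℝ G] [MeasureSpace G]

/-- `k` is a smooth probability density concentrated at distance less than `δ` from the origin: an
approximation of the identity for `mollify` at scale `δ`. -/
structure IsMollifier (δ : ℝ) (k : G → ℝ) : Prop where
  contDiff : ContDiff ℝ ∞ k
  hasCompactSupport : HasCompactSupport k
  nonneg : ∀ z, 0 ≤ k z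
  integral_eq_one : ∫ z, k z = 1
  eq_zero : ∀ z, δ ≤ ‖z‖ → k z = 0

theorem IsMollifier.integrable [BorelSpace G] [IsFiniteMeasureOnCompacts (volume : Measure G)]
    {δ : ℝ} {k : G → ℝ} (hk : IsMollifier δ k) : Integrable k :=
  hk.contDiff.continuous.integrable_of_hasCompactSupport hk.hasCompactSupport

variable [FiniteDimensional ℝ G] [BorelSpace G] [(volume : Measure G).IsAddHaarMeasure]

/-- A standard sequence of mollifiers, at scale `2 / (n + 1)`. -/
def stdMollifier (G : Type*) [NormedAddCommGroup G] [NormedSpace ℝ G] [FiniteDimensional ℝ G]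
    [MeasureSpace G] (n : ℕ) : G → ℝ :=
  ContDiffBump.normed (c := (0 : G))
    ⟨1 / (n + 1 : ℝ), 2 / (n + 1 : ℝ), by positivity, by gcongr; norm_num⟩ volume

theorem isMollifier_stdMollifier (n : ℕ) : IsMollifier (2 / (n + 1 : ℝ)) (stdMollifier G n) where
  contDiff := ContDiffBump.contDiff_normed _
  hasCompactSupport := ContDiffBump.hasCompactSupport_normed _
  nonneg := ContDiffBump.nonneg_normed _
  integral_eq_one := ContDiffBump.integral_normed _
  eq_zero z hz := by
    rw [← Function.notMem_support, stdMollifier, ContDiffBump.support_normed_eq]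
    simpa using hz

theorem ae_tendsto_mollify_stdMollifier {f : G → ℝ} (hf : LocallyIntegrable f) :
    ∀ᵐ x, Tendsto (fun n => mollify (stdMollifier G n) f x) atTop (𝓝 (f x)) := by
  refine ContDiffBump.ae_convolution_tendsto_right_of_locallyIntegrable (K := 2) ?_
    (Eventually.of_forall fun n => le_of_eq ?_) hf
  · simpa [div_eq_mul_inv] using
      (tendsto_one_div_add_atTop_nhds_zero_nat (𝕜 := ℝ)).const_mul 2
  · dsimp only
    ring

theorem exists_isMollifier {δ : ℝ} (hδ : 0 < δ) : ∃ k : G → ℝ, IsMollifier δ k := by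
  obtain ⟨n, hn⟩ := exists_nat_one_div_lt (half_pos hδ)
  have hnδ : 2 / (n + 1 : ℝ) ≤ δ := by
    rw [show (2 : ℝ) / (n + 1) = 2 * (1 / (n + 1)) by ring]
    linarith
  have h := isMollifier_stdMollifier (G := G) n
  exact ⟨stdMollifier G n, { h with eq_zero := fun z hz => h.eq_zero z (hnδ.trans hz) }⟩

theorem exists_integral_abs_translate_sub_le {f : G → ℝ} (hf : Integrable f) {κ : ℝ} (hκ : 0 < κ) :
    ∃ δ > 0, ∀ z : G, ‖z‖ < δ → ∫ x, |f (x - z) - f x| ≤ κ := by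
  let F : Lp ℝ 1 (volume : Measure G) := hf.toL1 f
  have : Fact ((1 : ℝ≥0∞) ≠ ⊤) := ⟨by simp⟩
  have hcont : Continuous fun z : G => (DomAddAct.mk z) +ᵥ F :=
    DomAddAct.continuous_mk.vadd continuous_const
  obtain ⟨δ, hδ, h⟩ :=
    Metric.eventually_nhds_iff.1 (Metric.tendsto_nhds.1 (hcont.tendsto 0) κ hκ)
  refine ⟨δ, hδ, fun z hz => ?_⟩
  have hd := h (y := -z) (by simpa using hz)
  simp only [DomAddAct.mk_zero, zero_vadd] at hd
  rw [dist_eq_norm, L1.norm_eq_integral_norm] at hd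
  refine le_trans (le_of_eq (integral_congr_ae ?_)) hd.le
  have hF : F =ᵐ[volume] f := hf.coeFn_toL1
  have hFz : (fun x => F (-z +ᵥ x)) =ᵐ[volume] fun x => f (-z +ᵥ x) :=
    (measurePreserving_vadd (-z) (volume : Measure G)).quasiMeasurePreserving.ae_eq_comp hF
  filter_upwards [Lp.coeFn_sub ((DomAddAct.mk (-z)) +ᵥ F) F,
    DomAddAct.vadd_Lp_ae_eq (DomAddAct.mk (-z)) F, hF, hFz] with x hsub hvadd hFx hFzx
  have hshift : F (-z +ᵥ x) = f (x - z) := by rw [hFzx, vadd_eq_add, neg_add_eq_sub]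
  rw [hsub, Pi.sub_apply, hvadd, hFx, Real.norm_eq_abs, ← hshift]
  rfl

theorem IsMollifier.mollify_sub_eq {δ : ℝ} {k f : G → ℝ} (hk : IsMollifier δ k)
    (hf : LocallyIntegrable f) (x : G) :
    mollify k f x - f x = ∫ z, k z * (f (x - z) - f x) := by
  have hint : Integrable fun z => k z * f (x - z) := by
    simpa using (integrable_comp_sub_mul hk.contDiff.continuous hk.hasCompactSupport hf
      x).comp_sub_left x
  simp_rw [mul_sub]
  rw [integral_sub hint (hk.integrable.mul_const _), integral_mul_const, hk.integral_eq_one,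
    one_mul, mollify_apply_comp_sub]

theorem eventually_integral_abs_mollify_sub_le {f : G → ℝ} (hf : Integrable f) {κ : ℝ}
    (hκ : 0 < κ) :
    ∀ᶠ δ in 𝓝[>] (0 : ℝ), ∀ k : G → ℝ, IsMollifier δ k → ∫ x, |mollify k f x - f x| ≤ κ := by
  obtain ⟨δ₀, hδ₀, h⟩ := exists_integral_abs_translate_sub_le hf hκ
  filter_upwards [Ioc_mem_nhdsGT hδ₀] with δ hδ k hk
  have hprod : Integrable (fun p : G × G => |k p.2 * (f (p.1 - p.2) - f p.1)|)
      (volume.prod volume) := by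
    have hconv : Integrable (fun p : G × G => k p.2 * f (p.1 - p.2)) (volume.prod volume) :=
      hk.integrable.convolution_integrand (ContinuousLinearMap.lsmul ℝ ℝ) hf
    have hmul : Integrable (fun p : G × G => k p.2 * f p.1) (volume.prod volume) := by
      simpa only [mul_comm] using hf.mul_prod hk.integrable
    exact (hconv.sub hmul).abs.congr (ae_of_all _ fun p => by simp [mul_sub])
  calc ∫ x, |mollify k f x - f x| ≤ ∫ x, ∫ z, |k z * (f (x - z) - f x)| := by
        refine integral_mono ((integrable_mollify hk.integrable hf).sub hf).abs
          hprod.integral_prod_left fun x => ?_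
        simp only [hk.mollify_sub_eq hf.locallyIntegrable]
        exact abs_integral_le_integral_abs
    _ = ∫ z, ∫ x, |k z * (f (x - z) - f x)| := integral_integral_swap hprod
    _ ≤ ∫ z, k z * κ := by
        refine integral_mono hprod.integral_prod_right (hk.integrable.mul_const _) fun z => ?_
        simp only [abs_mul, abs_of_nonneg (hk.nonneg z), integral_const_mul]
        rcases lt_or_ge ‖z‖ δ with hz | hz
        · exact mul_le_mul_of_nonneg_left (h z (hz.trans_le hδ.2)) (hk.nonneg z)
        · simp [hk.eq_zero z hz]
    _ = κ := by rw [integral_mul_const, hk.integral_eq_one, one_mul]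

theorem exists_tendsto_invariant_of_weak_deriv_eq_zero {f : G → ℝ} (hf : LocallyIntegrable f)
    {S : Set G} (h : ∀ v ∈ S, ∀ φ : G → ℝ, ContDiff ℝ ∞ φ → HasCompactSupport φ →
      ∫ x, f x * ∂[v] φ x = 0) :
    ∃ F : ℕ → G → ℝ, (∀ n x, ∀ v ∈ S, F n (x + v) = F n x) ∧
      ∀ᵐ x, Tendsto (fun n => F n x) atTop (𝓝 (f x)) := by
  refine ⟨fun n => mollify (stdMollifier G n) f, fun n x v hv => ?_,
    ae_tendsto_mollify_stdMollifier hf⟩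
  have hk := isMollifier_stdMollifier (G := G) n
  refine apply_add_eq_of_dirDeriv_eq_zero
    ((contDiff_mollify hk.contDiff hk.hasCompactSupport hf).differentiable (by simp))
    (fun y => ?_) x
  have htest := h v hv (fun z => stdMollifier G n (y - z)) (hk.contDiff.comp (by fun_prop))
    (hk.hasCompactSupport.comp_homeomorph (Homeomorph.subLeft y))
  rw [dirDeriv_mollify hk.contDiff hk.hasCompactSupport hf, mollify_apply]
  simpa only [dirDeriv_comp_const_sub (hk.contDiff.differentiable (by simp)), mul_neg,
    integral_neg, neg_eq_zero, mul_comm] using htest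

theorem exists_ae_eq_const_of_weak_deriv_eq_zero {f : G → ℝ} (hf : LocallyIntegrable f)
    (h : ∀ v, ∀ φ : G → ℝ, ContDiff ℝ ∞ φ → HasCompactSupport φ → ∫ x, f x * ∂[v] φ x = 0) :
    ∃ c, ∀ᵐ x, f x = c := by
  obtain ⟨F, hF, hlim⟩ := exists_tendsto_invariant_of_weak_deriv_eq_zero (S := Set.univ) hf
    fun v _ => h v
  obtain ⟨x₀, hx₀⟩ := hlim.exists
  refine ⟨f x₀, hlim.mono fun x hx => tendsto_nhds_unique hx ?_⟩
  simpa only [← hF _ x₀ (x - x₀) (Set.mem_univ _), add_sub_cancel] using hx₀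

end Mollifier

section Lipschitz

theorem abs_sub_le_of_ae_abs_deriv_le {f : ℝ → ℝ} (hf : Differentiable ℝ f) {C : ℝ}
    (hC : ∀ᵐ t, |deriv f t| ≤ C) : |f 1 - f 0| ≤ C := by
  have hint : IntervalIntegrable (deriv f) volume 0 1 := by
    rw [intervalIntegrable_iff]
    exact Measure.integrableOn_of_bounded (by simp) (measurable_deriv f).aestronglyMeasurable
      (ae_restrict_of_ae hC)
  rw [← intervalIntegral.integral_eq_sub_of_hasDerivAt (fun t _ => (hf t).hasDerivAt) hint]
  simpa using intervalIntegral.norm_integral_le_of_norm_le_const_ae (a := 0) (b := 1)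
    (f := deriv f) (hC.mono fun t ht _ => ht)

variable {G : Type*} [NormedAddCommGroup G] [NormedSpace ℝ G] [FiniteDimensional ℝ G]
  [MeasureSpace G] [BorelSpace G] [(volume : Measure G).IsAddHaarMeasure]

theorem ae_abs_apply_add_sub_le {f : G → ℝ} (hf : Differentiable ℝ f) {L : NNReal}
    (h : ∀ᵐ x, ‖fderiv ℝ f x‖ ≤ L) (v : G) : ∀ᵐ x, |f (x + v) - f x| ≤ L * ‖v‖ := by
  have hmeas : MeasurableSet {y : G | ‖fderiv ℝ f y‖ ≤ L} :=
    measurableSet_le (measurable_fderiv ℝ f).norm measurable_const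
  have htranslate : ∀ᵐ t : ℝ, ∀ᵐ x : G, ‖fderiv ℝ f (x + t • v)‖ ≤ L := ae_of_all _ fun t =>
    (measurePreserving_add_right (volume : Measure G) (t • v)).quasiMeasurePreserving.ae h
  have hline : ∀ᵐ x : G, ∀ᵐ t : ℝ, ‖fderiv ℝ f (x + t • v)‖ ≤ L :=
    (Measure.ae_ae_comm (p := fun t x => ‖fderiv ℝ f (x + t • v)‖ ≤ L)
      ((by fun_prop : Measurable fun p : ℝ × G => p.2 + p.1 • v) hmeas)).1 htranslate
  filter_upwards [hline] with x hx
  have hderiv (t : ℝ) :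
      HasDerivAt (fun t : ℝ => f (x + t • v)) (fderiv ℝ f (x + t • v) v) t := by
    have hg : HasDerivAt (fun t : ℝ => x + t • v) v t := by
      simpa using ((hasDerivAt_id t).smul_const v).const_add x
    exact (hf (x + t • v)).hasFDerivAt.comp_hasDerivAt t hg
  simpa using abs_sub_le_of_ae_abs_deriv_le (fun t => (hderiv t).differentiableAt)
    (hx.mono fun t ht => by
      rw [(hderiv t).deriv]
      exact (fderiv ℝ f (x + t • v)).le_of_opNorm_le ht v)

theorem lipschitzWith_of_ae_norm_fderiv_le {f : G → ℝ} (hf : Differentiable ℝ f) {L : NNReal}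
    (h : ∀ᵐ x, ‖fderiv ℝ f x‖ ≤ L) : LipschitzWith L f := by
  have hcont := hf.continuous
  have hle (v x : G) : |f (x + v) - f x| ≤ L * ‖v‖ := by
    have hclosed : IsClosed {y : G | |f (y + v) - f y| ≤ L * ‖v‖} :=
      isClosed_le (by fun_prop) continuous_const
    have hdense := Measure.dense_of_ae (ae_abs_apply_add_sub_le hf h v)
    exact hclosed.closure_subset (hdense x)
  refine LipschitzWith.of_dist_le_mul fun x y => ?_
  simpa [Real.dist_eq, dist_eq_norm] using hle (x - y) y

variable {L : NNReal} {f : G → ℝ}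

theorem IsMollifier.lipschitzWith_mollify {δ : ℝ} {k : G → ℝ} (hk : IsMollifier δ k)
    (hf : LipschitzWith L f) : LipschitzWith L (mollify k f) := by
  have hint (x : G) : Integrable fun z => k z * f (x - z) := by
    have hcont := hf.continuous
    exact (by fun_prop : Continuous fun z => f (x - z)).locallyIntegrable
      |>.integrable_smul_left_of_hasCompactSupport hk.contDiff.continuous hk.hasCompactSupport
  refine LipschitzWith.of_dist_le_mul fun x y => ?_
  rw [Real.dist_eq, mollify_apply_comp_sub, mollify_apply_comp_sub,
    ← integral_sub (hint x) (hint y)]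
  calc |∫ z, (k z * f (x - z) - k z * f (y - z))|
      ≤ ∫ z, k z * (L * dist x y) := by
        refine norm_integral_le_of_norm_le (f := fun z => k z * f (x - z) - k z * f (y - z))
          (hk.integrable.mul_const _) (ae_of_all _ fun z => ?_)
        rw [← mul_sub, norm_mul, Real.norm_of_nonneg (hk.nonneg z), ← dist_eq_norm]
        exact mul_le_mul_of_nonneg_left
          ((hf.dist_le_mul _ _).trans_eq (by rw [dist_sub_right])) (hk.nonneg z)
    _ = L * dist x y := by rw [integral_mul_const, hk.integral_eq_one, one_mul]

theorem IsMollifier.abs_mollify_sub_le {δ : ℝ} {k : G → ℝ} (hk : IsMollifier δ k)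
    (hf : LipschitzWith L f) (x : G) : |mollify k f x - f x| ≤ L * δ := by
  rw [hk.mollify_sub_eq hf.continuous.locallyIntegrable]
  calc |∫ z, k z * (f (x - z) - f x)| ≤ ∫ z, k z * (L * δ) := by
        refine norm_integral_le_of_norm_le (f := fun z => k z * (f (x - z) - f x))
          (hk.integrable.mul_const _) (ae_of_all _ fun z => ?_)
        rw [norm_mul, Real.norm_of_nonneg (hk.nonneg z), ← dist_eq_norm]
        rcases lt_or_ge ‖z‖ δ with hz | hz
        · refine mul_le_mul_of_nonneg_left ((hf.dist_le_mul _ _).trans ?_) (hk.nonneg z)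
          gcongr
          simpa [dist_eq_norm] using hz.le
        · simp [hk.eq_zero z hz]
    _ = L * δ := by rw [integral_mul_const, hk.integral_eq_one, one_mul]

theorem tendsto_mollify_stdMollifier (hf : LipschitzWith L f) (x : G) :
    Tendsto (fun n => mollify (stdMollifier G n) f x) atTop (𝓝 (f x)) := by
  refine tendsto_iff_dist_tendsto_zero.2 (squeeze_zero (fun _ => dist_nonneg)
    (fun n => (isMollifier_stdMollifier n).abs_mollify_sub_le hf x) ?_)
  simpa [div_eq_mul_inv] using
    ((tendsto_one_div_add_atTop_nhds_zero_nat (𝕜 := ℝ)).const_mul (2 : ℝ)).const_mul (L : ℝ)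

theorem ae_tendsto_dirDeriv_mollify_stdMollifier (hf : Differentiable ℝ f)
    (hL : LipschitzWith L f) (v : G) :
    ∀ᵐ x, Tendsto (fun n => ∂[v] (mollify (stdMollifier G n) f) x) atTop (𝓝 (∂[v] f x)) := by
  have hf' := locallyIntegrable_dirDeriv_of_lipschitzWith hL v
  filter_upwards [ae_tendsto_mollify_stdMollifier hf'] with x hx
  refine hx.congr fun n => ?_
  have hk := isMollifier_stdMollifier (G := G) n
  rw [mollify_dirDeriv hk.contDiff hk.hasCompactSupport hf hf',
    dirDeriv_mollify hk.contDiff hk.hasCompactSupport hf.continuous.locallyIntegrable]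

end Lipschitz

/-! ### The kinetic Fokker-Planck operator -/

section Coordinates

variable {d : ℕ}

/-- The `j`-th vector of the standard basis of the parameter space. -/
def stdDir (j : Fin d) : Param d := EuclideanSpace.single j 1

/-- The `j`-th coordinate direction of the position space, as a direction of phase space. -/
def posDir (j : Fin d) : Phase d := (stdDir j, 0)

/-- The `j`-th coordinate direction of the velocity space, as a direction of phase space. -/
def velDir (j : Fin d) : Phase d := (0, stdDir j)

/-- The `j`-th velocity coordinate `(θ, r) ↦ r_j`, as a linear functional on phase space. -/
def velCoord (j : Fin d) : Phase d →L[ℝ] ℝ :=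
  EuclideanSpace.proj j ∘L ContinuousLinearMap.snd ℝ (Param d) (Param d)

theorem velCoord_apply (j : Fin d) (x : Phase d) : velCoord j x = x.2 j := rfl

theorem norm_stdDir (j : Fin d) : ‖stdDir j‖ = 1 := by
  simp [stdDir]

theorem sum_smul_stdDir (v : Param d) : ∑ j, v j • stdDir j = v := by
  simpa [stdDir] using (EuclideanSpace.basisFun (Fin d) ℝ).sum_repr v

theorem dirDeriv_eq_sum_stdDir (v : Param d) (f : Param d → ℝ) (θ : Param d) :
    ∂[v] f θ = ∑ j, v j * ∂[stdDir j] f θ := by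
  conv_lhs => rw [dirDeriv, ← sum_smul_stdDir v, map_sum]
  simp [dirDeriv]

theorem abs_dirDeriv_stdDir_le {L : NNReal} {V : Param d → ℝ} (hV : LipschitzWith L V)
    (j : Fin d) (θ : Param d) : |∂[stdDir j] V θ| ≤ L := by
  simpa [norm_stdDir] using abs_dirDeriv_le hV (stdDir j) θ

theorem inner_gradient_eq_dirDeriv (v : Param d) (f : Param d → ℝ) (θ : Param d) :
    inner ℝ v (gradient f θ) = ∂[v] f θ := by
  rw [real_inner_comm, gradient, InnerProductSpace.toDual_symm_apply, dirDeriv]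

theorem laplacian_eq_sum_dirDeriv {f : Param d → ℝ} (hf : ContDiff ℝ ∞ f) (θ : Param d) :
    Laplacian.laplacian f θ = ∑ j, ∂[stdDir j] (∂[stdDir j] f) θ := by
  rw [InnerProductSpace.laplacian_eq_iteratedFDeriv_orthonormalBasis _
    (EuclideanSpace.basisFun (Fin d) ℝ)]
  refine Finset.sum_congr rfl fun j _ => ?_
  have hf' : DifferentiableAt ℝ (fderiv ℝ f) θ :=
    (hf.fderiv_right (m := ∞) (by simp)).differentiable (by simp) θ
  rw [iteratedFDeriv_two_apply, dirDeriv, show ∂[stdDir j] f = fun x => fderiv ℝ f x (stdDir j)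
    from rfl, fderiv_clm_apply hf' (by fun_prop)]
  simp [stdDir]

theorem hasCompactSupport_fst_mul_snd {X Y : Type*} [TopologicalSpace X] [TopologicalSpace Y]
    [R1Space (X × Y)] {f : X → ℝ} {k : Y → ℝ} (hf : HasCompactSupport f)
    (hk : HasCompactSupport k) : HasCompactSupport fun z : X × Y => f z.1 * k z.2 := by
  refine HasCompactSupport.intro (hf.isCompact.prod hk.isCompact) fun z hz => ?_
  rw [Set.mem_prod, not_and_or] at hz
  rcases hz with hz | hz
  · rw [image_eq_zero_of_notMem_tsupport hz, zero_mul]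
  · rw [image_eq_zero_of_notMem_tsupport hz, mul_zero]

theorem dirDeriv_comp_prodMk_right {φ : Phase d → ℝ} {x : Phase d} (hφ : DifferentiableAt ℝ φ x)
    (v : Param d) : ∂[v] (fun θ => φ (θ, x.2)) x.1 = ∂[(v, 0)] φ x := by
  have := (hφ.hasFDerivAt.comp (f := fun θ => (θ, x.2)) x.1
    (hasFDerivAt_prodMk_left x.1 x.2)).fderiv
  simpa [dirDeriv, Function.comp_def] using DFunLike.congr_fun this v

theorem dirDeriv_comp_prodMk_left {φ : Phase d → ℝ} {x : Phase d} (hφ : DifferentiableAt ℝ φ x)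
    (v : Param d) : ∂[v] (fun r => φ (x.1, r)) x.2 = ∂[(0, v)] φ x := by
  have := (hφ.hasFDerivAt.comp (f := fun r => (x.1, r)) x.2
    (hasFDerivAt_prodMk_right x.1 x.2)).fderiv
  simpa [dirDeriv, Function.comp_def] using DFunLike.congr_fun this v

theorem dirDeriv_comp_fst {f : Param d → ℝ} {x : Phase d} (hf : DifferentiableAt ℝ f x.1)
    (w : Phase d) : ∂[w] (fun y => f y.1) x = ∂[w.1] f x.1 := by
  have := (hf.hasFDerivAt.comp x hasFDerivAt_fst).fderiv
  simpa [dirDeriv, Function.comp_def] using DFunLike.congr_fun this w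

theorem dirDeriv_comp_snd {f : Param d → ℝ} {x : Phase d} (hf : DifferentiableAt ℝ f x.2)
    (w : Phase d) : ∂[w] (fun y => f y.2) x = ∂[w.2] f x.2 := by
  have := (hf.hasFDerivAt.comp x hasFDerivAt_snd).fderiv
  simpa [dirDeriv, Function.comp_def] using DFunLike.congr_fun this w

theorem dirDeriv_velDir_comp_fst {f : Param d → ℝ} {x : Phase d} (hf : DifferentiableAt ℝ f x.1)
    (j : Fin d) : ∂[velDir j] (fun y => f y.1) x = 0 :=
  (dirDeriv_comp_fst hf _).trans (map_zero _)

theorem dirDeriv_posDir_comp_snd {f : Param d → ℝ} {x : Phase d} (hf : DifferentiableAt ℝ f x.2)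
    (j : Fin d) : ∂[posDir j] (fun y => f y.2) x = 0 :=
  (dirDeriv_comp_snd hf _).trans (map_zero _)

end Coordinates

section Generator

variable {d : ℕ}

/-- The kinetic Fokker-Planck generator in coordinates, for the potential `V`, the inverse
temperature `β` and the diffusivity `σ`. The friction is `σ * β`, so that no relation between `β`
and the friction is needed in the linear theory. -/
def kineticGenerator (V : Param d → ℝ) (β σ : ℝ) (φ : Phase d → ℝ) (x : Phase d) : ℝ :=
  ∑ j, (x.2 j * ∂[posDir j] φ x - ∂[stdDir j] V x.1 * ∂[velDir j] φ x
    + σ * (∂[velDir j] (∂[velDir j] φ) x - β * x.2 j * ∂[velDir j] φ x))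

/-- `ρ` is a stationary distributional solution of the linear kinetic Fokker-Planck equation with
potential `V`, inverse temperature `β` and diffusivity `σ`. -/
def IsWeakStationary (V : Param d → ℝ) (β σ : ℝ) (ρ : Phase d → ℝ) : Prop :=
  ∀ φ : Phase d → ℝ, ContDiff ℝ ∞ φ → HasCompactSupport φ →
    ∫ x, kineticGenerator V β σ φ x * ρ x = 0

variable {H : Type*} [NormedAddCommGroup H] [InnerProductSpace ℝ H] {R : H → ℝ}
  {Ψ : Param d → H} {g : Param d → ℝ} {β γ : ℝ}

theorem generator_eq_kineticGenerator (hβ : β ≠ 0) (η : Param d → ℝ) {φ : Phase d → ℝ}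
    (hφ : ContDiff ℝ ∞ φ) (x : Phase d) :
    generator R Ψ g β γ η φ x = kineticGenerator (dObjective R Ψ g η) β (γ * β⁻¹) φ x := by
  have hdiff {ψ : Phase d → ℝ} (hψ : ContDiff ℝ ∞ ψ) : Differentiable ℝ ψ :=
    hψ.differentiable (by simp)
  have hlap : Laplacian.laplacian (fun r => φ (x.1, r)) x.2
      = ∑ j, ∂[velDir j] (∂[velDir j] φ) x := by
    rw [laplacian_eq_sum_dirDeriv (by fun_prop : ContDiff ℝ ∞ fun r => φ (x.1, r))]
    refine Finset.sum_congr rfl fun j _ => ?_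
    have hinner : (∂[stdDir j] fun r => φ (x.1, r)) = fun r => ∂[velDir j] φ (x.1, r) :=
      funext fun r => dirDeriv_comp_prodMk_left (x := (x.1, r)) (hdiff hφ _) _
    rw [hinner]
    exact dirDeriv_comp_prodMk_left (hdiff (contDiff_dirDeriv hφ) _) _
  have hcoord (v : Param d) (j : Fin d) : v j = inner ℝ (stdDir j) v := by
    simp [stdDir, EuclideanSpace.inner_single_left]
  rw [generator, kineticGenerator, hlap, inner_gradient_eq_dirDeriv, inner_gradient_eq_dirDeriv,
    dirDeriv_eq_sum_stdDir x.2, dirDeriv_eq_sum_stdDir (_ - _), Finset.mul_sum,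
    ← Finset.sum_add_distrib, ← Finset.sum_add_distrib]
  refine Finset.sum_congr rfl fun j _ => ?_
  rw [dirDeriv_comp_prodMk_right (hdiff hφ _), dirDeriv_comp_prodMk_left (hdiff hφ _),
    PiLp.sub_apply, PiLp.neg_apply, PiLp.smul_apply, smul_eq_mul, hcoord (gradient _ _),
    inner_gradient_eq_dirDeriv, ← posDir, ← velDir]
  field_simp
  ring

theorem IsStationary.isWeakStationary {ρ : Phase d → ℝ} (h : IsStationary R Ψ g β γ ρ)
    (hβ : β ≠ 0) : IsWeakStationary (dObjective R Ψ g (marginal ρ)) β (γ * β⁻¹) ρ := by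
  intro φ hφ hc
  have := (h.evolution φ hφ hc 1 zero_le_one).2
  simp_rw [generator_eq_kineticGenerator hβ _ hφ] at this
  simpa using this.symm

end Generator

section Adjoint

variable {d : ℕ} {V : Param d → ℝ} {β σ : ℝ}

/-- The formal adjoint of `kineticGenerator V β σ`, in divergence form. -/
def kineticAdjoint (V : Param d → ℝ) (β σ : ℝ) (u : Phase d → ℝ) (x : Phase d) : ℝ :=
  ∑ j, (-(x.2 j * ∂[posDir j] u x)
    + ∂[velDir j] (fun y => (∂[stdDir j] V y.1 + σ * β * y.2 j) * u y + σ * ∂[velDir j] u y) x)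

/-- The adjoint of `kineticGenerator V β σ` with respect to the Gibbs weight `expEnergy (-β) V`, see
`kineticAdjoint_expEnergy_mul`. -/
def kineticDual (V : Param d → ℝ) (β σ : ℝ) (h : Phase d → ℝ) (x : Phase d) : ℝ :=
  ∑ j, (-(x.2 j * ∂[posDir j] h x) + ∂[stdDir j] V x.1 * ∂[velDir j] h x
    + σ * (∂[velDir j] (∂[velDir j] h) x - β * x.2 j * ∂[velDir j] h x))

/-- The exponential `exp (b E)` of a multiple of the energy `E(θ, r) = V(θ) + |r|² / 2`. The Gibbs
weight at inverse temperature `β` is `expEnergy (-β) V`. -/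
def expEnergy (b : ℝ) (V : Param d → ℝ) (x : Phase d) : ℝ :=
  Real.exp (b * (V x.1 + ‖x.2‖ ^ 2 / 2))

instance : (volume : Measure (Phase d)).IsAddHaarMeasure :=
  inferInstanceAs ((volume : Measure (Param d)).prod volume).IsAddHaarMeasure

@[fun_prop]
theorem contDiff_velocity_apply (j : Fin d) : ContDiff ℝ ∞ fun x : Phase d => x.2 j :=
  (velCoord j).contDiff

theorem dirDeriv_posDir_velocity_mul {f : Phase d → ℝ} {x : Phase d} (hf : DifferentiableAt ℝ f x)
    (i j : Fin d) : ∂[posDir j] (fun y => y.2 i * f y) x = x.2 i * ∂[posDir j] f x := by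
  simpa [dirDeriv_clm, velCoord_apply, posDir] using
    dirDeriv_mul (v := posDir j) (velCoord i).differentiableAt hf

theorem dirDeriv_velDir_velocity_mul {f : Phase d → ℝ} {x : Phase d} (hf : DifferentiableAt ℝ f x)
    (j : Fin d) : ∂[velDir j] (fun y => y.2 j * f y) x = x.2 j * ∂[velDir j] f x + f x := by
  simpa [dirDeriv_clm, velCoord_apply, velDir, stdDir] using
    dirDeriv_mul (v := velDir j) (velCoord j).differentiableAt hf

theorem dirDeriv_velDir_potential_mul (hV : ContDiff ℝ ∞ V) {f : Phase d → ℝ} {x : Phase d}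
    (hf : DifferentiableAt ℝ f x) (i j : Fin d) :
    ∂[velDir j] (fun y => ∂[stdDir i] V y.1 * f y) x = ∂[stdDir i] V x.1 * ∂[velDir j] f x := by
  have hV' : Differentiable ℝ (∂[stdDir i] V) := (contDiff_dirDeriv hV).differentiable (by simp)
  rw [dirDeriv_mul (by fun_prop) hf, dirDeriv_velDir_comp_fst (hV' _), zero_mul, add_zero]

theorem dirDeriv_velocity_flux (hV : ContDiff ℝ ∞ V) {u : Phase d → ℝ} (hu : ContDiff ℝ ∞ u)
    (x : Phase d) (j : Fin d) :
    ∂[velDir j] (fun y => (∂[stdDir j] V y.1 + σ * β * y.2 j) * u y + σ * ∂[velDir j] u y) x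
      = ∂[stdDir j] V x.1 * ∂[velDir j] u x + σ * β * (x.2 j * ∂[velDir j] u x + u x)
        + σ * ∂[velDir j] (∂[velDir j] u) x := by
  have hdiff {f : Phase d → ℝ} (hf : ContDiff ℝ ∞ f) : DifferentiableAt ℝ f x :=
    hf.differentiable (by simp) x
  have hsplit : (fun y : Phase d =>
      (∂[stdDir j] V y.1 + σ * β * y.2 j) * u y + σ * ∂[velDir j] u y)
      = fun y => (∂[stdDir j] V y.1 * u y + σ * β * (y.2 j * u y)) + σ * ∂[velDir j] u y := by
    ext y
    ring
  rw [hsplit, dirDeriv_add (hdiff (by fun_prop)) (hdiff (by fun_prop)),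
    dirDeriv_add (hdiff (by fun_prop)) (hdiff (by fun_prop)),
    dirDeriv_const_mul (hdiff (by fun_prop)), dirDeriv_const_mul (hdiff (by fun_prop)),
    dirDeriv_velDir_potential_mul hV (hdiff hu), dirDeriv_velDir_velocity_mul (hdiff hu)]

section Duality

variable {φ u : Phase d → ℝ}

theorem integral_mul_transport (hφ : ContDiff ℝ ∞ φ) (hc : HasCompactSupport φ)
    (hu : ContDiff ℝ ∞ u) (j : Fin d) :
    ∫ x, φ x * -(x.2 j * ∂[posDir j] u x) = ∫ x, x.2 j * ∂[posDir j] φ x * u x := by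
  have := integral_mul_dirDeriv_of_contDiff (v := posDir j) (f := fun y => y.2 j * φ y)
    (by fun_prop) hc.mul_left hu
  simp_rw [dirDeriv_posDir_velocity_mul (hφ.differentiable (by simp) _)] at this
  rw [← neg_eq_iff_eq_neg.2 this, ← integral_neg]
  congr 1 with x
  ring

theorem integrable_mul_of_contDiff {a b : Phase d → ℝ} (ha : ContDiff ℝ ∞ a)
    (hac : HasCompactSupport a) (hb : ContDiff ℝ ∞ b) : Integrable fun x => a x * b x :=
  (by fun_prop : Continuous fun x => a x * b x).integrable_of_hasCompactSupport hac.mul_right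

theorem integral_mul_velocity_flux (hV : ContDiff ℝ ∞ V) (hφ : ContDiff ℝ ∞ φ)
    (hc : HasCompactSupport φ) (hu : ContDiff ℝ ∞ u) (j : Fin d) :
    ∫ x, φ x * ∂[velDir j]
        (fun y => (∂[stdDir j] V y.1 + σ * β * y.2 j) * u y + σ * ∂[velDir j] u y) x
      = ∫ x, (-(∂[stdDir j] V x.1 * ∂[velDir j] φ x)
        + σ * (∂[velDir j] (∂[velDir j] φ) x - β * x.2 j * ∂[velDir j] φ x)) * u x := by
  have hφc := hasCompactSupport_dirDeriv hc (velDir j)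
  have hsecond := integral_mul_dirDeriv_of_contDiff (contDiff_dirDeriv hφ) hφc hu (v := velDir j)
  rw [integral_mul_dirDeriv_of_contDiff hφ hc (by fun_prop), ← integral_neg]
  have hleft (x : Phase d) : -(∂[velDir j] φ x
      * ((∂[stdDir j] V x.1 + σ * β * x.2 j) * u x + σ * ∂[velDir j] u x))
      = ∂[velDir j] φ x * (-(∂[stdDir j] V x.1 + σ * β * x.2 j) * u x)
        - σ * (∂[velDir j] φ x * ∂[velDir j] u x) := by
    ring
  have hright (x : Phase d) : (-(∂[stdDir j] V x.1 * ∂[velDir j] φ x)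
      + σ * (∂[velDir j] (∂[velDir j] φ) x - β * x.2 j * ∂[velDir j] φ x)) * u x
      = ∂[velDir j] φ x * (-(∂[stdDir j] V x.1 + σ * β * x.2 j) * u x)
        + σ * (∂[velDir j] (∂[velDir j] φ) x * u x) := by
    ring
  simp_rw [hleft, hright]
  rw [integral_sub (integrable_mul_of_contDiff (by fun_prop) hφc (by fun_prop))
    ((integrable_mul_of_contDiff (by fun_prop) hφc (by fun_prop)).const_mul σ),
    integral_add (integrable_mul_of_contDiff (by fun_prop) hφc (by fun_prop))
    ((integrable_mul_of_contDiff (by fun_prop) (hasCompactSupport_dirDeriv hφc _) hu).const_mul σ),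
    integral_const_mul, integral_const_mul, hsecond]
  ring

theorem integral_mul_kineticAdjoint (hV : ContDiff ℝ ∞ V) (hφ : ContDiff ℝ ∞ φ)
    (hc : HasCompactSupport φ) (hu : ContDiff ℝ ∞ u) :
    ∫ x, φ x * kineticAdjoint V β σ u x = ∫ x, kineticGenerator V β σ φ x * u x := by
  have hφc (j : Fin d) := hasCompactSupport_dirDeriv hc (velDir j)
  have hleft (j : Fin d) := integrable_mul_of_contDiff hφ hc
    (by fun_prop : ContDiff ℝ ∞ fun x => -(x.2 j * ∂[posDir j] u x))
  have hright (j : Fin d) := integrable_mul_of_contDiff hφ hc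
    (by fun_prop : ContDiff ℝ ∞ (∂[velDir j] fun y : Phase d =>
      (∂[stdDir j] V y.1 + σ * β * y.2 j) * u y + σ * ∂[velDir j] u y))
  have hpos (j : Fin d) := integrable_mul_of_contDiff
    (by fun_prop : ContDiff ℝ ∞ fun x => x.2 j * ∂[posDir j] φ x)
    (hasCompactSupport_dirDeriv hc _).mul_left hu
  have hvel (j : Fin d) := integrable_mul_of_contDiff (by fun_prop : ContDiff ℝ ∞ fun x : Phase d =>
      -(∂[stdDir j] V x.1 * ∂[velDir j] φ x)
        + σ * (∂[velDir j] (∂[velDir j] φ) x - β * x.2 j * ∂[velDir j] φ x))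
    (((hφc j).mul_left.neg).add
      (((hasCompactSupport_dirDeriv (hφc j) _).sub ((hφc j).mul_left)).mul_left)) hu
  calc ∫ x, φ x * kineticAdjoint V β σ u x
      = ∑ j, ((∫ x, φ x * -(x.2 j * ∂[posDir j] u x)) + ∫ x, φ x * ∂[velDir j] (fun y =>
          (∂[stdDir j] V y.1 + σ * β * y.2 j) * u y + σ * ∂[velDir j] u y) x) := by
        simp only [kineticAdjoint, Finset.mul_sum, mul_add]
        rw [integral_finsetSum _ fun j _ => (hleft j).fun_add (hright j)]
        exact Finset.sum_congr rfl fun j _ => integral_add (hleft j) (hright j)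
    _ = ∑ j, ((∫ x, x.2 j * ∂[posDir j] φ x * u x)
          + ∫ x, (-(∂[stdDir j] V x.1 * ∂[velDir j] φ x)
            + σ * (∂[velDir j] (∂[velDir j] φ) x - β * x.2 j * ∂[velDir j] φ x)) * u x) := by
        simp_rw [integral_mul_transport hφ hc hu, integral_mul_velocity_flux hV hφ hc hu]
    _ = ∫ x, kineticGenerator V β σ φ x * u x := by
        simp_rw [← integral_add (hpos _) (hvel _)]
        rw [← integral_finsetSum _ fun j _ => (hpos j).fun_add (hvel j)]
        congr 1 with x
        rw [kineticGenerator, Finset.sum_mul]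
        exact Finset.sum_congr rfl fun j _ => by ring

end Duality

section Energy

theorem expEnergy_pos (b : ℝ) (V : Param d → ℝ) (x : Phase d) : 0 < expEnergy b V x :=
  Real.exp_pos _

theorem expEnergy_neg_mul (b : ℝ) (V : Param d → ℝ) (x : Phase d) :
    expEnergy (-b) V x * expEnergy b V x = 1 := by
  rw [expEnergy, expEnergy, ← Real.exp_add, neg_mul, neg_add_cancel, Real.exp_zero]

@[fun_prop]
theorem contDiff_expEnergy (hV : ContDiff ℝ ∞ V) (b : ℝ) : ContDiff ℝ ∞ (expEnergy b V) := by
  unfold expEnergy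
  have : ContDiff ℝ ∞ fun x : Phase d => ‖x.2‖ ^ 2 := contDiff_snd.norm_sq ℝ
  fun_prop

theorem differentiable_half_norm_sq : Differentiable ℝ fun r : Param d => ‖r‖ ^ 2 / 2 := by
  have hsq : Differentiable ℝ fun r : Param d => ‖r‖ ^ 2 := differentiable_id.norm_sq ℝ
  fun_prop

theorem dirDeriv_half_norm_sq (j : Fin d) (r : Param d) :
    ∂[stdDir j] (fun y => ‖y‖ ^ 2 / 2) r = r j := by
  have h := (hasStrictFDerivAt_norm_sq r).hasFDerivAt.const_mul (1 / 2 : ℝ)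
  simp_rw [show ∀ y : Param d, ‖y‖ ^ 2 / 2 = 1 / 2 * ‖y‖ ^ 2 from fun y => by ring]
  rw [dirDeriv, h.fderiv]
  simp [stdDir, EuclideanSpace.inner_single_right]

theorem dirDeriv_expEnergy (hV : Differentiable ℝ V) (b : ℝ) (v x : Phase d) :
    ∂[v] (expEnergy b V) x
      = b * expEnergy b V x * (∂[v.1] V x.1 + ∂[v.2] (fun r => ‖r‖ ^ 2 / 2) x.2) := by
  have hV' : DifferentiableAt ℝ (fun y : Phase d => V y.1) x := by fun_prop
  have hK' : DifferentiableAt ℝ (fun y : Phase d => ‖y.2‖ ^ 2 / 2) x :=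
    (differentiable_half_norm_sq x.2).comp x differentiableAt_snd
  unfold expEnergy
  rw [dirDeriv_comp (Real.hasDerivAt_exp _) ((hV'.fun_add hK').const_mul b),
    dirDeriv_const_mul (hV'.fun_add hK'), dirDeriv_add hV' hK', dirDeriv_comp_fst (hV _),
    dirDeriv_comp_snd (f := fun r => ‖r‖ ^ 2 / 2) (differentiable_half_norm_sq _)]
  ring

theorem dirDeriv_posDir_expEnergy (hV : Differentiable ℝ V) (b : ℝ) (j : Fin d) (x : Phase d) :
    ∂[posDir j] (expEnergy b V) x = b * ∂[stdDir j] V x.1 * expEnergy b V x := by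
  rw [dirDeriv_expEnergy hV, show (posDir j : Phase d).2 = 0 from rfl, dirDeriv, dirDeriv,
    map_zero, dirDeriv, posDir]
  ring

theorem dirDeriv_velDir_expEnergy (hV : Differentiable ℝ V) (b : ℝ) (j : Fin d) (x : Phase d) :
    ∂[velDir j] (expEnergy b V) x = b * x.2 j * expEnergy b V x := by
  rw [dirDeriv_expEnergy hV, show (velDir j : Phase d).1 = 0 from rfl, dirDeriv, map_zero,
    show (velDir j : Phase d).2 = stdDir j from rfl, dirDeriv_half_norm_sq]
  ring

theorem kineticAdjoint_expEnergy_mul (hV : ContDiff ℝ ∞ V) {h : Phase d → ℝ}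
    (hh : ContDiff ℝ ∞ h) (x : Phase d) :
    kineticAdjoint V β σ (fun y => expEnergy (-β) V y * h y) x
      = expEnergy (-β) V x * kineticDual V β σ h x := by
  have hdiff {f : Phase d → ℝ} (hf : ContDiff ℝ ∞ f) : Differentiable ℝ f :=
    hf.differentiable (by simp)
  have hV' : Differentiable ℝ V := hV.differentiable (by simp)
  have hm := contDiff_expEnergy hV (-β)
  have hflux (j : Fin d) : (fun y : Phase d => (∂[stdDir j] V y.1 + σ * β * y.2 j)
        * (expEnergy (-β) V y * h y) + σ * ∂[velDir j] (fun z => expEnergy (-β) V z * h z) y)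
      = fun y => expEnergy (-β) V y * (∂[stdDir j] V y.1 * h y + σ * ∂[velDir j] h y) := by
    ext y
    rw [dirDeriv_mul (hdiff hm y) (hdiff hh y), dirDeriv_velDir_expEnergy hV']
    ring
  rw [kineticAdjoint, kineticDual, Finset.mul_sum]
  refine Finset.sum_congr rfl fun j _ => ?_
  rw [hflux, dirDeriv_mul (hdiff hm x) (hdiff hh x),
    dirDeriv_mul (g := fun y => _ + _) (hdiff hm x) (hdiff (by fun_prop) x),
    dirDeriv_velDir_expEnergy hV', dirDeriv_posDir_expEnergy hV',
    dirDeriv_add (hdiff (by fun_prop) x) (hdiff (by fun_prop) x),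
    dirDeriv_velDir_potential_mul hV (hdiff hh x), dirDeriv_const_mul (hdiff (by fun_prop) x)]
  ring

theorem kineticDual_comp {h : Phase d → ℝ} (hh : ContDiff ℝ ∞ h) {Φ Φ' : ℝ → ℝ} {c : ℝ}
    {x : Phase d} (hΦ : ∀ y, HasDerivAt Φ (Φ' (h y)) (h y)) (hΦ' : HasDerivAt Φ' c (h x)) :
    kineticDual V β σ (fun y => Φ (h y)) x
      = Φ' (h x) * kineticDual V β σ h x + σ * c * ∑ j, ∂[velDir j] h x ^ 2 := by
  have hh' : Differentiable ℝ h := hh.differentiable (by simp)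
  have hsecond (j : Fin d) : ∂[velDir j] (∂[velDir j] fun y => Φ (h y)) x
      = Φ' (h x) * ∂[velDir j] (∂[velDir j] h) x + c * ∂[velDir j] h x * ∂[velDir j] h x := by
    rw [show (∂[velDir j] fun y => Φ (h y)) = fun y => Φ' (h y) * ∂[velDir j] h y from
        funext fun y => dirDeriv_comp (hΦ y) (hh' y),
      dirDeriv_mul (f := fun y => Φ' (h y)) (hΦ'.differentiableAt.comp x (hh' x))
        ((contDiff_dirDeriv hh).differentiable (by simp) x), dirDeriv_comp hΦ' (hh' x)]
  rw [kineticDual, kineticDual, Finset.mul_sum, Finset.mul_sum, ← Finset.sum_add_distrib]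
  refine Finset.sum_congr rfl fun j _ => ?_
  rw [hsecond, dirDeriv_comp (hΦ x) (hh' x), dirDeriv_comp (hΦ x) (hh' x)]
  ring

end Energy

end Adjoint

/-! ### Regularization of weak stationary solutions -/

section Kernel

variable {d : ℕ}

theorem IsMollifier.prod {δ τ : ℝ} {f k : Param d → ℝ} (hf : IsMollifier δ f)
    (hk : IsMollifier τ k) :
    IsMollifier (max δ τ) (fun z : Phase d => f z.1 * k z.2) where
  contDiff := (hf.contDiff.comp contDiff_fst).mul (hk.contDiff.comp contDiff_snd)
  hasCompactSupport := hasCompactSupport_fst_mul_snd hf.hasCompactSupport hk.hasCompactSupport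
  nonneg z := mul_nonneg (hf.nonneg _) (hk.nonneg _)
  integral_eq_one := by
    have := integral_prod_mul (μ := (volume : Measure (Param d))) (ν := volume) f k
    rwa [hf.integral_eq_one, hk.integral_eq_one, one_mul] at this
  eq_zero z hz := by
    rcases le_max_iff.1 (hz.trans_eq (Prod.norm_def z)) with h | h
    · rw [hf.eq_zero _ ((le_max_left δ τ).trans h), zero_mul]
    · rw [hk.eq_zero _ ((le_max_right δ τ).trans h), mul_zero]

theorem IsMollifier.abs_apply_mul_le {τ : ℝ} {k : Param d → ℝ} (hk : IsMollifier τ k) (j : Fin d)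
    (r : Param d) : |r j| * k r ≤ τ * k r := by
  rcases lt_or_ge ‖r‖ τ with h | h
  · exact mul_le_mul_of_nonneg_right ((PiLp.norm_apply_le r j).trans h.le) (hk.nonneg r)
  · simp [hk.eq_zero r h]

theorem integral_abs_velocity_mul_dirDeriv_prod_le {τ : ℝ} {f k : Param d → ℝ}
    (hf : ContDiff ℝ ∞ f) (hfc : HasCompactSupport f) (hk : IsMollifier τ k) (j : Fin d) :
    ∫ z : Phase d, |z.2 j * ∂[posDir j] (fun z => f z.1 * k z.2) z|
      ≤ τ * ∫ θ, |∂[stdDir j] f θ| := by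
  have hderiv (z : Phase d) : ∂[posDir j] (fun z : Phase d => f z.1 * k z.2) z
      = ∂[stdDir j] f z.1 * k z.2 := by
    have hf' := hf.differentiable (by simp)
    have hk' := hk.contDiff.differentiable (by simp)
    rw [dirDeriv_mul (f := fun z : Phase d => f z.1) (g := fun z : Phase d => k z.2)
      (by fun_prop) (by fun_prop), dirDeriv_comp_fst (hf' _), dirDeriv_posDir_comp_snd (hk' _),
      mul_zero, zero_add]
    rfl
  have hint : Integrable fun z : Phase d => |∂[stdDir j] f z.1| * k z.2 :=
    ((contDiff_dirDeriv hf).continuous.integrable_of_hasCompactSupport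
      (hasCompactSupport_dirDeriv hfc _)).abs.mul_prod hk.integrable
  calc ∫ z : Phase d, |z.2 j * ∂[posDir j] (fun z => f z.1 * k z.2) z|
      ≤ ∫ z : Phase d, τ * (|∂[stdDir j] f z.1| * k z.2) := by
        refine integral_mono_of_nonneg (ae_of_all _ fun z => abs_nonneg _) (hint.const_mul τ)
          (ae_of_all _ fun z => ?_)
        have := mul_le_mul_of_nonneg_left (hk.abs_apply_mul_le j z.2)
          (abs_nonneg (∂[stdDir j] f z.1))
        simp only [hderiv, abs_mul, abs_of_nonneg (hk.nonneg z.2)]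
        linarith
    _ = τ * ∫ θ, |∂[stdDir j] f θ| := by
        have := integral_prod_mul (μ := (volume : Measure (Param d))) (ν := volume)
          (fun θ => |∂[stdDir j] f θ|) k
        rw [hk.integral_eq_one, mul_one] at this
        rw [integral_const_mul, ← this]
        rfl

theorem eventually_mul_le (c : ℝ) {κ : ℝ} (hκ : 0 < κ) : ∀ᶠ τ in 𝓝[>] (0 : ℝ), τ * c ≤ κ := by
  have : Tendsto (fun τ : ℝ => τ * c) (𝓝 0) (𝓝 0) := by
    simpa using (continuous_mul_const c).tendsto 0
  exact (this.mono_left nhdsWithin_le_nhds).eventually (eventually_le_nhds hκ)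

-- The velocity scale is chosen after the position profile, hence after its derivatives.
theorem exists_isMollifier_velocity_le {δ κ : ℝ} (hδ : 0 < δ) (hκ : 0 < κ) :
    ∃ η : Phase d → ℝ, IsMollifier δ η ∧ (∀ j z, |z.2 j * η z| ≤ κ * η z) ∧
      ∀ j, ∫ z, |z.2 j * ∂[posDir j] η z| ≤ κ := by
  obtain ⟨f, hf⟩ := exists_isMollifier (G := Param d) hδ
  obtain ⟨τ, hderiv, hτκ, hτδ, hτ⟩ := ((eventually_all.2 fun j : Fin d =>
    eventually_mul_le (∫ θ, |∂[stdDir j] f θ|) hκ).and <| (eventually_mul_le 1 hκ).and <|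
      ((eventually_le_nhds hδ).filter_mono nhdsWithin_le_nhds).and self_mem_nhdsWithin).exists
  obtain ⟨k, hk⟩ := exists_isMollifier (G := Param d) hτ
  refine ⟨fun z => f z.1 * k z.2, max_eq_left hτδ ▸ hf.prod hk, fun j z => ?_, fun j =>
    (integral_abs_velocity_mul_dirDeriv_prod_le hf.contDiff hf.hasCompactSupport hk j).trans
      (hderiv j)⟩
  have hvel := (hk.abs_apply_mul_le j z.2).trans
    (mul_le_mul_of_nonneg_right (by simpa using hτκ) (hk.nonneg z.2))
  have := mul_le_mul_of_nonneg_left hvel (hf.nonneg z.1)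
  rw [abs_mul, abs_of_nonneg (mul_nonneg (hf.nonneg z.1) (hk.nonneg z.2))]
  linarith

end Kernel

section SmoothPotential

variable {d : ℕ} {V : Param d → ℝ} {L : NNReal}

theorem tendsto_integral_abs_dirDeriv_mollify_sub (hV : Differentiable ℝ V)
    (hL : LipschitzWith L V) {ρ : Phase d → ℝ} (hρ : Integrable ρ) (j : Fin d) :
    Tendsto (fun n => ∫ x : Phase d, |∂[stdDir j] V x.1
      - ∂[stdDir j] (mollify (stdMollifier (Param d) n) V) x.1| * |ρ x|) atTop (𝓝 0) := by
  have hlip (n : ℕ) := (isMollifier_stdMollifier (G := Param d) n).lipschitzWith_mollify hL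
  have hmeas (W : Param d → ℝ) : Measurable fun x : Phase d => ∂[stdDir j] W x.1 :=
    (measurable_dirDeriv _ _).comp measurable_fst
  rw [← integral_zero (Phase d) ℝ]
  refine tendsto_integral_of_dominated_convergence (fun x => 2 * L * |ρ x|)
    (fun n => ((hmeas V).sub (hmeas _)).abs.aestronglyMeasurable.mul hρ.abs.1)
    (hρ.abs.const_mul _) (fun n => ae_of_all _ fun x => ?_) ?_
  · rw [Real.norm_of_nonneg (by positivity)]
    gcongr
    linarith [abs_sub (∂[stdDir j] V x.1) (∂[stdDir j] (mollify (stdMollifier _ n) V) x.1),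
      abs_dirDeriv_stdDir_le hL j x.1, abs_dirDeriv_stdDir_le (hlip n) j x.1]
  · have hlim := ae_tendsto_dirDeriv_mollify_stdMollifier hV hL (stdDir j)
    filter_upwards [Measure.quasiMeasurePreserving_fst.ae hlim] with x hx
    simpa using (hx.const_sub (∂[stdDir j] V x.1)).abs.mul_const |ρ x|

theorem exists_smooth_potential (hV : Differentiable ℝ V) (hL : LipschitzWith L V)
    {ρ : Phase d → ℝ} (hρ : Integrable ρ) {κ : ℝ} (hκ : 0 < κ) :
    ∃ U : Param d → ℝ, ContDiff ℝ ∞ U ∧ LipschitzWith L U ∧ (∀ θ, |U θ - V θ| ≤ κ) ∧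
      ∀ j, ∫ x : Phase d, |∂[stdDir j] V x.1 - ∂[stdDir j] U x.1| * |ρ x| ≤ κ := by
  have hscale : Tendsto (fun n : ℕ => L * (2 / (n + 1 : ℝ))) atTop (𝓝 0) := by
    simpa [div_eq_mul_inv] using
      ((tendsto_one_div_add_atTop_nhds_zero_nat (𝕜 := ℝ)).const_mul (2 : ℝ)).const_mul (L : ℝ)
  obtain ⟨n, hn, hforce⟩ := ((hscale.eventually (eventually_le_nhds hκ)).and
    (eventually_all.2 fun j => (tendsto_integral_abs_dirDeriv_mollify_sub hV hL hρ j).eventually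
      (eventually_le_nhds hκ))).exists
  have hk := isMollifier_stdMollifier (G := Param d) n
  exact ⟨mollify (stdMollifier _ n) V,
    contDiff_mollify hk.contDiff hk.hasCompactSupport hL.continuous.locallyIntegrable,
    hk.lipschitzWith_mollify hL, fun θ => (hk.abs_mollify_sub_le hL θ).trans hn, hforce⟩

end SmoothPotential

section Regularization

variable {d : ℕ} {V U : Param d → ℝ} {β σ : ℝ} {η ρ : Phase d → ℝ}

/-- The error in the velocity flux when `ρ` is mollified and the potential `V` is replaced by `U`:
mollification commutes neither with the force nor with the friction. -/
def fluxError (V U : Param d → ℝ) (β σ : ℝ) (η ρ : Phase d → ℝ) (j : Fin d) (x : Phase d) : ℝ :=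
  mollify η (fun y => ∂[stdDir j] V y.1 * ρ y) x - ∂[stdDir j] U x.1 * mollify η ρ x
    - σ * β * mollify (fun z => z.2 j * η z) ρ x

/-- The commutator of mollification with the transport term `r · ∇_θ`, applied to `ρ`. -/
def transportError (η ρ : Phase d → ℝ) (x : Phase d) : ℝ :=
  ∑ j, mollify (fun z => z.2 j * ∂[posDir j] η z) ρ x

theorem integrable_dirDeriv_mul {L : NNReal} (hL : LipschitzWith L V)
    (hρ : Integrable ρ) (j : Fin d) : Integrable fun y => ∂[stdDir j] V y.1 * ρ y := by
  refine hρ.bdd_mul ((measurable_dirDeriv _ V).comp measurable_fst).aestronglyMeasurable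
    (c := L * ‖stdDir j‖) (ae_of_all _ fun y => abs_dirDeriv_le hL _ _)

theorem IsWeakStationary.mollified_equation
    (h : IsWeakStationary V β σ ρ) (hη : ContDiff ℝ ∞ η) (hc : HasCompactSupport η)
    (hρ : LocallyIntegrable ρ)
    (hVρ : ∀ j, LocallyIntegrable fun y : Phase d => ∂[stdDir j] V y.1 * ρ y) (x : Phase d) :
    ∑ j, (-mollify (∂[posDir j] η) (fun y => y.2 j * ρ y) x
      + mollify (∂[velDir j] η) (fun y => ∂[stdDir j] V y.1 * ρ y) x
      + σ * mollify (∂[velDir j] (∂[velDir j] η)) ρ x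
      + σ * β * mollify (∂[velDir j] η) (fun y => y.2 j * ρ y) x) = 0 := by
  have hint {k f : Phase d → ℝ} (hk : ContDiff ℝ ∞ k) (hkc : HasCompactSupport k)
      (hf : LocallyIntegrable f) : Integrable fun y => k (x - y) * f y :=
    integrable_comp_sub_mul hk.continuous hkc hf x
  have hvel (j : Fin d) := hasCompactSupport_dirDeriv hc (velDir j)
  have hvρ (j : Fin d) : LocallyIntegrable fun y : Phase d => y.2 j * ρ y :=
    hρ.continuous_mul (velCoord j).continuous
  have hpos' (j : Fin d) := (hint (contDiff_dirDeriv hη)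
    (hasCompactSupport_dirDeriv hc (posDir j)) (hvρ j)).fun_neg
  have hforce' (j : Fin d) := hint (contDiff_dirDeriv hη) (hvel j) (hVρ j)
  have hdiff' (j : Fin d) := (hint (contDiff_dirDeriv (contDiff_dirDeriv hη))
    (hasCompactSupport_dirDeriv (hvel j) (velDir j)) hρ).const_mul σ
  have hfric (j : Fin d) := (hint (contDiff_dirDeriv hη) (hvel j) (hvρ j)).const_mul (σ * β)
  have hterm (j : Fin d) := ((hpos' j).fun_add (hforce' j)).fun_add
    ((hdiff' j).fun_add (hfric j))
  calc _ = ∑ j, ∫ y, (-(∂[posDir j] η (x - y) * (y.2 j * ρ y))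
        + ∂[velDir j] η (x - y) * (∂[stdDir j] V y.1 * ρ y)
        + (σ * (∂[velDir j] (∂[velDir j] η) (x - y) * ρ y)
          + σ * β * (∂[velDir j] η (x - y) * (y.2 j * ρ y)))) := by
        refine Finset.sum_congr rfl fun j _ => ?_
        rw [integral_add ((hpos' j).fun_add (hforce' j)) ((hdiff' j).fun_add (hfric j)),
          integral_add (hpos' j) (hforce' j), integral_add (hdiff' j) (hfric j), integral_neg,
          integral_const_mul, integral_const_mul, ← add_assoc]
        simp only [mollify_apply]
    _ = ∫ y, kineticGenerator V β σ (fun y => η (x - y)) y * ρ y := by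
        rw [← integral_finsetSum _ fun j _ => hterm j]
        congr 1 with y
        simp_rw [kineticGenerator, Finset.sum_mul, dirDeriv_dirDeriv_comp_const_sub hη,
          dirDeriv_comp_const_sub (hη.differentiable (by simp))]
        exact Finset.sum_congr rfl fun j _ => by ring
    _ = 0 := h _ (by fun_prop) (hc.comp_homeomorph (Homeomorph.subLeft x))

theorem dirDeriv_velDir_fluxError (hU : ContDiff ℝ ∞ U) (hη : ContDiff ℝ ∞ η)
    (hc : HasCompactSupport η) (hρ : LocallyIntegrable ρ) (j : Fin d)
    (hVρ : LocallyIntegrable fun y : Phase d => ∂[stdDir j] V y.1 * ρ y) (x : Phase d) :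
    ∂[velDir j] (fluxError V U β σ η ρ j) x
      = ∂[velDir j] (mollify η fun y => ∂[stdDir j] V y.1 * ρ y) x
        - ∂[stdDir j] U x.1 * ∂[velDir j] (mollify η ρ) x
        - σ * β * ∂[velDir j] (mollify (fun z => z.2 j * η z) ρ) x := by
  have hdiff {f : Phase d → ℝ} (hf : ContDiff ℝ ∞ f) : DifferentiableAt ℝ f x :=
    hf.differentiable (by simp) x
  have hu := contDiff_mollify hη hc hρ
  have hkη := contDiff_mollify (by fun_prop : ContDiff ℝ ∞ fun z => z.2 j * η z) hc.mul_left hρ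
  have hforce := contDiff_mollify hη hc hVρ
  unfold fluxError
  rw [dirDeriv_sub (hdiff (by fun_prop)) (hdiff (by fun_prop)),
    dirDeriv_sub (hdiff (by fun_prop)) (hdiff (by fun_prop)),
    dirDeriv_velDir_potential_mul hU (hdiff hu), dirDeriv_const_mul (hdiff hkη)]

theorem IsWeakStationary.kineticAdjoint_mollify_add_eq_zero
    (h : IsWeakStationary V β σ ρ) (hU : ContDiff ℝ ∞ U) (hη : ContDiff ℝ ∞ η)
    (hc : HasCompactSupport η) (hρ : LocallyIntegrable ρ)
    (hVρ : ∀ j, LocallyIntegrable fun y : Phase d => ∂[stdDir j] V y.1 * ρ y) (x : Phase d) :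
    kineticAdjoint U β σ (mollify η ρ) x + ∑ j, ∂[velDir j] (fluxError V U β σ η ρ j) x
      + transportError η ρ x = 0 := by
  have hdiff {f : Phase d → ℝ} (hf : ContDiff ℝ ∞ f) : DifferentiableAt ℝ f x :=
    hf.differentiable (by simp) x
  have hu := contDiff_mollify hη hc hρ
  rw [← h.mollified_equation hη hc hρ hVρ x, kineticAdjoint, transportError,
    ← Finset.sum_add_distrib, ← Finset.sum_add_distrib]
  refine Finset.sum_congr rfl fun j _ => ?_
  have hkη := contDiff_mollify (by fun_prop : ContDiff ℝ ∞ fun z => z.2 j * η z) hc.mul_left hρ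
  have hvρ : LocallyIntegrable fun y : Phase d => y.2 j * ρ y :=
    hρ.continuous_mul (velCoord j).continuous
  have htransport := mollify_clm_mul (velCoord j) (contDiff_dirDeriv (v := posDir j) hη).continuous
    (hasCompactSupport_dirDeriv hc _) hρ x
  have hfriction : mollify η (fun y => y.2 j * ρ y)
      = fun y => y.2 j * mollify η ρ y - mollify (fun z => z.2 j * η z) ρ y :=
    funext (mollify_clm_mul (velCoord j) hη.continuous hc hρ)
  simp only [velCoord_apply] at htransport
  rw [htransport, ← dirDeriv_mollify hη hc (hVρ j), ← dirDeriv_mollify hη hc hvρ,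
    ← dirDeriv_mollify (contDiff_dirDeriv hη) (hasCompactSupport_dirDeriv hc _) hρ,
    ← dirDeriv_mollify hη hc hρ, ← dirDeriv_mollify hη hc hρ, hfriction,
    dirDeriv_velocity_flux hU hu, dirDeriv_velDir_fluxError hU hη hc hρ j (hVρ j),
    dirDeriv_sub (hdiff (by fun_prop)) (hdiff hkη), dirDeriv_velDir_velocity_mul (hdiff hu)]
  ring

end Regularization

section ErrorBounds

variable {d : ℕ} {V U : Param d → ℝ} {β σ δ τ : ℝ} {η ρ : Phase d → ℝ} {L : NNReal}

theorem IsMollifier.mollify_nonneg (hη : IsMollifier δ η) (hρ0 : ∀ᵐ x, 0 ≤ ρ x) (x : Phase d) :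
    0 ≤ mollify η ρ x := by
  rw [mollify_apply]
  exact integral_nonneg_of_ae (hρ0.mono fun y hy => mul_nonneg (hη.nonneg _) hy)

theorem IsMollifier.abs_mollify_velocity_mul_le (hη : IsMollifier δ η)
    (hητ : ∀ j z, |z.2 j * η z| ≤ τ * η z) (hρ : Integrable ρ) (hρ0 : ∀ᵐ x, 0 ≤ ρ x) (j : Fin d)
    (x : Phase d) : |mollify (fun z => z.2 j * η z) ρ x| ≤ τ * mollify η ρ x := by
  rw [← mollify_const_mul_left]
  exact abs_mollify_le (hη.contDiff.continuous.const_mul τ) hη.hasCompactSupport.mul_left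
    hρ.locallyIntegrable (hητ j) (hρ0.mono fun y hy => (abs_of_nonneg hy).le) x

theorem IsMollifier.abs_fluxError_le (hη : IsMollifier δ η)
    (hητ : ∀ j z, |z.2 j * η z| ≤ τ * η z) (hV : LipschitzWith L V) (hU : LipschitzWith L U)
    (hρ : Integrable ρ) (hρ0 : ∀ᵐ x, 0 ≤ ρ x) (j : Fin d) (x : Phase d) :
    |fluxError V U β σ η ρ j x| ≤ (2 * L + |σ * β| * τ) * mollify η ρ x := by
  have hforce : |mollify η (fun y => ∂[stdDir j] V y.1 * ρ y) x| ≤ L * mollify η ρ x := by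
    rw [← mollify_const_mul_right]
    refine abs_mollify_le hη.contDiff.continuous hη.hasCompactSupport
      (hρ.const_mul _).locallyIntegrable (fun z => (abs_of_nonneg (hη.nonneg z)).le)
      (hρ0.mono fun y hy => ?_) x
    rw [abs_mul, abs_of_nonneg hy]
    exact mul_le_mul_of_nonneg_right (abs_dirDeriv_stdDir_le hV j y.1) hy
  have hpot : |∂[stdDir j] U x.1 * mollify η ρ x| ≤ L * mollify η ρ x := by
    rw [abs_mul, abs_of_nonneg (hη.mollify_nonneg hρ0 x)]
    exact mul_le_mul_of_nonneg_right (abs_dirDeriv_stdDir_le hU j x.1) (hη.mollify_nonneg hρ0 x)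
  have hfric : |σ * β * mollify (fun z => z.2 j * η z) ρ x| ≤ |σ * β| * (τ * mollify η ρ x) := by
    rw [abs_mul]
    exact mul_le_mul_of_nonneg_left (hη.abs_mollify_velocity_mul_le hητ hρ hρ0 j x)
      (abs_nonneg _)
  rw [fluxError]
  refine ((abs_sub _ _).trans (add_le_add (abs_sub _ _) le_rfl)).trans ?_
  linarith

theorem IsMollifier.abs_fluxError_le_add (hη : IsMollifier δ η)
    (hητ : ∀ j z, |z.2 j * η z| ≤ τ * η z) (hU : LipschitzWith L U)
    (hρ : Integrable ρ) (hρ0 : ∀ᵐ x, 0 ≤ ρ x) (j : Fin d) (x : Phase d) :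
    |fluxError V U β σ η ρ j x|
      ≤ |mollify η (fun y => ∂[stdDir j] V y.1 * ρ y) x - ∂[stdDir j] V x.1 * ρ x|
        + |∂[stdDir j] V x.1 - ∂[stdDir j] U x.1| * |ρ x|
        + L * |mollify η ρ x - ρ x| + |σ * β| * τ * |mollify η ρ x| := by
  have hpot : |∂[stdDir j] U x.1 * (mollify η ρ x - ρ x)| ≤ L * |mollify η ρ x - ρ x| := by
    rw [abs_mul]
    exact mul_le_mul_of_nonneg_right (abs_dirDeriv_stdDir_le hU j x.1) (abs_nonneg _)
  have hfric : |σ * β * mollify (fun z => z.2 j * η z) ρ x| ≤ |σ * β| * τ * |mollify η ρ x| := by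
    rw [abs_mul, mul_assoc, abs_of_nonneg (hη.mollify_nonneg hρ0 x)]
    exact mul_le_mul_of_nonneg_left (hη.abs_mollify_velocity_mul_le hητ hρ hρ0 j x)
      (abs_nonneg _)
  rw [← abs_mul]
  calc |fluxError V U β σ η ρ j x|
      = |(mollify η (fun y => ∂[stdDir j] V y.1 * ρ y) x - ∂[stdDir j] V x.1 * ρ x)
        + (∂[stdDir j] V x.1 - ∂[stdDir j] U x.1) * ρ x
        - ∂[stdDir j] U x.1 * (mollify η ρ x - ρ x)
        - σ * β * mollify (fun z => z.2 j * η z) ρ x| := by rw [fluxError]; ring_nf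
    _ ≤ _ := (abs_sub _ _).trans (add_le_add ((abs_sub _ _).trans (add_le_add
        (abs_add_le _ _) hpot)) hfric)

theorem IsMollifier.integral_abs_fluxError_le (hη : IsMollifier δ η)
    (hητ : ∀ j z, |z.2 j * η z| ≤ τ * η z) (hτ : 0 ≤ τ) (hV : LipschitzWith L V)
    (hU : LipschitzWith L U) (hρ : Integrable ρ) (hρ0 : ∀ᵐ x, 0 ≤ ρ x) (j : Fin d) :
    ∫ x, |fluxError V U β σ η ρ j x|
      ≤ (∫ x, |mollify η (fun y => ∂[stdDir j] V y.1 * ρ y) x - ∂[stdDir j] V x.1 * ρ x|)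
        + (∫ x : Phase d, |∂[stdDir j] V x.1 - ∂[stdDir j] U x.1| * |ρ x|)
        + L * (∫ x, |mollify η ρ x - ρ x|) + |σ * β| * τ * ∫ x, |ρ x| := by
  have hVρ := integrable_dirDeriv_mul hV hρ j
  have hu := integrable_mollify hη.integrable hρ
  have hforce : Integrable fun x =>
      |mollify η (fun y => ∂[stdDir j] V y.1 * ρ y) x - ∂[stdDir j] V x.1 * ρ x| :=
    ((integrable_mollify hη.integrable hVρ).sub hVρ).abs
  have hpot : Integrable fun x : Phase d => |∂[stdDir j] V x.1 - ∂[stdDir j] U x.1| * |ρ x| := by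
    simpa only [Pi.sub_apply, ← sub_mul, abs_mul] using
      (hVρ.sub (integrable_dirDeriv_mul hU hρ j)).abs
  have hdens : Integrable fun x => L * |mollify η ρ x - ρ x| := (hu.sub hρ).abs.const_mul _
  have hfric := hu.abs.const_mul (|σ * β| * τ)
  have hmass : ∫ x, |mollify η ρ x| ≤ ∫ x, |ρ x| := by
    simpa [abs_of_nonneg (hη.nonneg _), hη.integral_eq_one] using
      integral_abs_mollify_le hη.integrable hρ
  refine (integral_mono_of_nonneg (ae_of_all _ fun x => abs_nonneg _)
    (((hforce.fun_add hpot).fun_add hdens).fun_add hfric)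
    (ae_of_all _ (hη.abs_fluxError_le_add hητ hU hρ hρ0 j))).trans ?_
  rw [integral_add ((hforce.fun_add hpot).fun_add hdens) hfric,
    integral_add (hforce.fun_add hpot) hdens, integral_add hforce hpot, integral_const_mul,
    integral_const_mul]
  gcongr

theorem integrable_velocity_mul_dirDeriv (hη : ContDiff ℝ ∞ η) (hc : HasCompactSupport η)
    (j : Fin d) : Integrable fun z : Phase d => z.2 j * ∂[posDir j] η z :=
  (by fun_prop : Continuous fun z : Phase d => z.2 j * ∂[posDir j] η z
    ).integrable_of_hasCompactSupport (hasCompactSupport_dirDeriv hc _).mul_left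

theorem integrable_transportError (hη : ContDiff ℝ ∞ η) (hc : HasCompactSupport η)
    (hρ : Integrable ρ) : Integrable (transportError η ρ) :=
  integrable_finsetSum _ fun j _ =>
    integrable_mollify (integrable_velocity_mul_dirDeriv hη hc j) hρ

theorem integral_abs_transportError_le (hη : ContDiff ℝ ∞ η) (hc : HasCompactSupport η)
    (hητ : ∀ j, ∫ z, |z.2 j * ∂[posDir j] η z| ≤ τ) (hρ : Integrable ρ) :
    ∫ x, |transportError η ρ x| ≤ d * τ * ∫ x, |ρ x| := by
  have hint (j : Fin d) := integrable_velocity_mul_dirDeriv hη hc j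
  have hterm (j : Fin d) := (integrable_mollify (hint j) hρ).abs
  calc ∫ x, |transportError η ρ x|
      ≤ ∫ x, ∑ j, |mollify (fun z => z.2 j * ∂[posDir j] η z) ρ x| :=
        integral_mono (integrable_transportError hη hc hρ).abs
          (integrable_finsetSum _ fun j _ => hterm j)
          fun x => Finset.abs_sum_le_sum_abs _ _
    _ = ∑ j, ∫ x, |mollify (fun z => z.2 j * ∂[posDir j] η z) ρ x| :=
        integral_finsetSum _ fun j _ => hterm j
    _ ≤ ∑ _j : Fin d, τ * ∫ x, |ρ x| := Finset.sum_le_sum fun j _ =>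
        (integral_abs_mollify_le (hint j) hρ).trans
          (mul_le_mul_of_nonneg_right (hητ j) (integral_nonneg fun x => abs_nonneg _))
    _ = d * τ * ∫ x, |ρ x| := by simp [mul_assoc]

end ErrorBounds

section Existence

variable {d : ℕ} {V : Param d → ℝ} {β σ : ℝ} {ρ : Phase d → ℝ} {L : NNReal}

/-- Smooth approximations, with precision `κ`, of a rough potential `V` and of a stationary solution
`ρ` for it: `u` solves the stationary equation for the smooth potential `U` up to the divergence of
a flux `E` in the velocity variable and a source `B`, both small in `L¹`. -/
structure IsRegularization (V : Param d → ℝ) (β σ : ℝ) (ρ : Phase d → ℝ) (L : NNReal) (κ : ℝ)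
    (U : Param d → ℝ) (u : Phase d → ℝ) (E : Fin d → Phase d → ℝ) (B : Phase d → ℝ) : Prop where
  contDiff_potential : ContDiff ℝ ∞ U
  lipschitzWith_potential : LipschitzWith L U
  abs_potential_sub_le : ∀ θ, |U θ - V θ| ≤ κ
  contDiff : ContDiff ℝ ∞ u
  nonneg : ∀ x, 0 ≤ u x
  integrable : Integrable u
  integral_abs_sub_le : ∫ x, |u x - ρ x| ≤ κ
  contDiff_flux : ∀ j, ContDiff ℝ ∞ (E j)
  abs_flux_le : ∀ j x, |E j x| ≤ (2 * L + |σ * β|) * u x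
  integral_abs_flux_le : ∀ j, ∫ x, |E j x| ≤ κ
  contDiff_source : ContDiff ℝ ∞ B
  integrable_source : Integrable B
  integral_abs_source_le : ∫ x, |B x| ≤ κ
  equation : ∀ x, kineticAdjoint U β σ u x + ∑ j, ∂[velDir j] (E j) x + B x = 0

theorem contDiff_fluxError {U : Param d → ℝ} {η : Phase d → ℝ} (hU : ContDiff ℝ ∞ U)
    (hη : ContDiff ℝ ∞ η) (hc : HasCompactSupport η) (hV : LipschitzWith L V) (hρ : Integrable ρ)
    (j : Fin d) : ContDiff ℝ ∞ (fluxError V U β σ η ρ j) := by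
  have hu := contDiff_mollify hη hc hρ.locallyIntegrable
  have hkη := contDiff_mollify (by fun_prop : ContDiff ℝ ∞ fun z => z.2 j * η z) hc.mul_left
    hρ.locallyIntegrable
  have hforce := contDiff_mollify hη hc (integrable_dirDeriv_mul hV hρ j).locallyIntegrable
  unfold fluxError
  fun_prop

theorem contDiff_transportError {η : Phase d → ℝ} (hη : ContDiff ℝ ∞ η)
    (hc : HasCompactSupport η) (hρ : Integrable ρ) : ContDiff ℝ ∞ (transportError η ρ) :=
  ContDiff.sum fun _ _ => contDiff_mollify (by fun_prop) (hasCompactSupport_dirDeriv hc _).mul_left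
    hρ.locallyIntegrable

theorem IsWeakStationary.exists_isRegularization (h : IsWeakStationary V β σ ρ)
    (hV : Differentiable ℝ V) (hL : LipschitzWith L V) (hρ : Integrable ρ) (hρ0 : ∀ᵐ x, 0 ≤ ρ x)
    {κ : ℝ} (hκ : 0 < κ) : ∃ U u E B, IsRegularization V β σ ρ L κ U u E B := by
  have hforce (j : Fin d) := integrable_dirDeriv_mul hL hρ j
  obtain ⟨κ', hκ', hκκ'⟩ : ∃ κ' > 0, (3 + L) * κ' = κ :=
    ⟨κ / (3 + L), by positivity, by field_simp⟩
  have hκ'κ : κ' ≤ κ := by nlinarith [L.coe_nonneg, hκ'.le]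
  obtain ⟨U, hU, hUL, hUV, hUρ⟩ := exists_smooth_potential hV hL hρ hκ'
  obtain ⟨τ, hsub, hsub', hτ1, hτσ, hτd, hτ⟩ :=
    ((eventually_integral_abs_mollify_sub_le hρ hκ').and <|
      (eventually_all.2 fun j => eventually_integral_abs_mollify_sub_le (hforce j) hκ').and <|
      (eventually_mul_le 1 one_pos).and <| (eventually_mul_le (|σ * β| * ∫ x, |ρ x|) hκ').and <|
      (eventually_mul_le (d * ∫ x, |ρ x|) hκ).and self_mem_nhdsWithin).exists
  obtain ⟨η, hη, hητ, hηpos⟩ := exists_isMollifier_velocity_le (d := d) hτ hτ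
  refine ⟨U, mollify η ρ, fluxError V U β σ η ρ, transportError η ρ, hU, hUL,
    fun θ => (hUV θ).trans hκ'κ,
    contDiff_mollify hη.contDiff hη.hasCompactSupport hρ.locallyIntegrable,
    hη.mollify_nonneg hρ0, integrable_mollify hη.integrable hρ, (hsub η hη).trans hκ'κ,
    contDiff_fluxError hU hη.contDiff hη.hasCompactSupport hL hρ, fun j x => ?_, fun j => ?_,
    contDiff_transportError hη.contDiff hη.hasCompactSupport hρ,
    integrable_transportError hη.contDiff hη.hasCompactSupport hρ, ?_,
    h.kineticAdjoint_mollify_add_eq_zero hU hη.contDiff hη.hasCompactSupport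
      hρ.locallyIntegrable fun j => (hforce j).locallyIntegrable⟩
  · refine (hη.abs_fluxError_le hητ hL hUL hρ hρ0 j x).trans
      (mul_le_mul_of_nonneg_right ?_ (hη.mollify_nonneg hρ0 x))
    nlinarith [abs_nonneg (σ * β)]
  · have hdens := mul_le_mul_of_nonneg_left (hsub η hη) L.coe_nonneg
    linarith [hη.integral_abs_fluxError_le (σ := σ) (β := β) hητ (le_of_lt hτ) hL hUL hρ hρ0 j,
      hsub' j η hη, hUρ j]
  · linarith [integral_abs_transportError_le hη.contDiff hη.hasCompactSupport hηpos hρ]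

end Existence

/-! ### Entropy dissipation -/

section Dissipation

variable {d : ℕ} {U : Param d → ℝ} {β σ : ℝ} {u χ : Phase d → ℝ}

/-- The logarithm `log (1 + u / m)` of the density of `u` relative to the Gibbs weight
`m = expEnergy (-β) U`, shifted so as to be smooth where `u` vanishes. -/
def logDensity (β : ℝ) (U : Param d → ℝ) (u : Phase d → ℝ) (x : Phase d) : ℝ :=
  Real.log (1 + expEnergy β U x * u x)

/-- The density `m |∇_r log (1 + u / m)|²` of the entropy dissipated by the velocity diffusion. -/
def dissipation (β : ℝ) (U : Param d → ℝ) (u : Phase d → ℝ) (x : Phase d) : ℝ :=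
  expEnergy (-β) U x * ∑ j, ∂[velDir j] (logDensity β U u) x ^ 2

theorem one_add_expEnergy_mul_pos {x : Phase d} (h : 0 ≤ u x) : 0 < 1 + expEnergy β U x * u x :=
  add_pos_of_pos_of_nonneg one_pos (mul_nonneg (expEnergy_pos _ _ _).le h)

@[fun_prop]
theorem contDiff_logDensity (hU : ContDiff ℝ ∞ U) (hu : ContDiff ℝ ∞ u) (h0 : ∀ x, 0 ≤ u x) :
    ContDiff ℝ ∞ (logDensity β U u) :=
  ContDiff.log (by fun_prop) fun x => (one_add_expEnergy_mul_pos (h0 x)).ne'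

theorem logDensity_nonneg {x : Phase d} (h : 0 ≤ u x) : 0 ≤ logDensity β U u x :=
  Real.log_nonneg (le_add_of_nonneg_right (mul_nonneg (expEnergy_pos _ _ _).le h))

theorem expEnergy_mul_logDensity_le {x : Phase d} (h : 0 ≤ u x) :
    expEnergy (-β) U x * logDensity β U u x ≤ u x := by
  have hlog := Real.log_le_sub_one_of_pos (one_add_expEnergy_mul_pos (β := β) (U := U) h)
  calc expEnergy (-β) U x * logDensity β U u x
      ≤ expEnergy (-β) U x * (expEnergy β U x * u x) :=
        mul_le_mul_of_nonneg_left (by rw [logDensity]; linarith) (expEnergy_pos _ _ _).le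
    _ = u x := by rw [← mul_assoc, expEnergy_neg_mul, one_mul]

theorem exp_neg_logDensity {x : Phase d} (h : 0 ≤ u x) :
    Real.exp (-logDensity β U u x) = (1 + expEnergy β U x * u x)⁻¹ := by
  rw [Real.exp_neg, logDensity, Real.exp_log (one_add_expEnergy_mul_pos h)]

theorem exp_neg_logDensity_mul_le {x : Phase d} (h : 0 ≤ u x) :
    Real.exp (-logDensity β U u x) * u x ≤ expEnergy (-β) U x := by
  rw [exp_neg_logDensity h, inv_mul_le_iff₀ (one_add_expEnergy_mul_pos h), add_mul, mul_right_comm,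
    mul_comm (expEnergy β U x), expEnergy_neg_mul, one_mul, one_mul]
  linarith [expEnergy_pos (-β) U x]

theorem dirDeriv_logDensity (hU : ContDiff ℝ ∞ U) (hu : ContDiff ℝ ∞ u) {x : Phase d}
    (h : 0 ≤ u x) (v : Phase d) : ∂[v] (logDensity β U u) x
      = (1 + expEnergy β U x * u x)⁻¹ * ∂[v] (fun y => expEnergy β U y * u y) x :=
  dirDeriv_comp (Φ := fun s => Real.log (1 + s)) (f := fun y => expEnergy β U y * u y)
    (by simpa using ((hasDerivAt_id _).const_add (1 : ℝ)).log (one_add_expEnergy_mul_pos h).ne')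
    ((by fun_prop : ContDiff ℝ ∞ fun y => expEnergy β U y * u y).differentiable (by simp) x)

theorem kineticAdjoint_expEnergy_mul_logDensity (hU : ContDiff ℝ ∞ U) (hu : ContDiff ℝ ∞ u)
    (h0 : ∀ x, 0 ≤ u x) (x : Phase d) :
    kineticAdjoint U β σ (fun y => expEnergy (-β) U y * logDensity β U u y) x
      = Real.exp (-logDensity β U u x) * kineticAdjoint U β σ u x
        - σ * dissipation β U u x := by
  have hw : ContDiff ℝ ∞ fun y => expEnergy β U y * u y := by fun_prop
  have hpos (y : Phase d) := one_add_expEnergy_mul_pos (β := β) (U := U) (h0 y)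
  have hu' : kineticAdjoint U β σ u x
      = expEnergy (-β) U x * kineticDual U β σ (fun y => expEnergy β U y * u y) x := by
    rw [← kineticAdjoint_expEnergy_mul hU hw]
    simp_rw [← mul_assoc, expEnergy_neg_mul, one_mul]
  have hdual := kineticDual_comp (V := U) (β := β) (σ := σ) hw
    (Φ := fun s => Real.log (1 + s)) (Φ' := fun s => (1 + s)⁻¹)
    (fun y => by simpa using ((hasDerivAt_id _).const_add (1 : ℝ)).log (hpos y).ne')
    (((hasDerivAt_id _).const_add (1 : ℝ)).fun_inv (hpos x).ne')
  rw [kineticAdjoint_expEnergy_mul hU (contDiff_logDensity hU hu h0), hu', dissipation,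
    exp_neg_logDensity (h0 x)]
  simp_rw [dirDeriv_logDensity hU hu (h0 x), mul_pow, ← Finset.mul_sum]
  unfold logDensity
  have hne := (hpos x).ne'
  rw [hdual, id]
  field_simp
  ring

@[fun_prop]
theorem contDiff_dissipation (hU : ContDiff ℝ ∞ U) (hu : ContDiff ℝ ∞ u) (h0 : ∀ x, 0 ≤ u x) :
    ContDiff ℝ ∞ (dissipation β U u) := by
  have := contDiff_logDensity (β := β) hU hu h0
  unfold dissipation
  fun_prop

theorem dissipation_nonneg (β : ℝ) (U : Param d → ℝ) (u : Phase d → ℝ) (x : Phase d) :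
    0 ≤ dissipation β U u x :=
  mul_nonneg (expEnergy_pos _ _ _).le (Finset.sum_nonneg fun _ _ => sq_nonneg _)

theorem integral_mul_dissipation {E : Fin d → Phase d → ℝ} {B : Phase d → ℝ}
    (hU : ContDiff ℝ ∞ U) (hu : ContDiff ℝ ∞ u) (h0 : ∀ x, 0 ≤ u x)
    (hE : ∀ j, ContDiff ℝ ∞ (E j)) (hB : ContDiff ℝ ∞ B)
    (heq : ∀ x, kineticAdjoint U β σ u x + ∑ j, ∂[velDir j] (E j) x + B x = 0)
    (hχ : ContDiff ℝ ∞ χ) (hc : HasCompactSupport χ) :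
    σ * ∫ x, χ x * dissipation β U u x
      = (∑ j, ∫ x, ∂[velDir j] (fun y => χ y * Real.exp (-logDensity β U u y)) x * E j x)
        - (∫ x, χ x * Real.exp (-logDensity β U u x) * B x)
        - ∫ x, kineticGenerator U β σ χ x * (expEnergy (-β) U x * logDensity β U u x) := by
  have := contDiff_logDensity (β := β) hU hu h0
  have hp : ContDiff ℝ ∞ fun x => χ x * Real.exp (-logDensity β U u x) := by fun_prop
  have hpc : HasCompactSupport fun x => χ x * Real.exp (-logDensity β U u x) := hc.mul_right
  have hdiv (j : Fin d) := integrable_mul_of_contDiff hp hpc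
    (contDiff_dirDeriv (v := velDir j) (hE j))
  have hsource := integrable_mul_of_contDiff hp hpc hB
  have hdiss := (integrable_mul_of_contDiff hχ hc
    (contDiff_dissipation (β := β) hU hu h0)).const_mul σ
  have hsum : Integrable fun x =>
      -∑ j, χ x * Real.exp (-logDensity β U u x) * ∂[velDir j] (E j) x :=
    (integrable_finsetSum _ fun j _ => hdiv j).fun_neg
  have hfirst : Integrable fun x =>
      (-∑ j, χ x * Real.exp (-logDensity β U u x) * ∂[velDir j] (E j) x)
        - χ x * Real.exp (-logDensity β U u x) * B x := hsum.sub hsource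
  have hpoint (x : Phase d) :
      χ x * kineticAdjoint U β σ (fun y => expEnergy (-β) U y * logDensity β U u y) x
        = -(∑ j, χ x * Real.exp (-logDensity β U u x) * ∂[velDir j] (E j) x)
          - χ x * Real.exp (-logDensity β U u x) * B x - σ * (χ x * dissipation β U u x) := by
    rw [kineticAdjoint_expEnergy_mul_logDensity hU hu h0, ← Finset.mul_sum]
    linear_combination χ x * Real.exp (-logDensity β U u x) * heq x
  rw [← integral_mul_kineticAdjoint hU hχ hc (by fun_prop)]
  simp_rw [hpoint]
  rw [integral_sub hfirst hdiss, integral_sub hsum hsource, integral_neg,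
    integral_finsetSum _ fun j _ => hdiv j, integral_const_mul]
  simp_rw [integral_mul_dirDeriv_of_contDiff hp hpc (hE _), Finset.sum_neg_distrib]
  ring

theorem neg_mul_le_mul_sq_add_of_sq_div_le {m a l b : ℝ} (hσ : 0 < σ) (hm : 0 < m)
    (h : a ^ 2 / m ≤ b) : -(a * l) ≤ σ / 2 * (m * l ^ 2) + b / (2 * σ) := by
  have hsquare : 0 ≤ (σ * m * l + a) ^ 2 / (2 * σ * m) := by positivity
  have hexpand : (σ * m * l + a) ^ 2 / (2 * σ * m)
      = σ / 2 * (m * l ^ 2) + a * l + a ^ 2 / m / (2 * σ) := by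
    field_simp
    ring
  have hdiv : a ^ 2 / m / (2 * σ) ≤ b / (2 * σ) := by gcongr
  linarith

-- Young's inequality with the weight `σ m / 2` lets the quadratic term be absorbed by the
-- dissipation; `|e| ≤ K u` together with `e^{-l} u ≤ m` makes the remainder linear in `e`.
theorem dirDeriv_mul_exp_neg_mul_le {K e : ℝ} (hσ : 0 < σ) (hK : 0 ≤ K) (hU : ContDiff ℝ ∞ U)
    (hu : ContDiff ℝ ∞ u) (h0 : ∀ x, 0 ≤ u x) (hχ : ContDiff ℝ ∞ χ) {x : Phase d}
    (hχ0 : 0 ≤ χ x) (hχ1 : χ x ≤ 1) (he : |e| ≤ K * u x) (v : Phase d) :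
    ∂[v] (fun y => χ y * Real.exp (-logDensity β U u y)) x * e
      ≤ |∂[v] χ x| * |e| + σ / 2 * (χ x * (expEnergy (-β) U x * ∂[v] (logDensity β U u) x ^ 2))
        + K / (2 * σ) * |e| := by
  have hl := contDiff_logDensity (β := β) hU hu h0
  rw [dirDeriv_mul_exp_neg hχ hl]
  set l' := ∂[v] (logDensity β U u) x
  set p := Real.exp (-logDensity β U u x)
  set m := expEnergy (-β) U x
  have hp0 : 0 < p := Real.exp_pos _
  have hp1 : p ≤ 1 := Real.exp_le_one_iff.2 (neg_nonpos.2 (logDensity_nonneg (h0 x)))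
  have hm : 0 < m := expEnergy_pos _ _ _
  have hpu : p * u x ≤ m := exp_neg_logDensity_mul_le (h0 x)
  have hfirst : p * ∂[v] χ x * e ≤ |∂[v] χ x| * |e| := by
    rw [← abs_mul, mul_assoc]
    exact (mul_le_mul_of_nonneg_left (le_abs_self _) hp0.le).trans
      (mul_le_of_le_one_left (abs_nonneg _) hp1)
  have hsq : (p * e) ^ 2 / m ≤ K * |e| := by
    rw [div_le_iff₀ hm]
    calc (p * e) ^ 2 = p * (p * |e| * |e|) := by rw [mul_pow, ← sq_abs e]; ring
      _ ≤ 1 * (p * |e| * (K * u x)) := by gcongr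
      _ = K * |e| * (p * u x) := by ring
      _ ≤ K * |e| * m := by gcongr
  have hyoung : -(p * e * l') ≤ σ / 2 * (m * l' ^ 2) + K * |e| / (2 * σ) :=
    neg_mul_le_mul_sq_add_of_sq_div_le hσ hm hsq
  calc p * (∂[v] χ x - χ x * l') * e = p * ∂[v] χ x * e + χ x * -(p * e * l') := by ring
    _ ≤ |∂[v] χ x| * |e| + χ x * (σ / 2 * (m * l' ^ 2) + K * |e| / (2 * σ)) := by gcongr
    _ ≤ |∂[v] χ x| * |e| + (χ x * (σ / 2 * (m * l' ^ 2)) + 1 * (K * |e| / (2 * σ))) := by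
        rw [mul_add]
        gcongr
    _ = _ := by ring

/-- A bound on `|kineticGenerator V β σ χ|` that is uniform over the `L`-Lipschitz potentials. -/
def generatorBound (L : NNReal) (β σ : ℝ) (χ : Phase d → ℝ) (x : Phase d) : ℝ :=
  ∑ j, (|x.2 j| * |∂[posDir j] χ x| + L * |∂[velDir j] χ x|
    + |σ| * (|∂[velDir j] (∂[velDir j] χ) x| + |β| * |x.2 j| * |∂[velDir j] χ x|))

theorem generatorBound_nonneg (L : NNReal) (β σ : ℝ) (χ : Phase d → ℝ) (x : Phase d) :
    0 ≤ generatorBound L β σ χ x :=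
  Finset.sum_nonneg fun _ _ => by positivity

theorem abs_kineticGenerator_le {L : NNReal} (hU : LipschitzWith L U) (χ : Phase d → ℝ)
    (x : Phase d) : |kineticGenerator U β σ χ x| ≤ generatorBound L β σ χ x := by
  refine (Finset.abs_sum_le_sum_abs _ _).trans (Finset.sum_le_sum fun j _ => ?_)
  refine (abs_add_le _ _).trans (add_le_add ((abs_sub _ _).trans (add_le_add ?_ ?_)) ?_)
  · rw [abs_mul]
  · rw [abs_mul]
    exact mul_le_mul_of_nonneg_right (abs_dirDeriv_stdDir_le hU j _) (abs_nonneg _)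
  · rw [abs_mul]
    refine mul_le_mul_of_nonneg_left ((abs_sub _ _).trans_eq ?_) (abs_nonneg _)
    simp only [abs_mul]

theorem continuous_generatorBound (L : NNReal) (β σ : ℝ) (hχ : ContDiff ℝ ∞ χ) :
    Continuous (generatorBound L β σ χ) := by
  have hvel (j : Fin d) := contDiff_dirDeriv (v := velDir j) hχ
  unfold generatorBound
  refine continuous_finsetSum _ fun j _ => ?_
  have := (contDiff_dirDeriv (v := posDir j) hχ).continuous
  have := (hvel j).continuous
  have := (contDiff_dirDeriv (v := velDir j) (hvel j)).continuous
  fun_prop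

theorem hasCompactSupport_generatorBound (L : NNReal) (β σ : ℝ) (hc : HasCompactSupport χ) :
    HasCompactSupport (generatorBound L β σ χ) := by
  refine HasCompactSupport.intro hc fun x hx => ?_
  have hderiv (v : Phase d) : tsupport (∂[v] χ) ⊆ tsupport χ := tsupport_fderiv_apply_subset ℝ v
  have hzero {f : Phase d → ℝ} (hf : tsupport f ⊆ tsupport χ) : f x = 0 :=
    image_eq_zero_of_notMem_tsupport fun h => hx (hf h)
  refine Finset.sum_eq_zero fun j _ => ?_
  have hsecond : ∂[velDir j] (∂[velDir j] χ) x = 0 :=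
    hzero ((tsupport_fderiv_apply_subset ℝ _).trans (hderiv _))
  simp [hzero (hderiv _), hsecond]

end Dissipation

section RegularizedDissipation

variable {d : ℕ} {U V : Param d → ℝ} {β σ κ M : ℝ} {u χ ρ : Phase d → ℝ} {L : NNReal}
  {E : Fin d → Phase d → ℝ} {B : Phase d → ℝ}

theorem IsRegularization.integrable_flux (h : IsRegularization V β σ ρ L κ U u E B)
    (j : Fin d) : Integrable (E j) :=
  (h.integrable.const_mul (2 * L + |σ * β|)).mono'
    (h.contDiff_flux j).continuous.aestronglyMeasurable (ae_of_all _ (h.abs_flux_le j))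

theorem IsRegularization.integral_dirDeriv_mul_flux_le
    (h : IsRegularization V β σ ρ L κ U u E B) (hσ : 0 < σ) (hχ : ContDiff ℝ ∞ χ)
    (hc : HasCompactSupport χ) (hχ0 : ∀ x, 0 ≤ χ x) (hχ1 : ∀ x, χ x ≤ 1) (hM : 0 ≤ M)
    (hχM : ∀ j x, |∂[velDir j] χ x| ≤ M) (j : Fin d) :
    ∫ x, ∂[velDir j] (fun y => χ y * Real.exp (-logDensity β U u y)) x * E j x
      ≤ (M + (2 * L + |σ * β|) / (2 * σ)) * κ
        + σ / 2 * ∫ x, χ x * (expEnergy (-β) U x * ∂[velDir j] (logDensity β U u) x ^ 2) := by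
  have hl := contDiff_logDensity (β := β) h.contDiff_potential h.contDiff h.nonneg
  have hU := h.contDiff_potential
  have hflux := (h.integrable_flux j).abs.const_mul (M + (2 * L + |σ * β|) / (2 * σ))
  have := contDiff_dirDeriv (v := velDir j) hl
  have hquad := (integrable_mul_of_contDiff hχ hc (by fun_prop : ContDiff ℝ ∞ fun x =>
    expEnergy (-β) U x * ∂[velDir j] (logDensity β U u) x ^ 2)).const_mul (σ / 2)
  have hp : ContDiff ℝ ∞ fun x => χ x * Real.exp (-logDensity β U u x) := by fun_prop
  calc ∫ x, ∂[velDir j] (fun y => χ y * Real.exp (-logDensity β U u y)) x * E j x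
      ≤ ∫ x, ((M + (2 * L + |σ * β|) / (2 * σ)) * |E j x|
          + σ / 2 * (χ x * (expEnergy (-β) U x * ∂[velDir j] (logDensity β U u) x ^ 2))) := by
        refine integral_mono (integrable_mul_of_contDiff (contDiff_dirDeriv hp)
          (hasCompactSupport_dirDeriv hc.mul_right _) (h.contDiff_flux j)) (hflux.add hquad)
          fun x => ?_
        have hyoung := dirDeriv_mul_exp_neg_mul_le (β := β) hσ (by positivity) hU h.contDiff
          h.nonneg hχ (hχ0 x) (hχ1 x) (h.abs_flux_le j x) (velDir j)
        have hgrad := mul_le_mul_of_nonneg_right (hχM j x) (abs_nonneg (E j x))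
        linarith
    _ = (M + (2 * L + |σ * β|) / (2 * σ)) * (∫ x, |E j x|) + σ / 2 *
          ∫ x, χ x * (expEnergy (-β) U x * ∂[velDir j] (logDensity β U u) x ^ 2) := by
        rw [integral_add hflux hquad, integral_const_mul, integral_const_mul]
    _ ≤ _ := by
        gcongr
        exact h.integral_abs_flux_le j

theorem IsRegularization.neg_integral_source_le
    (h : IsRegularization V β σ ρ L κ U u E B) (hχ : ContDiff ℝ ∞ χ) (hc : HasCompactSupport χ)
    (hχ0 : ∀ x, 0 ≤ χ x) (hχ1 : ∀ x, χ x ≤ 1) :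
    -∫ x, χ x * Real.exp (-logDensity β U u x) * B x ≤ κ := by
  have hl := contDiff_logDensity (β := β) h.contDiff_potential h.contDiff h.nonneg
  have hp : ContDiff ℝ ∞ fun x => χ x * Real.exp (-logDensity β U u x) := by fun_prop
  rw [← integral_neg]
  refine (integral_mono (integrable_mul_of_contDiff hp hc.mul_right h.contDiff_source).neg
    h.integrable_source.abs fun x => ?_).trans h.integral_abs_source_le
  have hle : χ x * Real.exp (-logDensity β U u x) ≤ 1 := mul_le_one₀ (hχ1 x) (Real.exp_pos _).le
    (Real.exp_le_one_iff.2 (neg_nonpos.2 (logDensity_nonneg (h.nonneg x))))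
  calc -(χ x * Real.exp (-logDensity β U u x) * B x)
      ≤ |χ x * Real.exp (-logDensity β U u x) * B x| := neg_le_abs _
    _ = χ x * Real.exp (-logDensity β U u x) * |B x| := by
        rw [abs_mul, abs_of_nonneg (mul_nonneg (hχ0 x) (Real.exp_pos _).le)]
    _ ≤ |B x| := mul_le_of_le_one_left (abs_nonneg _) hle

theorem IsRegularization.neg_generator_mul_le (h : IsRegularization V β σ ρ L κ U u E B)
    (χ : Phase d → ℝ) (x : Phase d) :
    -(kineticGenerator U β σ χ x * (expEnergy (-β) U x * logDensity β U u x))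
      ≤ generatorBound L β σ χ x * u x := by
  rw [← neg_mul]
  exact mul_le_mul ((neg_le_abs _).trans (abs_kineticGenerator_le h.lipschitzWith_potential χ x))
    (expEnergy_mul_logDensity_le (h.nonneg x))
    (mul_nonneg (expEnergy_pos _ _ _).le (logDensity_nonneg (h.nonneg x)))
    (generatorBound_nonneg _ _ _ _ _)

theorem IsRegularization.neg_integral_generator_le
    (h : IsRegularization V β σ ρ L κ U u E B) (hρ : Integrable ρ) (hχ : ContDiff ℝ ∞ χ)
    (hc : HasCompactSupport χ) (hM : 0 ≤ M) (hχM : ∀ x, generatorBound L β σ χ x ≤ M) :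
    -∫ x, kineticGenerator U β σ χ x * (expEnergy (-β) U x * logDensity β U u x)
      ≤ (∫ x, generatorBound L β σ χ x * ρ x) + M * κ := by
  have hl := contDiff_logDensity (β := β) h.contDiff_potential h.contDiff h.nonneg
  have hU := h.contDiff_potential
  have hbound := continuous_generatorBound L β σ hχ
  have hboundc := hasCompactSupport_generatorBound L β σ hc
  have hgen : ContDiff ℝ ∞ (kineticGenerator U β σ χ) := by
    unfold kineticGenerator
    fun_prop
  have hgenc : HasCompactSupport (kineticGenerator U β σ χ) :=
    hboundc.mono' fun x hx => subset_tsupport _ fun h0 => hx <| abs_eq_zero.1 <|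
      le_antisymm ((abs_kineticGenerator_le h.lipschitzWith_potential χ x).trans_eq h0)
        (abs_nonneg _)
  have hdens : Integrable fun x => generatorBound L β σ χ x * ρ x :=
    hρ.locallyIntegrable.integrable_smul_left_of_hasCompactSupport hbound hboundc
  have hsub : Integrable fun x => M * |u x - ρ x| := (h.integrable.sub hρ).abs.const_mul M
  calc -∫ x, kineticGenerator U β σ χ x * (expEnergy (-β) U x * logDensity β U u x)
      ≤ ∫ x, (generatorBound L β σ χ x * ρ x + M * |u x - ρ x|) := by
        rw [← integral_neg]
        refine integral_mono (integrable_mul_of_contDiff hgen hgenc (by fun_prop)).neg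
          (hdens.add hsub) fun x => ?_
        calc -(kineticGenerator U β σ χ x * (expEnergy (-β) U x * logDensity β U u x))
            ≤ generatorBound L β σ χ x * u x := h.neg_generator_mul_le χ x
          _ = generatorBound L β σ χ x * ρ x + generatorBound L β σ χ x * (u x - ρ x) := by ring
          _ ≤ generatorBound L β σ χ x * ρ x + M * |u x - ρ x| := by
              exact add_le_add_right ((mul_le_mul_of_nonneg_left (le_abs_self _)
                (generatorBound_nonneg _ _ _ _ _)).trans
                (mul_le_mul_of_nonneg_right (hχM x) (abs_nonneg _))) _
    _ = (∫ x, generatorBound L β σ χ x * ρ x) + M * ∫ x, |u x - ρ x| := by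
        rw [integral_add hdens hsub, integral_const_mul]
    _ ≤ _ := by
        gcongr
        exact h.integral_abs_sub_le

theorem exists_integral_dissipation_le (hσ : 0 < σ) (hρ : Integrable ρ)
    (hχ : ContDiff ℝ ∞ χ) (hc : HasCompactSupport χ) (hχ0 : ∀ x, 0 ≤ χ x) (hχ1 : ∀ x, χ x ≤ 1) :
    ∃ C, ∀ κ U u E B, IsRegularization V β σ ρ L κ U u E B →
      σ / 2 * ∫ x, χ x * dissipation β U u x ≤ (∫ x, generatorBound L β σ χ x * ρ x) + C * κ := by
  obtain ⟨M, hM⟩ := (hasCompactSupport_generatorBound L β σ hc).exists_bound_of_continuous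
    (continuous_generatorBound L β σ hχ)
  have hM0 : 0 ≤ M := (norm_nonneg _).trans (hM 0)
  choose D hD using fun j => (hasCompactSupport_dirDeriv hc (velDir j)).exists_bound_of_continuous
    (contDiff_dirDeriv hχ).continuous
  have hD0 (j : Fin d) : 0 ≤ D j := (norm_nonneg _).trans (hD j 0)
  have hDsum (j : Fin d) (x : Phase d) : |∂[velDir j] χ x| ≤ ∑ i, D i := (hD j x).trans
    (Finset.single_le_sum (fun i _ => hD0 i) (Finset.mem_univ j))
  refine ⟨d * (∑ i, D i + (2 * L + |σ * β|) / (2 * σ)) + 1 + M, fun κ U u E B h => ?_⟩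
  have hU := h.contDiff_potential
  have hl := contDiff_logDensity (β := β) hU h.contDiff h.nonneg
  have hdiss : ∫ x, χ x * dissipation β U u x
      = ∑ j, ∫ x, χ x * (expEnergy (-β) U x * ∂[velDir j] (logDensity β U u) x ^ 2) := by
    simp_rw [dissipation, Finset.mul_sum]
    exact integral_finsetSum _ fun j _ => integrable_mul_of_contDiff hχ hc (by fun_prop)
  have hflux := Finset.sum_le_sum fun j (_ : j ∈ Finset.univ) =>
    h.integral_dirDeriv_mul_flux_le hσ hχ hc hχ0 hχ1 (Finset.sum_nonneg fun i _ => hD0 i) hDsum j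
  rw [Finset.sum_add_distrib, ← Finset.mul_sum (a := σ / 2), ← hdiss, Finset.sum_const,
    Finset.card_univ, Fintype.card_fin, nsmul_eq_mul] at hflux
  have hsource := h.neg_integral_source_le hχ hc hχ0 hχ1
  have hgen := h.neg_integral_generator_le hρ hχ hc hM0 fun x => (le_abs_self _).trans (hM x)
  have hentropy := integral_mul_dissipation hU h.contDiff h.nonneg h.contDiff_flux
    h.contDiff_source h.equation hχ hc
  linarith

end RegularizedDissipation

/-! ### Absence of velocity gradients relative to the Gibbs weight -/

section Cutoff

variable {d : ℕ} {L : NNReal} {β σ : ℝ} {ρ χ : Phase d → ℝ}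

theorem generatorBound_comp_smul_le (hχ : ContDiff ℝ ∞ χ) {s : ℝ} (h0 : 0 ≤ s) (h1 : s ≤ 1)
    (x : Phase d) :
    generatorBound L β σ (fun y => χ (s • y)) x ≤ generatorBound L β σ χ (s • x) := by
  have hdiff : Differentiable ℝ χ := hχ.differentiable (by simp)
  have hvel (j : Fin d) : Differentiable ℝ (∂[velDir j] χ) :=
    (contDiff_dirDeriv hχ).differentiable (by simp)
  have hfirst (v : Phase d) : ∂[v] (fun y => χ (s • y)) = fun y => s * ∂[v] χ (s • y) :=
    funext (dirDeriv_comp_smul hdiff s v)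
  have hsecond (j : Fin d) : ∂[velDir j] (fun y => s * ∂[velDir j] χ (s • y)) x
      = s * (s * ∂[velDir j] (∂[velDir j] χ) (s • x)) := by
    rw [dirDeriv_const_mul (by fun_prop), dirDeriv_comp_smul (hvel j)]
  refine Finset.sum_le_sum fun j _ => ?_
  rw [hfirst, hfirst, hsecond]
  simp only [abs_mul, abs_of_nonneg h0, Prod.smul_snd, PiLp.smul_apply, smul_eq_mul]
  have hcontract {a : ℝ} (ha : 0 ≤ a) : s * a ≤ a := mul_le_of_le_one_left ha h1
  refine add_le_add (add_le_add (by linarith) ?_) ?_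
  · exact mul_le_mul_of_nonneg_left (hcontract (abs_nonneg _)) L.coe_nonneg
  · refine mul_le_mul_of_nonneg_left (add_le_add ?_ (by linarith)) (abs_nonneg _)
    exact (hcontract (by positivity)).trans (hcontract (abs_nonneg _))

theorem generatorBound_eq_zero {x : Phase d} {c : ℝ} (h : χ =ᶠ[𝓝 x] fun _ => c) :
    generatorBound L β σ χ x = 0 := by
  have hderiv (v : Phase d) : ∂[v] χ =ᶠ[𝓝 x] fun _ => 0 :=
    h.eventuallyEq_nhds.mono fun y hy => by simp [dirDeriv, hy.fderiv_eq]
  have hsecond (v : Phase d) : ∂[v] (∂[v] χ) x = 0 := by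
    simp [dirDeriv, show fderiv ℝ (∂[v] χ) x = 0 by simp [(hderiv v).fderiv_eq]]
  refine Finset.sum_eq_zero fun j _ => ?_
  simp [(hderiv _).eq_of_nhds, hsecond]

theorem tendsto_integral_generatorBound_smul (hρ : Integrable ρ) (hχ : ContDiff ℝ ∞ χ)
    (hc : HasCompactSupport χ) (h : χ =ᶠ[𝓝 0] fun _ => 1) :
    Tendsto (fun s : ℝ => ∫ x, generatorBound L β σ χ (s • x) * ρ x) (𝓝 0) (𝓝 0) := by
  have hcont := continuous_generatorBound L β σ hχ
  obtain ⟨M, hM⟩ := (hasCompactSupport_generatorBound L β σ hc).exists_bound_of_continuous hcont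
  have hlim : Tendsto (fun s : ℝ => ∫ x, generatorBound L β σ χ (s • x) * ρ x) (𝓝 0)
      (𝓝 (∫ x, generatorBound L β σ χ ((0 : ℝ) • x) * ρ x)) := by
    refine tendsto_integral_filter_of_dominated_convergence (fun x => M * |ρ x|)
      (Eventually.of_forall fun s => ?_) (Eventually.of_forall fun s => ae_of_all _ fun x => ?_)
      (hρ.abs.const_mul M) (ae_of_all _ fun x => ?_)
    · exact (hcont.comp (continuous_const_smul s)).aestronglyMeasurable.mul
        hρ.aestronglyMeasurable
    · rw [norm_mul]
      exact mul_le_mul_of_nonneg_right (hM _) (norm_nonneg _)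
    · exact ((hcont.comp (continuous_id.smul continuous_const)).tendsto 0).mul_const _
  simpa [generatorBound_eq_zero h] using hlim

theorem exists_cutoff (L : NNReal) (β σ : ℝ) (hρ : Integrable ρ) (hρ0 : ∀ᵐ x, 0 ≤ ρ x)
    {S : Set (Phase d)} (hS : IsCompact S) {κ : ℝ} (hκ : 0 < κ) :
    ∃ χ : Phase d → ℝ, ContDiff ℝ ∞ χ ∧ HasCompactSupport χ ∧ (∀ x, 0 ≤ χ x) ∧ (∀ x, χ x ≤ 1) ∧
      (∀ x ∈ S, χ x = 1) ∧ ∫ x, generatorBound L β σ χ x * ρ x ≤ κ := by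
  let ϖ : ContDiffBump (0 : Phase d) := ⟨1, 2, one_pos, one_lt_two⟩
  have hϖ : ContDiff ℝ ∞ ϖ := ϖ.contDiff
  have hlim := tendsto_integral_generatorBound_smul (L := L) (β := β) (σ := σ) hρ hϖ
    ϖ.hasCompactSupport ϖ.eventuallyEq_one
  obtain ⟨r, hr⟩ := hS.isBounded.exists_norm_le
  have hsmall : ∀ᶠ s : ℝ in 𝓝[>] 0, ∫ x, generatorBound L β σ ϖ (s • x) * ρ x ≤ κ :=
    (hlim.mono_left nhdsWithin_le_nhds).eventually_le_const hκ
  obtain ⟨s, hsκ, hsr, hs1, hs0⟩ := (hsmall.and <| (eventually_mul_le r one_pos).and <|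
    (eventually_mul_le 1 one_pos).and self_mem_nhdsWithin).exists
  have hs0 : 0 < s := hs0
  have hs1 : s ≤ 1 := by simpa using hs1
  have hχ : ContDiff ℝ ∞ fun x => ϖ (s • x) := hϖ.comp (contDiff_const_smul s)
  have hχc : HasCompactSupport fun x => ϖ (s • x) := ϖ.hasCompactSupport.comp_smul hs0.ne'
  refine ⟨fun x => ϖ (s • x), hχ, hχc, fun x => ϖ.nonneg, fun x => ϖ.le_one, fun x hx => ?_, ?_⟩
  · refine ϖ.one_of_mem_closedBall (mem_closedBall_zero_iff.2 ?_)
    rw [norm_smul, Real.norm_of_nonneg hs0.le]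
    exact (mul_le_mul_of_nonneg_left (hr x hx) hs0.le).trans hsr
  · have hint {G : Phase d → ℝ} (hG : Continuous G) (hGc : HasCompactSupport G) :
        Integrable fun x => G x * ρ x :=
      hρ.locallyIntegrable.integrable_smul_left_of_hasCompactSupport hG hGc
    have hcont := continuous_generatorBound L β σ hϖ
    refine (integral_mono_ae (hint (continuous_generatorBound L β σ hχ)
      (hasCompactSupport_generatorBound L β σ hχc)) (hint (hcont.comp (continuous_const_smul s))
      ((hasCompactSupport_generatorBound L β σ ϖ.hasCompactSupport).comp_smul hs0.ne'))
      (hρ0.mono fun x hx => ?_)).trans hsκ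
    exact mul_le_mul_of_nonneg_right (generatorBound_comp_smul_le hϖ hs0.le hs1 x) hx

end Cutoff

section LogDensity

variable {d : ℕ} {U V : Param d → ℝ} {β σ κ : ℝ} {u χ ζ ρ : Phase d → ℝ} {L : NNReal}
  {E : Fin d → Phase d → ℝ} {B : Phase d → ℝ}

theorem continuous_expEnergy (hV : Continuous V) (b : ℝ) : Continuous (expEnergy b V) := by
  unfold expEnergy
  fun_prop

theorem expEnergy_le_exp_mul (h : ∀ θ, |U θ - V θ| ≤ κ) (b : ℝ) (x : Phase d) :
    expEnergy b U x ≤ Real.exp (|b| * κ) * expEnergy b V x := by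
  rw [expEnergy, expEnergy, ← Real.exp_add, Real.exp_le_exp]
  have hb : b * (U x.1 - V x.1) ≤ |b| * κ := (le_abs_self _).trans <| by
    rw [abs_mul]
    exact mul_le_mul_of_nonneg_left (h _) (abs_nonneg b)
  linarith

theorem abs_expEnergy_sub_le (h : ∀ θ, |U θ - V θ| ≤ κ) (b : ℝ) (x : Phase d) :
    |expEnergy b U x - expEnergy b V x| ≤ (Real.exp (|b| * κ) - 1) * expEnergy b V x := by
  have hle := expEnergy_le_exp_mul h b x
  have hge := expEnergy_le_exp_mul (fun θ => (abs_sub_comm _ _).trans_le (h θ)) b x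
  have hκ : 0 ≤ κ := (abs_nonneg _).trans (h 0)
  have hone : 1 ≤ Real.exp (|b| * κ) := Real.one_le_exp (by positivity)
  rw [abs_le]
  constructor <;> nlinarith [expEnergy_pos b V x]

theorem abs_log_one_add_sub_log_one_add_le {a b : ℝ} (ha : 0 ≤ a) (hb : 0 ≤ b) :
    |Real.log (1 + a) - Real.log (1 + b)| ≤ |a - b| := by
  wlog h : b ≤ a generalizing a b
  · rw [abs_sub_comm, abs_sub_comm a b]
    exact this hb ha (not_le.1 h).le
  have hlog : Real.log (1 + b) ≤ Real.log (1 + a) := Real.log_le_log (by linarith) (by linarith)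
  rw [abs_of_nonneg (by linarith), abs_of_nonneg (by linarith),
    ← Real.log_div (by linarith) (by linarith)]
  have hdiv : (1 + a) / (1 + b) - 1 ≤ a - b := by
    rw [div_sub_one (by linarith), div_le_iff₀ (by linarith)]
    nlinarith
  exact (Real.log_le_sub_one_of_pos (by positivity)).trans hdiv

theorem locallyIntegrable_logDensity (hV : Continuous V) (hρ : Integrable ρ)
    (hρ0 : ∀ᵐ x, 0 ≤ ρ x) (β : ℝ) : LocallyIntegrable (logDensity β V ρ) := by
  have hcont := continuous_expEnergy hV β
  have hprod : LocallyIntegrable fun x => expEnergy β V x * ρ x :=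
    hρ.locallyIntegrable.continuous_mul hcont
  have hmeas : AEMeasurable fun x => 1 + expEnergy β V x * ρ x :=
    (hcont.measurable.aemeasurable.mul hρ.aestronglyMeasurable.aemeasurable).const_add 1
  refine hprod.mono (Real.measurable_log.comp_aemeasurable hmeas).aestronglyMeasurable
    (hρ0.mono fun x hx => ?_)
  simpa [logDensity] using abs_log_one_add_sub_log_one_add_le
    (mul_nonneg (expEnergy_pos β V x).le hx) le_rfl

theorem integrable_logDensity_mul_dirDeriv (hV : Continuous V) (hρ : Integrable ρ)
    (hρ0 : ∀ᵐ x, 0 ≤ ρ x) (β : ℝ) (hζ : ContDiff ℝ ∞ ζ) (hc : HasCompactSupport ζ)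
    (v : Phase d) : Integrable fun x => logDensity β V ρ x * ∂[v] ζ x :=
  (locallyIntegrable_logDensity hV hρ hρ0 β).integrable_smul_right_of_hasCompactSupport
    (contDiff_dirDeriv hζ).continuous (hasCompactSupport_dirDeriv hc v)

theorem abs_mul_le_of_mul_eq_one {m w s : ℝ} (h : m * w = 1) (hm : 0 < m) (hs : 0 < s)
    (a b : ℝ) : |a * b| ≤ s / 2 * (a ^ 2 * w) + 1 / (2 * s) * (m * b ^ 2) := by
  have hsquare : 0 ≤ m * (s * |a| * w - |b|) ^ 2 / (2 * s) := by positivity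
  have hexpand : m * (s * |a| * w - |b|) ^ 2 / (2 * s)
      = s / 2 * (a ^ 2 * w) + 1 / (2 * s) * (m * b ^ 2) - |a| * |b| := by
    rw [← sq_abs a, ← sq_abs b]
    field_simp
    linear_combination (s ^ 2 * |a| ^ 2 * w - 2 * s * |a| * |b|) * h
  rw [abs_mul]
  linarith

theorem dirDeriv_velocity_eq_sum (w : Param d) (f : Phase d → ℝ) (x : Phase d) :
    ∂[((0, w) : Phase d)] f x = ∑ j, w j * ∂[velDir j] f x := by
  have hw : ((0, w) : Phase d) = ∑ j, w j • velDir j := by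
    refine Prod.ext ?_ ?_
    · simp [Prod.fst_sum, velDir]
    · simpa [Prod.snd_sum, velDir] using (sum_smul_stdDir w).symm
  rw [dirDeriv, hw, map_sum]
  simp [dirDeriv]

theorem abs_integral_logDensity_mul_dirDeriv_le (hU : ContDiff ℝ ∞ U) (hu : ContDiff ℝ ∞ u)
    (h0 : ∀ x, 0 ≤ u x) (hχ : ContDiff ℝ ∞ χ) (hχc : HasCompactSupport χ) (hχ0 : ∀ x, 0 ≤ χ x)
    (hζ : ContDiff ℝ ∞ ζ) (hζc : HasCompactSupport ζ) (hχζ : ∀ x ∈ tsupport ζ, χ x = 1)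
    (j : Fin d) {s : ℝ} (hs : 0 < s) :
    |∫ x, logDensity β U u x * ∂[velDir j] ζ x|
      ≤ s / 2 * (∫ x, ζ x ^ 2 * expEnergy β U x)
        + 1 / (2 * s) * ∫ x, χ x * dissipation β U u x := by
  have hl := contDiff_logDensity (β := β) hU hu h0
  have hprod := integrable_mul_of_contDiff hζ hζc (contDiff_dirDeriv (v := velDir j) hl)
  have hweight := (integrable_mul_of_contDiff (by fun_prop : ContDiff ℝ ∞ fun x => ζ x ^ 2)
    (hζc.comp_left (g := fun t => t ^ 2) (by simp)) (contDiff_expEnergy hU β)).const_mul (s / 2)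
  have hdiss := (integrable_mul_of_contDiff hχ hχc
    (contDiff_dissipation (β := β) hU hu h0)).const_mul (1 / (2 * s))
  have hpoint (x : Phase d) : |ζ x * ∂[velDir j] (logDensity β U u) x|
      ≤ s / 2 * (ζ x ^ 2 * expEnergy β U x) + 1 / (2 * s) * (χ x * dissipation β U u x) := by
    have hdiss0 := dissipation_nonneg β U u x
    by_cases hx : x ∈ tsupport ζ
    · rw [hχζ x hx, one_mul]
      refine (abs_mul_le_of_mul_eq_one (expEnergy_neg_mul β U x) (expEnergy_pos _ _ _) hs _ _).trans
        (add_le_add_right (mul_le_mul_of_nonneg_left ?_ (by positivity)) _)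
      exact mul_le_mul_of_nonneg_left (Finset.single_le_sum
        (f := fun i => ∂[velDir i] (logDensity β U u) x ^ 2) (fun i _ => sq_nonneg _)
        (Finset.mem_univ j)) (expEnergy_pos _ _ _).le
    · have hχx := hχ0 x
      rw [image_eq_zero_of_notMem_tsupport hx, zero_mul, abs_zero, zero_pow two_ne_zero, zero_mul,
        mul_zero, zero_add]
      positivity
  have hparts : ∫ x, logDensity β U u x * ∂[velDir j] ζ x
      = -∫ x, ζ x * ∂[velDir j] (logDensity β U u) x := by
    rw [integral_mul_dirDeriv_of_contDiff hζ hζc hl, neg_neg]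
    simp_rw [mul_comm]
  rw [hparts, abs_neg]
  calc |∫ x, ζ x * ∂[velDir j] (logDensity β U u) x|
      ≤ ∫ x, |ζ x * ∂[velDir j] (logDensity β U u) x| := abs_integral_le_integral_abs
    _ ≤ ∫ x, (s / 2 * (ζ x ^ 2 * expEnergy β U x)
          + 1 / (2 * s) * (χ x * dissipation β U u x)) :=
        integral_mono hprod.abs (hweight.add hdiss) hpoint
    _ = _ := by rw [integral_add hweight hdiss, integral_const_mul, integral_const_mul]

theorem IsRegularization.abs_logDensity_sub_le (h : IsRegularization V β σ ρ L κ U u E B)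
    {x : Phase d} (hx : 0 ≤ ρ x) :
    |logDensity β V ρ x - logDensity β U u x| ≤ expEnergy β V x *
      (Real.exp (|β| * κ) * |u x - ρ x| + (Real.exp (|β| * κ) - 1) * ρ x) := by
  have hU := expEnergy_pos β U x
  have hV := expEnergy_pos β V x
  have hlog := abs_log_one_add_sub_log_one_add_le (mul_nonneg hV.le hx)
    (mul_nonneg hU.le (h.nonneg x))
  refine hlog.trans ?_
  calc |expEnergy β V x * ρ x - expEnergy β U x * u x|
      = |expEnergy β U x * (u x - ρ x) + (expEnergy β U x - expEnergy β V x) * ρ x| := by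
        rw [abs_sub_comm]
        congr 1
        ring
    _ ≤ expEnergy β U x * |u x - ρ x| + |expEnergy β U x - expEnergy β V x| * ρ x := by
        refine (abs_add_le _ _).trans_eq ?_
        rw [abs_mul, abs_mul, abs_of_pos hU, abs_of_nonneg hx]
    _ ≤ Real.exp (|β| * κ) * expEnergy β V x * |u x - ρ x|
          + (Real.exp (|β| * κ) - 1) * expEnergy β V x * ρ x := by
        gcongr
        · exact expEnergy_le_exp_mul h.abs_potential_sub_le β x
        · exact abs_expEnergy_sub_le h.abs_potential_sub_le β x
    _ = _ := by ring

theorem IsRegularization.abs_integral_logDensity_sub_le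
    (h : IsRegularization V β σ ρ L κ U u E B) (hV : Continuous V) (hρ : Integrable ρ)
    (hρ0 : ∀ᵐ x, 0 ≤ ρ x) (hζ : ContDiff ℝ ∞ ζ) (hc : HasCompactSupport ζ) {v : Phase d} {M : ℝ}
    (hM : ∀ x, |expEnergy β V x * ∂[v] ζ x| ≤ M) :
    |(∫ x, logDensity β V ρ x * ∂[v] ζ x) - ∫ x, logDensity β U u x * ∂[v] ζ x|
      ≤ M * (Real.exp (|β| * κ) * κ + (Real.exp (|β| * κ) - 1) * ∫ x, ρ x) := by
  have hM0 : 0 ≤ M := (abs_nonneg _).trans (hM 0)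
  have hlV := integrable_logDensity_mul_dirDeriv hV hρ hρ0 β hζ hc v
  have hlU := integrable_logDensity_mul_dirDeriv h.contDiff_potential.continuous h.integrable
    (ae_of_all _ h.nonneg) β hζ hc v
  have hsub : Integrable fun x => Real.exp (|β| * κ) * |u x - ρ x| :=
    (h.integrable.sub hρ).abs.const_mul _
  have hmass := hρ.const_mul (Real.exp (|β| * κ) - 1)
  calc |(∫ x, logDensity β V ρ x * ∂[v] ζ x) - ∫ x, logDensity β U u x * ∂[v] ζ x|
      ≤ ∫ x, |logDensity β V ρ x * ∂[v] ζ x - logDensity β U u x * ∂[v] ζ x| := by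
        rw [← integral_sub hlV hlU]
        exact abs_integral_le_integral_abs
    _ ≤ ∫ x, M * (Real.exp (|β| * κ) * |u x - ρ x| + (Real.exp (|β| * κ) - 1) * ρ x) := by
        refine integral_mono_ae (hlV.sub hlU).abs ((hsub.add hmass).const_mul M)
          (hρ0.mono fun x hx => ?_)
        dsimp only
        have hκ : 0 ≤ κ := (abs_nonneg _).trans (h.abs_potential_sub_le 0)
        have hone : 0 ≤ Real.exp (|β| * κ) - 1 := sub_nonneg.2 (Real.one_le_exp (by positivity))
        rw [← sub_mul, abs_mul]
        refine (mul_le_mul_of_nonneg_right (h.abs_logDensity_sub_le hx) (abs_nonneg _)).trans ?_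
        rw [mul_right_comm, ← abs_of_pos (expEnergy_pos β V x), ← abs_mul]
        exact mul_le_mul_of_nonneg_right (hM x) (by positivity)
    _ = M * (Real.exp (|β| * κ) * (∫ x, |u x - ρ x|)
          + (Real.exp (|β| * κ) - 1) * ∫ x, ρ x) := by
        rw [integral_const_mul, integral_add hsub hmass, integral_const_mul, integral_const_mul]
    _ ≤ _ := by
        gcongr
        exact h.integral_abs_sub_le

theorem IsRegularization.integral_sq_mul_expEnergy_le
    (h : IsRegularization V β σ ρ L κ U u E B) (hV : Continuous V) (hζ : ContDiff ℝ ∞ ζ)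
    (hc : HasCompactSupport ζ) :
    ∫ x, ζ x ^ 2 * expEnergy β U x ≤ Real.exp (|β| * κ) * ∫ x, ζ x ^ 2 * expEnergy β V x := by
  have hsupp : HasCompactSupport fun x => ζ x ^ 2 := hc.comp_left (g := fun t => t ^ 2) (by simp)
  have hint {W : Param d → ℝ} (hW : Continuous W) : Integrable fun x => ζ x ^ 2 * expEnergy β W x :=
    ((hζ.continuous.pow 2).mul (continuous_expEnergy hW β)).integrable_of_hasCompactSupport
      hsupp.mul_right
  rw [← integral_const_mul]
  refine integral_mono (hint h.contDiff_potential.continuous) ((hint hV).const_mul _) fun x => ?_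
  rw [mul_left_comm]
  exact mul_le_mul_of_nonneg_left (expEnergy_le_exp_mul h.abs_potential_sub_le β x) (sq_nonneg _)

theorem abs_integral_logDensity_le_of_regularizations
    (h : ∀ κ > 0, ∃ U u E B, IsRegularization V β σ ρ L κ U u E B) (hσ : 0 < σ)
    (hV : Continuous V) (hρ : Integrable ρ) (hρ0 : ∀ᵐ x, 0 ≤ ρ x) (hχ : ContDiff ℝ ∞ χ)
    (hχc : HasCompactSupport χ) (hχ0 : ∀ x, 0 ≤ χ x) (hχ1 : ∀ x, χ x ≤ 1) (hζ : ContDiff ℝ ∞ ζ)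
    (hζc : HasCompactSupport ζ) (hχζ : ∀ x ∈ tsupport ζ, χ x = 1) (j : Fin d) {s : ℝ}
    (hs : 0 < s) :
    |∫ x, logDensity β V ρ x * ∂[velDir j] ζ x|
      ≤ s / 2 * (∫ x, ζ x ^ 2 * expEnergy β V x)
        + 1 / (s * σ) * ∫ x, generatorBound L β σ χ x * ρ x := by
  obtain ⟨M, hM⟩ := (hasCompactSupport_dirDeriv hζc (velDir j)).mul_left.exists_bound_of_continuous
    ((continuous_expEnergy hV β).mul (contDiff_dirDeriv hζ).continuous)
  obtain ⟨C, hC⟩ := exists_integral_dissipation_le (β := β) (V := V) (L := L) hσ hρ hχ hχc hχ0 hχ1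
  set Z := ∫ x, ζ x ^ 2 * expEnergy β V x
  set Γ := ∫ x, generatorBound L β σ χ x * ρ x
  set m := ∫ x, ρ x
  have hbound : ∀ κ > 0, |∫ x, logDensity β V ρ x * ∂[velDir j] ζ x|
      ≤ s / 2 * (Real.exp (|β| * κ) * Z) + 1 / (s * σ) * (Γ + C * κ)
        + M * (Real.exp (|β| * κ) * κ + (Real.exp (|β| * κ) - 1) * m) := by
    intro κ hκ
    obtain ⟨U, u, E, B, hreg⟩ := h κ hκ
    have hsmooth := abs_integral_logDensity_mul_dirDeriv_le (β := β) hreg.contDiff_potential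
      hreg.contDiff hreg.nonneg hχ hχc hχ0 hζ hζc hχζ j hs
    have happrox := (abs_sub_abs_le_abs_sub _ _).trans
      (hreg.abs_integral_logDensity_sub_le hV hρ hρ0 hζ hζc hM)
    have hweight := mul_le_mul_of_nonneg_left (hreg.integral_sq_mul_expEnergy_le hV hζ hζc)
      (half_pos hs).le
    have hdiss := mul_le_mul_of_nonneg_left (hC κ U u E B hreg)
      (by positivity : 0 ≤ 1 / (s * σ))
    have hscale (D : ℝ) : 1 / (s * σ) * (σ / 2 * D) = 1 / (2 * s) * D := by
      field_simp
    rw [hscale] at hdiss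
    linarith
  have hlim : Tendsto (fun κ : ℝ => s / 2 * (Real.exp (|β| * κ) * Z) + 1 / (s * σ) * (Γ + C * κ)
      + M * (Real.exp (|β| * κ) * κ + (Real.exp (|β| * κ) - 1) * m)) (𝓝[>] 0)
      (𝓝 (s / 2 * Z + 1 / (s * σ) * Γ)) :=
    ((by fun_prop : Continuous _).tendsto' 0 _ (by simp)).mono_left nhdsWithin_le_nhds
  exact ge_of_tendsto hlim (eventually_nhdsWithin_of_forall hbound)

theorem integral_logDensity_mul_dirDeriv_velDir_eq_zero
    (h : ∀ κ > 0, ∃ U u E B, IsRegularization V β σ ρ L κ U u E B) (hσ : 0 < σ)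
    (hV : Continuous V) (hρ : Integrable ρ) (hρ0 : ∀ᵐ x, 0 ≤ ρ x) (hζ : ContDiff ℝ ∞ ζ)
    (hc : HasCompactSupport ζ) (j : Fin d) :
    ∫ x, logDensity β V ρ x * ∂[velDir j] ζ x = 0 := by
  set Z := ∫ x, ζ x ^ 2 * expEnergy β V x
  have hbound : ∀ s > 0, |∫ x, logDensity β V ρ x * ∂[velDir j] ζ x| ≤ s * (Z / 2 + 1 / σ) := by
    intro s hs
    obtain ⟨χ, hχ, hχc, hχ0, hχ1, hχζ, hsmall⟩ :=
      exists_cutoff L β σ hρ hρ0 hc (pow_pos hs 2)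
    calc |∫ x, logDensity β V ρ x * ∂[velDir j] ζ x|
        ≤ s / 2 * Z + 1 / (s * σ) * ∫ x, generatorBound L β σ χ x * ρ x :=
          abs_integral_logDensity_le_of_regularizations h hσ hV hρ hρ0 hχ hχc hχ0 hχ1 hζ hc hχζ j hs
      _ ≤ s / 2 * Z + 1 / (s * σ) * s ^ 2 := by gcongr
      _ = s * (Z / 2 + 1 / σ) := by
          field_simp
  have hlim : Tendsto (fun s : ℝ => s * (Z / 2 + 1 / σ)) (𝓝[>] 0) (𝓝 0) :=
    ((by fun_prop : Continuous _).tendsto' 0 _ (by simp)).mono_left nhdsWithin_le_nhds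
  exact abs_nonpos_iff.1 (ge_of_tendsto hlim (eventually_nhdsWithin_of_forall hbound))

theorem exists_ae_expEnergy_mul_eq_comp_fst
    (h : ∀ κ > 0, ∃ U u E B, IsRegularization V β σ ρ L κ U u E B) (hσ : 0 < σ)
    (hV : Continuous V) (hρ : Integrable ρ) (hρ0 : ∀ᵐ x, 0 ≤ ρ x) :
    ∃ F : Param d → ℝ, ∀ᵐ x : Phase d, expEnergy β V x * ρ x = F x.1 := by
  have hloc := locallyIntegrable_logDensity hV hρ hρ0 β
  obtain ⟨F, hF, hlim⟩ := exists_tendsto_invariant_of_weak_deriv_eq_zero hloc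
      (S := {v | v.1 = 0}) <| by
    rintro ⟨v, w⟩ (rfl : v = 0) φ hφ hc
    simp_rw [dirDeriv_velocity_eq_sum, Finset.mul_sum, mul_left_comm _ (w _)]
    rw [integral_finsetSum _ fun j _ =>
      (integrable_logDensity_mul_dirDeriv hV hρ hρ0 β hφ hc _).const_mul _]
    refine Finset.sum_eq_zero fun j _ => ?_
    rw [integral_const_mul,
      integral_logDensity_mul_dirDeriv_velDir_eq_zero h hσ hV hρ hρ0 hφ hc j, mul_zero]
  refine ⟨fun θ => Real.exp (limUnder atTop fun n => F n (θ, 0)) - 1, ?_⟩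
  filter_upwards [hlim, hρ0] with x hx hx0
  have hinv (n : ℕ) : F n (x.1, 0) = F n x := by
    simpa using (hF n (x.1, 0) (0, x.2) rfl).symm
  simp_rw [hinv, hx.limUnder_eq]
  rw [logDensity, Real.exp_log (one_add_expEnergy_mul_pos hx0), add_sub_cancel_left]

end LogDensity

/-! ### Stationary solutions are Gibbs densities -/

section TwistedDerivative

variable {G : Type*} [NormedAddCommGroup G] [NormedSpace ℝ G] {L : NNReal} {f V : G → ℝ} {β : ℝ}

theorem dirDeriv_exp_mul_mul {U φ : G → ℝ} (hU : ContDiff ℝ ∞ U) (hφ : ContDiff ℝ ∞ φ) (β : ℝ)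
    (v x : G) :
    ∂[v] (fun y => Real.exp (β * U y) * φ y) x
      = Real.exp (β * U x) * (∂[v] φ x + β * ∂[v] U x * φ x) := by
  have hUd : Differentiable ℝ U := hU.differentiable (by simp)
  have hφd : Differentiable ℝ φ := hφ.differentiable (by simp)
  have hexp : HasDerivAt (fun t => Real.exp (β * t)) (Real.exp (β * U x) * β) (U x) := by
    simpa using ((hasDerivAt_id (U x)).const_mul β).exp
  rw [dirDeriv_mul (by fun_prop) (by fun_prop), dirDeriv_comp hexp (hUd x)]
  ring

theorem abs_exp_mul_mul_dirDeriv_add_le {U : G → ℝ} (hU : LipschitzWith L U)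
    (hV : LipschitzWith L V) {x : G} {δ : ℝ} (h : |U x - V x| ≤ δ) (β : ℝ) (v : G) (φ : G → ℝ) :
    |Real.exp (β * U x) * (∂[v] φ x + β * (∂[v] U x - ∂[v] V x) * φ x)|
      ≤ Real.exp (|β| * δ)
        * (Real.exp (β * V x) * (|∂[v] φ x| + |β| * (2 * (L * ‖v‖)) * |φ x|)) := by
  have hexp : β * U x ≤ |β| * δ + β * V x := by
    have : β * (U x - V x) ≤ |β| * δ :=
      (le_abs_self _).trans ((abs_mul _ _).trans_le (by gcongr))
    linarith
  have hforce : |∂[v] U x - ∂[v] V x| ≤ 2 * (L * ‖v‖) := by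
    linarith [abs_sub (∂[v] U x) (∂[v] V x), abs_dirDeriv_le hU v x, abs_dirDeriv_le hV v x]
  rw [abs_mul, Real.abs_exp, ← mul_assoc, ← Real.exp_add]
  gcongr
  refine (abs_add_le _ _).trans ?_
  rw [abs_mul, abs_mul]
  gcongr

variable [FiniteDimensional ℝ G] [MeasureSpace G] [BorelSpace G]
  [(volume : Measure G).IsAddHaarMeasure]

theorem tendsto_integral_mul_exp_mollify_mul_dirDeriv_add (hV : Differentiable ℝ V)
    (hL : LipschitzWith L V) (hf : LocallyIntegrable f) (β : ℝ) (v : G) {φ : G → ℝ}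
    (hφ : ContDiff ℝ ∞ φ) (hc : HasCompactSupport φ) :
    Tendsto (fun n => ∫ x, f x * (Real.exp (β * mollify (stdMollifier G n) V x)
        * (∂[v] φ x + β * (∂[v] (mollify (stdMollifier G n) V) x - ∂[v] V x) * φ x))) atTop
      (𝓝 (∫ x, f x * (Real.exp (β * V x) * ∂[v] φ x))) := by
  set U : ℕ → G → ℝ := fun n => mollify (stdMollifier G n) V
  have hk (n : ℕ) := isMollifier_stdMollifier (G := G) n
  have hUV (n : ℕ) (x : G) : |U n x - V x| ≤ L * 2 :=
    ((hk n).abs_mollify_sub_le hL x).trans <| mul_le_mul_of_nonneg_left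
      (div_le_self zero_le_two (by simp)) L.coe_nonneg
  have hVc := hL.continuous
  have hUc (n : ℕ) : Continuous (U n) :=
    (contDiff_mollify (hk n).contDiff (hk n).hasCompactSupport hVc.locallyIntegrable).continuous
  have hφc := hφ.continuous
  have hφc' := (contDiff_dirDeriv (v := v) hφ).continuous
  have hVm := measurable_dirDeriv v V
  have hUm (n : ℕ) := measurable_dirDeriv v (U n)
  have hmeas (n : ℕ) : Measurable fun x =>
      Real.exp (β * U n x) * (∂[v] φ x + β * (∂[v] (U n) x - ∂[v] V x) * φ x) := by fun_prop
  set w : G → ℝ := fun x => Real.exp (β * V x) * (|∂[v] φ x| + |β| * (2 * (L * ‖v‖)) * |φ x|)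
  have hw : Continuous w := by fun_prop
  have hwc : HasCompactSupport w :=
    ((hasCompactSupport_dirDeriv hc v).abs.add hc.abs.mul_left).mul_left
  refine tendsto_integral_of_dominated_convergence
    (fun x => ‖f x * (Real.exp (|β| * (L * 2)) * w x)‖)
    (fun n => hf.aestronglyMeasurable.mul (hmeas n).aestronglyMeasurable)
    (hf.integrable_smul_right_of_hasCompactSupport
      (continuous_const.mul hw) hwc.mul_left).norm
    (fun n => ae_of_all _ fun x => ?_) ?_
  · have hbound := abs_exp_mul_mul_dirDeriv_add_le ((hk n).lipschitzWith_mollify hL) hL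
      (hUV n x) β v φ
    rw [norm_mul, norm_mul (f x)]
    exact mul_le_mul_of_nonneg_left (hbound.trans (le_abs_self _)) (abs_nonneg (f x))
  · filter_upwards [ae_tendsto_dirDeriv_mollify_stdMollifier hV hL v] with x hx
    have hexp := ((tendsto_mollify_stdMollifier hL x).const_mul β).rexp
    have hforce := ((hx.sub_const (∂[v] V x)).const_mul β).mul_const (φ x)
    simpa using (hexp.mul (hforce.const_add (∂[v] φ x))).const_mul (f x)

theorem integral_mul_exp_mul_dirDeriv_eq_zero (hV : Differentiable ℝ V) (hL : LipschitzWith L V)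
    (hf : LocallyIntegrable f) {v : G}
    (h : ∀ φ : G → ℝ, ContDiff ℝ ∞ φ → HasCompactSupport φ →
      ∫ x, f x * (∂[v] φ x - β * ∂[v] V x * φ x) = 0)
    {φ : G → ℝ} (hφ : ContDiff ℝ ∞ φ) (hc : HasCompactSupport φ) :
    ∫ x, f x * (Real.exp (β * V x) * ∂[v] φ x) = 0 := by
  refine tendsto_nhds_unique
    (tendsto_integral_mul_exp_mollify_mul_dirDeriv_add hV hL hf β v hφ hc)
    (tendsto_const_nhds.congr fun n => ?_)
  have hk := isMollifier_stdMollifier (G := G) n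
  have hU : ContDiff ℝ ∞ (mollify (stdMollifier G n) V) :=
    contDiff_mollify hk.contDiff hk.hasCompactSupport hL.continuous.locallyIntegrable
  rw [← h (fun x => Real.exp (β * mollify (stdMollifier G n) V x) * φ x) (by fun_prop) hc.mul_left]
  refine integral_congr_ae (ae_of_all _ fun x => ?_)
  simp only [dirDeriv_exp_mul_mul hU hφ]
  ring

theorem exists_ae_eq_mul_exp_neg (hV : Differentiable ℝ V) (hL : LipschitzWith L V)
    (hf : LocallyIntegrable f)
    (h : ∀ v, ∀ φ : G → ℝ, ContDiff ℝ ∞ φ → HasCompactSupport φ →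
      ∫ x, f x * (∂[v] φ x - β * ∂[v] V x * φ x) = 0) :
    ∃ c, ∀ᵐ x, f x = c * Real.exp (-(β * V x)) := by
  have hexp : Continuous fun x => Real.exp (β * V x) := by
    have := hL.continuous
    fun_prop
  have hloc : LocallyIntegrable fun x => f x * Real.exp (β * V x) :=
    hf.mul_continuous hexp
  obtain ⟨c, hc⟩ := exists_ae_eq_const_of_weak_deriv_eq_zero hloc fun v φ hφ hφc => by
    simpa only [mul_assoc] using integral_mul_exp_mul_dirDeriv_eq_zero hV hL hf (h v) hφ hφc
  refine ⟨c, hc.mono fun x hx => ?_⟩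
  rw [← hx, mul_assoc, ← Real.exp_add, add_neg_cancel, Real.exp_zero, mul_one]

end TwistedDerivative

section Maxwellian

variable {d : ℕ} {β : ℝ}

/-- The Maxwellian velocity distribution `r ↦ exp (-β|r|²/2) / Z` at inverse temperature `β`. -/
def maxwellian (β : ℝ) (r : Param d) : ℝ :=
  Real.exp (-β * (‖r‖ ^ 2 / 2)) / ∫ s : Param d, Real.exp (-β * (‖s‖ ^ 2 / 2))

theorem integral_exp_neg_mul_half_norm_sq_pos (hβ : 0 < β) :
    0 < ∫ r : Param d, Real.exp (-β * (‖r‖ ^ 2 / 2)) := by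
  have h := GaussianFourier.integral_rexp_neg_mul_sq_norm (V := Param d) (half_pos hβ)
  simp_rw [show ∀ r : Param d, -β * (‖r‖ ^ 2 / 2) = -(β / 2) * ‖r‖ ^ 2 from fun r => by ring, h]
  positivity

theorem maxwellian_pos (hβ : 0 < β) (r : Param d) : 0 < maxwellian β r :=
  div_pos (Real.exp_pos _) (integral_exp_neg_mul_half_norm_sq_pos hβ)

theorem integral_maxwellian (hβ : 0 < β) : ∫ r : Param d, maxwellian β r = 1 := by
  simp_rw [maxwellian]
  rw [integral_div, div_self (integral_exp_neg_mul_half_norm_sq_pos hβ).ne']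

@[fun_prop]
theorem contDiff_maxwellian (β : ℝ) : ContDiff ℝ ∞ (maxwellian (d := d) β) := by
  have : ContDiff ℝ ∞ fun r : Param d => ‖r‖ ^ 2 := contDiff_norm_sq ℝ
  exact (((this.div_const 2).const_smul (-β)).exp).div_const _

theorem dirDeriv_maxwellian (β : ℝ) (j : Fin d) (r : Param d) :
    ∂[stdDir j] (maxwellian β) r = -(β * (r j * maxwellian β r)) := by
  have hexp (t : ℝ) : HasDerivAt
      (fun t => Real.exp (-β * t) / ∫ s : Param d, Real.exp (-β * (‖s‖ ^ 2 / 2)))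
      (Real.exp (-β * t) * -β / ∫ s : Param d, Real.exp (-β * (‖s‖ ^ 2 / 2))) t := by
    simpa using (((hasDerivAt_id t).const_mul (-β)).exp).div_const _
  refine (dirDeriv_comp (hexp _) (differentiable_half_norm_sq r)).trans ?_
  rw [dirDeriv_half_norm_sq, maxwellian]
  ring

theorem integral_dirDeriv_mul_maxwellian {a : Param d → ℝ} (ha : ContDiff ℝ ∞ a)
    (hac : HasCompactSupport a) (β : ℝ) (j : Fin d) :
    ∫ r, ∂[stdDir j] a r * maxwellian β r = β * ∫ r, r j * a r * maxwellian β r := by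
  rw [← neg_inj, ← integral_mul_dirDeriv_of_contDiff ha hac (contDiff_maxwellian β),
    ← integral_const_mul, ← integral_neg]
  refine integral_congr_ae (ae_of_all _ fun r => ?_)
  simp only [dirDeriv_maxwellian]
  ring

theorem integral_friction_mul_maxwellian {a : Param d → ℝ} (ha : ContDiff ℝ ∞ a)
    (hac : HasCompactSupport a) (β : ℝ) (j : Fin d) :
    ∫ r, (∂[stdDir j] (∂[stdDir j] a) r - β * (r j * ∂[stdDir j] a r)) * maxwellian β r = 0 := by
  have ha' : ContDiff ℝ ∞ (∂[stdDir j] a) := contDiff_dirDeriv ha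
  have hac' := hasCompactSupport_dirDeriv hac (stdDir j)
  have hsecond : Integrable fun r => ∂[stdDir j] (∂[stdDir j] a) r * maxwellian β r :=
    (by fun_prop : Continuous _).integrable_of_hasCompactSupport
      (hasCompactSupport_dirDeriv hac' _).mul_right
  have hfirst : Integrable fun r => β * (r j * ∂[stdDir j] a r * maxwellian β r) :=
    (by fun_prop : Continuous _).integrable_of_hasCompactSupport
      hac'.mul_left.mul_right.mul_left
  calc ∫ r, (∂[stdDir j] (∂[stdDir j] a) r - β * (r j * ∂[stdDir j] a r)) * maxwellian β r
      = ∫ r, (∂[stdDir j] (∂[stdDir j] a) r * maxwellian β r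
          - β * (r j * ∂[stdDir j] a r * maxwellian β r)) := by
        simp only [sub_mul, mul_assoc]
    _ = 0 := by
        rw [integral_sub hsecond hfirst, integral_const_mul,
          integral_dirDeriv_mul_maxwellian ha' hac', sub_self]

theorem exists_integral_coord_mul_maxwellian_eq (hβ : 0 < β) (v : Param d) :
    ∃ a : Param d → ℝ, ContDiff ℝ ∞ a ∧ HasCompactSupport a ∧
      ∀ j, ∫ r, r j * a r * maxwellian β r = v j := by
  obtain ⟨b, hb⟩ := exists_isMollifier (G := Param d) one_pos
  refine ⟨fun r => -∂[v] b r * (maxwellian β r)⁻¹, ?_, ?_, fun j => ?_⟩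
  · exact (contDiff_dirDeriv hb.contDiff).neg.mul
      ((contDiff_maxwellian β).inv fun r => (maxwellian_pos hβ r).ne')
  · exact (hasCompactSupport_dirDeriv hb.hasCompactSupport v).neg.mul_right
  · calc ∫ r, r j * (-∂[v] b r * (maxwellian β r)⁻¹) * maxwellian β r
        = -∫ r, ∂[v] b r * EuclideanSpace.proj (𝕜 := ℝ) j r := by
          rw [← integral_neg]
          refine integral_congr_ae (ae_of_all _ fun r => ?_)
          have := (maxwellian_pos hβ r).ne'
          simp only [PiLp.proj_apply]
          field_simp
      _ = ∫ r, b r * v j := by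
          rw [← integral_mul_dirDeriv_of_contDiff hb.contDiff hb.hasCompactSupport
            (EuclideanSpace.proj (𝕜 := ℝ) j).contDiff]
          simp only [dirDeriv_clm, PiLp.proj_apply]
      _ = v j := by rw [integral_mul_const, hb.integral_eq_one, one_mul]

end Maxwellian

section Tensor

variable {d : ℕ} {V : Param d → ℝ} {L : NNReal} {β σ : ℝ} {η : Param d → ℝ}

theorem kineticGenerator_tensor {φ a : Param d → ℝ} (hφ : ContDiff ℝ ∞ φ) (ha : ContDiff ℝ ∞ a)
    (x : Phase d) :
    kineticGenerator V β σ (fun y => φ y.1 * a y.2) x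
      = ∑ j, (∂[stdDir j] φ x.1 * (x.2 j * a x.2) - ∂[stdDir j] V x.1 * φ x.1 * ∂[stdDir j] a x.2
        + σ * (φ x.1 * (∂[stdDir j] (∂[stdDir j] a) x.2 - β * (x.2 j * ∂[stdDir j] a x.2)))) := by
  have hφd : Differentiable ℝ φ := hφ.differentiable (by simp)
  have hdiff {b : Param d → ℝ} (hb : ContDiff ℝ ∞ b) : Differentiable ℝ b :=
    hb.differentiable (by simp)
  have hvel (j : Fin d) {b : Param d → ℝ} (hb : ContDiff ℝ ∞ b) :
      ∂[velDir j] (fun y => φ y.1 * b y.2) = fun y => φ y.1 * ∂[stdDir j] b y.2 :=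
    funext fun y => by
      have hbd := hdiff hb
      rw [dirDeriv_mul (by fun_prop) (by fun_prop), dirDeriv_velDir_comp_fst (hφd _),
        dirDeriv_comp_snd (hbd _), zero_mul, add_zero, velDir]
  have hpos (j : Fin d) : ∂[posDir j] (fun y => φ y.1 * a y.2) x = ∂[stdDir j] φ x.1 * a x.2 := by
    have had := hdiff ha
    rw [dirDeriv_mul (by fun_prop) (by fun_prop), dirDeriv_posDir_comp_snd (had _),
      dirDeriv_comp_fst (hφd _), mul_zero, zero_add, posDir]
  refine Finset.sum_congr rfl fun j _ => ?_
  simp only [hpos, hvel j ha, hvel j (contDiff_dirDeriv ha)]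
  ring

theorem integral_tensor_sub_tensor_add_tensor {p q s b c e : Param d → ℝ} (hp : Integrable p)
    (hq : Integrable q) (hs : Integrable s) (hb : Integrable b) (hc : Integrable c)
    (he : Integrable e) :
    Integrable (fun x : Phase d => p x.1 * b x.2 - q x.1 * c x.2 + s x.1 * e x.2) ∧
    ∫ x : Phase d, (p x.1 * b x.2 - q x.1 * c x.2 + s x.1 * e x.2)
      = (∫ θ, p θ) * (∫ r, b r) - (∫ θ, q θ) * (∫ r, c r) + (∫ θ, s θ) * ∫ r, e r := by
  have hpb : Integrable fun x : Phase d => p x.1 * b x.2 := hp.mul_prod hb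
  have hqc : Integrable fun x : Phase d => q x.1 * c x.2 := hq.mul_prod hc
  have hse : Integrable fun x : Phase d => s x.1 * e x.2 := hs.mul_prod he
  have hdiff : Integrable fun x : Phase d => p x.1 * b x.2 - q x.1 * c x.2 := hpb.sub hqc
  refine ⟨hdiff.add hse, ?_⟩
  rw [integral_add hdiff hse, integral_sub hpb hqc, Measure.volume_eq_prod,
    integral_prod_mul, integral_prod_mul, integral_prod_mul]

theorem integrable_mul_of_hasCompactSupport {ζ : Param d → ℝ} (hη : Integrable η)
    (hζ : Continuous ζ) (hζc : HasCompactSupport ζ) : Integrable fun θ => η θ * ζ θ :=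
  hη.locallyIntegrable.integrable_smul_right_of_hasCompactSupport hζ hζc

theorem integrable_dirDeriv_mul_mul (hL : LipschitzWith L V) (hη : Integrable η)
    {φ : Param d → ℝ} (hφ : Continuous φ) (hφc : HasCompactSupport φ) (j : Fin d) :
    Integrable fun θ => ∂[stdDir j] V θ * (η θ * φ θ) :=
  (integrable_mul_of_hasCompactSupport hη hφ hφc).bdd_mul
    (measurable_dirDeriv _ V).aestronglyMeasurable (ae_of_all _ (abs_dirDeriv_stdDir_le hL j))

theorem integrable_mul_dirDeriv (hη : Integrable η) {φ : Param d → ℝ} (hφ : ContDiff ℝ ∞ φ)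
    (hφc : HasCompactSupport φ) (v : Param d) : Integrable fun θ => η θ * ∂[v] φ θ :=
  integrable_mul_of_hasCompactSupport hη (contDiff_dirDeriv hφ).continuous
    (hasCompactSupport_dirDeriv hφc v)

theorem integral_mul_dirDeriv_sub (hL : LipschitzWith L V) (hη : Integrable η) {φ : Param d → ℝ}
    (hφ : ContDiff ℝ ∞ φ) (hφc : HasCompactSupport φ) (j : Fin d) :
    ∫ θ, η θ * (∂[stdDir j] φ θ - β * ∂[stdDir j] V θ * φ θ)
      = (∫ θ, η θ * ∂[stdDir j] φ θ) - β * ∫ θ, ∂[stdDir j] V θ * (η θ * φ θ) := by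
  rw [← integral_const_mul, ← integral_sub (integrable_mul_dirDeriv hη hφ hφc _)
    ((integrable_dirDeriv_mul_mul hL hη hφ.continuous hφc j).const_mul β)]
  congr with θ
  ring

theorem integral_kineticGenerator_tensor_mul (hL : LipschitzWith L V) (hη : Integrable η)
    {φ a : Param d → ℝ} (hφ : ContDiff ℝ ∞ φ) (hφc : HasCompactSupport φ) (ha : ContDiff ℝ ∞ a)
    (hac : HasCompactSupport a) :
    ∫ x : Phase d, kineticGenerator V β σ (fun y => φ y.1 * a y.2) x
        * (η x.1 * maxwellian β x.2)
      = ∑ j, (∫ r, r j * a r * maxwellian β r)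
          * ∫ θ, η θ * (∂[stdDir j] φ θ - β * ∂[stdDir j] V θ * φ θ) := by
  have hvel {b : Param d → ℝ} (hb : Continuous b) (hbc : HasCompactSupport b) :
      Integrable fun r => b r * maxwellian β r :=
    (by fun_prop : Continuous fun r => b r * maxwellian β r).integrable_of_hasCompactSupport
      hbc.mul_right
  have hacont := ha.continuous
  have ha' (j : Fin d) : ContDiff ℝ ∞ (∂[stdDir j] a) := contDiff_dirDeriv ha
  have ha'' (j : Fin d) : ContDiff ℝ ∞ (∂[stdDir j] (∂[stdDir j] a)) := contDiff_dirDeriv (ha' j)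
  have hacont' (j : Fin d) := (ha' j).continuous
  have hacont'' (j : Fin d) := (ha'' j).continuous
  have hac' (j : Fin d) := hasCompactSupport_dirDeriv hac (stdDir j)
  have hgrad (j : Fin d) := integrable_mul_dirDeriv hη hφ hφc (stdDir j)
  have hforce := integrable_dirDeriv_mul_mul hL hη hφ.continuous hφc
  have hterm (j : Fin d) := integral_tensor_sub_tensor_add_tensor (hgrad j) (hforce j)
    ((integrable_mul_of_hasCompactSupport hη hφ.continuous hφc).const_mul σ)
    (hvel (b := fun r => r j * a r) (by fun_prop) hac.mul_left) (hvel (hacont' j) (hac' j))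
    (hvel (b := fun r => ∂[stdDir j] (∂[stdDir j] a) r - β * (r j * ∂[stdDir j] a r))
      (by fun_prop) ((hasCompactSupport_dirDeriv (hac' j) _).sub (hac' j).mul_left.mul_left))
  calc _ = ∫ x : Phase d, ∑ j, (η x.1 * ∂[stdDir j] φ x.1 * (x.2 j * a x.2 * maxwellian β x.2)
          - ∂[stdDir j] V x.1 * (η x.1 * φ x.1) * (∂[stdDir j] a x.2 * maxwellian β x.2)
          + σ * (η x.1 * φ x.1) * ((∂[stdDir j] (∂[stdDir j] a) x.2
            - β * (x.2 j * ∂[stdDir j] a x.2)) * maxwellian β x.2)) := by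
        congr with x
        rw [kineticGenerator_tensor hφ ha, Finset.sum_mul]
        exact Finset.sum_congr rfl fun j _ => by ring
    _ = _ := by
        rw [integral_finsetSum _ fun j _ => (hterm j).1]
        refine Finset.sum_congr rfl fun j _ => ?_
        rw [(hterm j).2, integral_dirDeriv_mul_maxwellian ha hac,
          integral_friction_mul_maxwellian ha hac,
          integral_mul_dirDeriv_sub hL hη hφ hφc]
        ring

theorem IsWeakStationary.integral_mul_dirDeriv_sub_eq_zero {ρ : Phase d → ℝ}
    (h : IsWeakStationary V β σ ρ) (hβ : 0 < β) (hL : LipschitzWith L V) (hη : Integrable η)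
    (hρ : ∀ᵐ x : Phase d, ρ x = η x.1 * maxwellian β x.2) (v : Param d) {φ : Param d → ℝ}
    (hφ : ContDiff ℝ ∞ φ) (hφc : HasCompactSupport φ) :
    ∫ θ, η θ * (∂[v] φ θ - β * ∂[v] V θ * φ θ) = 0 := by
  obtain ⟨a, ha, hac, hav⟩ := exists_integral_coord_mul_maxwellian_eq hβ v
  have hzero : ∑ j, v j * ∫ θ, η θ * (∂[stdDir j] φ θ - β * ∂[stdDir j] V θ * φ θ) = 0 := by
    simp_rw [← hav, ← integral_kineticGenerator_tensor_mul (σ := σ) hL hη hφ hφc ha hac]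
    rw [← h (fun x => φ x.1 * a x.2) (by fun_prop) (hasCompactSupport_fst_mul_snd hφc hac)]
    exact integral_congr_ae (hρ.mono fun x hx => by simp only [hx])
  have hint (j : Fin d) :
      Integrable fun θ => η θ * (∂[stdDir j] φ θ - β * ∂[stdDir j] V θ * φ θ) := by
    refine ((integrable_mul_of_hasCompactSupport hη (contDiff_dirDeriv hφ).continuous
      (hasCompactSupport_dirDeriv hφc (stdDir j))).sub
      ((integrable_dirDeriv_mul_mul hL hη hφ.continuous hφc j).const_mul β)).congr
      (ae_of_all _ fun θ => ?_)
    simp only [Pi.sub_apply]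
    ring
  rw [← hzero]
  simp_rw [← integral_const_mul]
  rw [← integral_finsetSum _ fun j _ => (hint j).const_mul _]
  congr with θ
  rw [dirDeriv_eq_sum_stdDir v φ, dirDeriv_eq_sum_stdDir v V, Finset.mul_sum, Finset.sum_mul,
    ← Finset.sum_sub_distrib, Finset.mul_sum]
  exact Finset.sum_congr rfl fun j _ => by ring

end Tensor

section Gibbs

variable {d : ℕ} {V : Param d → ℝ} {L : NNReal} {β σ : ℝ} {ρ : Phase d → ℝ}

theorem marginal_ae_eq_of_ae_eq_mul_maxwellian {f : Param d → ℝ} (hβ : 0 < β)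
    (h : ∀ᵐ x : Phase d, ρ x = f x.1 * maxwellian β x.2) : ∀ᵐ θ, marginal ρ θ = f θ := by
  filter_upwards [Measure.ae_ae_of_ae_prod h] with θ hθ
  rw [marginal, integral_congr_ae hθ, integral_const_mul, integral_maxwellian hβ, mul_one]

theorem ae_eq_marginal_mul_maxwellian {F : Param d → ℝ} (hβ : 0 < β)
    (h : ∀ᵐ x : Phase d, expEnergy β V x * ρ x = F x.1) :
    ∀ᵐ x : Phase d, ρ x = marginal ρ x.1 * maxwellian β x.2 := by
  set Z : ℝ := ∫ r : Param d, Real.exp (-β * (‖r‖ ^ 2 / 2)) with hZ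
  have hZ0 : Z ≠ 0 := (integral_exp_neg_mul_half_norm_sq_pos hβ).ne'
  have hf : ∀ᵐ x : Phase d,
      ρ x = F x.1 * Real.exp (-β * V x.1) * Z * maxwellian β x.2 := by
    filter_upwards [h] with x hx
    have hexp :
        expEnergy β V x * (Real.exp (-β * V x.1) * Real.exp (-β * (‖x.2‖ ^ 2 / 2))) = 1 := by
      rw [expEnergy, ← Real.exp_add, ← Real.exp_add, Real.exp_eq_one_iff]
      ring
    rw [maxwellian, ← hZ, mul_assoc, mul_div_cancel₀ _ hZ0, ← hx]
    linear_combination (-ρ x) * hexp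
  have hmarginal : ∀ᵐ x : Phase d, marginal ρ x.1 = F x.1 * Real.exp (-β * V x.1) * Z :=
    Measure.quasiMeasurePreserving_fst.ae (marginal_ae_eq_of_ae_eq_mul_maxwellian
      (f := fun θ => F θ * Real.exp (-β * V θ) * Z) hβ hf)
  filter_upwards [hf, hmarginal] with x hx hm
  rw [hx, hm]

theorem IsDensity.marginal (h : IsDensity ρ) : IsDensity (marginal ρ) where
  integrable := h.integrable.integral_prod_left
  nonneg := (Measure.ae_ae_of_ae_prod h.nonneg).mono fun _ hθ => integral_nonneg_of_ae hθ
  integral_eq_one := (integral_prod ρ h.integrable).symm.trans h.integral_eq_one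

theorem IsWeakStationary.exists_marginal_ae_eq (h : IsWeakStationary V β σ ρ) (hβ : 0 < β)
    (hσ : 0 < σ) (hV : Differentiable ℝ V) (hL : LipschitzWith L V) (hρ : IsDensity ρ) :
    ∃ c, ∀ᵐ θ, HeavyBall.marginal ρ θ = c * Real.exp (-(β * V θ)) := by
  obtain ⟨F, hF⟩ := exists_ae_expEnergy_mul_eq_comp_fst
    (fun κ hκ => h.exists_isRegularization hV hL hρ.integrable hρ.nonneg hκ) hσ hL.continuous
    hρ.integrable hρ.nonneg
  have hη := hρ.marginal.integrable
  exact exists_ae_eq_mul_exp_neg hV hL hη.locallyIntegrable fun v φ hφ hφc =>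
    h.integral_mul_dirDeriv_sub_eq_zero hβ hL hη (ae_eq_marginal_mul_maxwellian hβ hF) v hφ hφc

end Gibbs

/-! ### Optimality of self-consistent Gibbs densities -/

section Convexity

theorem add_fderiv_sub_le_of_convexOn {E : Type*} [NormedAddCommGroup E] [NormedSpace ℝ E]
    {R : E → ℝ} (hR : ConvexOn ℝ Set.univ R) {a : E} (hd : DifferentiableAt ℝ R a) (b : E) :
    R a + fderiv ℝ R a (b - a) ≤ R b := by
  have hconv : ConvexOn ℝ Set.univ (R ∘ AffineMap.lineMap a b) :=
    hR.comp_affineMap (AffineMap.lineMap a b : ℝ →ᵃ[ℝ] E)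
  have hderiv : HasDerivAt (R ∘ AffineMap.lineMap a b) (fderiv ℝ R a (b - a)) (0 : ℝ) := by
    refine HasFDerivAt.comp_hasDerivAt (0 : ℝ) ?_ AffineMap.hasDerivAt_lineMap
    simpa using hd.hasFDerivAt
  have hslope := hconv.le_slope_of_hasDerivAt (Set.mem_univ 0) (Set.mem_univ 1) zero_lt_one hderiv
  simp only [slope_def_field, Function.comp_apply, AffineMap.lineMap_apply_zero,
    AffineMap.lineMap_apply_one, sub_zero, div_one] at hslope
  linarith

end Convexity

section LogPartition

variable {E : Type*} [NormedAddCommGroup E] [NormedSpace ℝ E] [FiniteDimensional ℝ E]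
  [MeasurableSpace E] [BorelSpace E] {μ : Measure E} [μ.IsAddHaarMeasure] {V : E → ℝ} {L : NNReal}
  {β : ℝ}

theorem exp_mul_measureReal_ball_le_integral (hL : LipschitzWith L V) (hβ : 0 < β)
    (hi : Integrable (fun x => Real.exp (-(β * V x))) μ) (x₀ : E) :
    Real.exp (-(β * V x₀) - L) * μ.real (Metric.ball x₀ β⁻¹) ≤ ∫ x, Real.exp (-(β * V x)) ∂μ := by
  have hlower {x : E} (hx : x ∈ Metric.ball x₀ β⁻¹) : -(β * V x₀) - L ≤ -(β * V x) := by
    have hV : V x - V x₀ ≤ L * β⁻¹ :=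
      (le_abs_self _).trans <| (hL.dist_le_mul x x₀).trans <| by
        gcongr
        exact (Metric.mem_ball.1 hx).le
    have : β * (V x - V x₀) ≤ L := (mul_le_mul_of_nonneg_left hV hβ.le).trans_eq (by field_simp)
    linarith
  calc Real.exp (-(β * V x₀) - L) * μ.real (Metric.ball x₀ β⁻¹)
      = ∫ _ in Metric.ball x₀ β⁻¹, Real.exp (-(β * V x₀) - L) ∂μ := by
        rw [setIntegral_const, smul_eq_mul, mul_comm]
    _ ≤ ∫ x in Metric.ball x₀ β⁻¹, Real.exp (-(β * V x)) ∂μ :=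
        setIntegral_mono_on (integrableOn_const measure_ball_lt_top.ne) hi.integrableOn
          measurableSet_ball fun x hx => Real.exp_le_exp.2 (hlower hx)
    _ ≤ ∫ x, Real.exp (-(β * V x)) ∂μ :=
        setIntegral_le_integral hi (ae_of_all _ fun x => (Real.exp_pos _).le)

theorem neg_log_integral_exp_neg_le (hL : LipschitzWith L V) (hβ : 0 < β)
    (hi : Integrable (fun x => Real.exp (-(β * V x))) μ) (x₀ : E) :
    -Real.log (∫ x, Real.exp (-(β * V x)) ∂μ)
      ≤ β * V x₀ + (L + Module.finrank ℝ E * Real.log β - Real.log (μ.real (Metric.ball 0 1))) := by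
  have hunit : 0 < μ.real (Metric.ball (0 : E) 1) :=
    ENNReal.toReal_pos (Metric.measure_ball_pos _ _ one_pos).ne' measure_ball_lt_top.ne
  have hball : μ.real (Metric.ball x₀ β⁻¹)
      = β⁻¹ ^ Module.finrank ℝ E * μ.real (Metric.ball (0 : E) 1) := by
    rw [measureReal_def, Measure.addHaar_ball_of_pos _ _ (inv_pos.2 hβ), ENNReal.toReal_mul,
      ENNReal.toReal_ofReal (by positivity), measureReal_def]
  have hlog := Real.log_le_log (by rw [hball]; positivity)
    (exp_mul_measureReal_ball_le_integral hL hβ hi x₀)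
  rw [hball, Real.log_mul (Real.exp_pos _).ne' (by positivity), Real.log_exp,
    Real.log_mul (by positivity) hunit.ne', Real.log_pow, Real.log_inv] at hlog
  linarith

end LogPartition

section Entropy

theorem exp_neg_mul_sub_le (u a : ℝ) : Real.exp (-u) * (u - a) ≤ Real.exp (-a) - Real.exp (-u) := by
  have h := mul_le_mul_of_nonneg_left (Real.add_one_le_exp (u - a)) (Real.exp_pos (-u)).le
  rw [← Real.exp_add, show -u + (u - a) = -a by ring] at h
  linarith

variable {α : Type*} [MeasureSpace α] {f g m V η : α → ℝ} {a β c : ℝ}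

theorem IsDensity.le_integral_mul (hη : IsDensity η) (hV : ∀ x, a ≤ V x)
    (hi : Integrable fun x => V x * η x) : a ≤ ∫ x, V x * η x :=
  calc a = ∫ x, a * η x := by rw [integral_const_mul, hη.integral_eq_one, mul_one]
    _ ≤ ∫ x, V x * η x := integral_mono_ae (hη.integrable.const_mul a) hi
        (hη.nonneg.mono fun x hx => mul_le_mul_of_nonneg_right (hV x) hx)

theorem IsDensity.mul_integral_exp_neg_eq_one (hm : IsDensity m)
    (h : ∀ᵐ x, m x = c * Real.exp (-(β * V x))) : c * ∫ x, Real.exp (-(β * V x)) = 1 := by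
  rw [← hm.integral_eq_one, integral_congr_ae h, integral_const_mul]

theorem mul_add_one_sub_inv_mul_le {y f g G : ℝ} (hβ : 0 < β) (hc : 0 < c) (hG : 0 < G)
    (hy : y = c * Real.exp (-(β * (f + g)))) :
    f * y + (1 - 1 / β) * (g * y)
      ≤ ((Real.log c + Real.log G - 1) * y + G⁻¹ * Real.exp (-g)) / β := by
  have hy' : y = Real.exp (-(β * (f + g) - Real.log c)) := by
    rw [hy, neg_sub, sub_eq_add_neg, Real.exp_add, Real.exp_log hc]
  have hq : G⁻¹ * Real.exp (-g) = Real.exp (-(g + Real.log G)) := by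
    rw [neg_add, Real.exp_add, Real.exp_neg (Real.log G), Real.exp_log hG, mul_comm]
  have h := exp_neg_mul_sub_le (β * (f + g) - Real.log c) (g + Real.log G)
  rw [← hy', ← hq] at h
  rw [le_div_iff₀ hβ]
  calc (f * y + (1 - 1 / β) * (g * y)) * β = y * (β * (f + g) - g) := by
        field_simp
        ring
    _ ≤ (Real.log c + Real.log G - 1) * y + G⁻¹ * Real.exp (-g) := by linarith

-- The entropy of `m` relative to `exp (-g)` is bounded below by `-log ∫ exp (-g)`: this is what
-- costs the fraction `1 / β` of the regularization.
theorem integrable_and_integral_gibbs_le (hm : IsDensity m)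
    (h : ∀ᵐ x, m x = c * Real.exp (-(β * (f x + g x)))) (hβ : 1 ≤ β) (hc : 0 < c)
    (hfm : Integrable fun x => f x * m x) (hg : AEStronglyMeasurable g) (hg0 : ∀ x, 0 ≤ g x)
    (hgi : Integrable fun x => Real.exp (-g x)) :
    (Integrable fun x => (1 - 1 / β) * (g x * m x)) ∧
      (∫ x, f x * m x) + ∫ x, (1 - 1 / β) * (g x * m x)
        ≤ (Real.log c + Real.log (∫ x, Real.exp (-g x))) / β := by
  have hβ0 : 0 < β := one_pos.trans_le hβ
  have : NeZero (volume : Measure α) := ⟨fun h0 => by simpa [h0] using hm.integral_eq_one⟩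
  set G := ∫ x, Real.exp (-g x) with hG
  have hG0 : 0 < G := integral_exp_pos hgi
  have hpt : ∀ᵐ x, f x * m x + (1 - 1 / β) * (g x * m x)
      ≤ ((Real.log c + Real.log G - 1) * m x + G⁻¹ * Real.exp (-g x)) / β :=
    h.mono fun x hx => mul_add_one_sub_inv_mul_le hβ0 hc hG0 hx
  have hm' := hm.integrable.const_mul (Real.log c + Real.log G - 1)
  have hgi' := hgi.const_mul G⁻¹
  have hbound : Integrable fun x =>
      ((Real.log c + Real.log G - 1) * m x + G⁻¹ * Real.exp (-g x)) / β :=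
    (hm'.add hgi').div_const β
  have hgm : Integrable fun x => (1 - 1 / β) * (g x * m x) := by
    refine (hbound.sub hfm).mono' ((hg.mul hm.integrable.1).const_mul _) ?_
    filter_upwards [hpt, hm.nonneg] with x hx hmx
    have hlam : 0 ≤ 1 - 1 / β := sub_nonneg.2 (div_le_one_of_le₀ hβ hβ0.le)
    rw [Real.norm_of_nonneg (mul_nonneg hlam (mul_nonneg (hg0 x) hmx)), Pi.sub_apply]
    linarith
  refine ⟨hgm, ?_⟩
  calc (∫ x, f x * m x) + ∫ x, (1 - 1 / β) * (g x * m x)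
      = ∫ x, (f x * m x + (1 - 1 / β) * (g x * m x)) := (integral_add hfm hgm).symm
    _ ≤ ∫ x, ((Real.log c + Real.log G - 1) * m x + G⁻¹ * Real.exp (-g x)) / β :=
        integral_mono_ae (hfm.add hgm) hbound hpt
    _ = (Real.log c + Real.log G) / β := by
        rw [integral_div, integral_add hm' hgi', integral_const_mul, integral_const_mul,
          hm.integral_eq_one, ← hG, inv_mul_cancel₀ hG0.ne', mul_one, sub_add_cancel]

end Entropy

section Objective

variable {d : ℕ} {H : Type*} [NormedAddCommGroup H] [InnerProductSpace ℝ H]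
  {R : H → ℝ} {Ψ : Param d → H} {g η m : Param d → ℝ} {β c lam : ℝ} {L : NNReal}

theorem integrable_dRisk_mul (R : H → ℝ) (m : Param d → ℝ)
    (hη : Integrable fun θ => η θ • Ψ θ) : Integrable fun θ => dRisk R Ψ m θ * η θ :=
  ((fderiv ℝ R (output Ψ m)).integrable_comp hη).congr <| ae_of_all _ fun θ => by
    simp [dRisk, mul_comm]

theorem fderiv_output [CompleteSpace H] (R : H → ℝ) (m : Param d → ℝ)
    (hη : Integrable fun θ => η θ • Ψ θ) :
    fderiv ℝ R (output Ψ m) (output Ψ η) = ∫ θ, dRisk R Ψ m θ * η θ := by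
  rw [output, output, ← ContinuousLinearMap.integral_comp_comm _ hη]
  exact integral_congr_ae (ae_of_all _ fun θ => by simp [dRisk, output, mul_comm])

theorem log_normalization_le (hβ : 0 < β) (hL : LipschitzWith L (dObjective R Ψ g m))
    (hm : IsDensity m) (h : ∀ᵐ θ, m θ = c * Real.exp (-(β * dObjective R Ψ g m θ)))
    (hη : IsDensity η) (hΨη : Integrable fun θ => η θ • Ψ θ)
    (hgη : Integrable fun θ => g θ * η θ) :
    Real.log c / β ≤ (∫ θ, dRisk R Ψ m θ * η θ) + (∫ θ, g θ * η θ)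
      + (L + d * Real.log β - Real.log (volume.real (Metric.ball (0 : Param d) 1))) / β := by
  set K : ℝ := L + d * Real.log β - Real.log (volume.real (Metric.ball (0 : Param d) 1))
  set V := dObjective R Ψ g m
  have hcZ := hm.mul_integral_exp_neg_eq_one h
  have hi : Integrable fun θ => Real.exp (-(β * V θ)) :=
    not_imp_comm.1 integral_undef (right_ne_zero_of_mul_eq_one hcZ)
  have hlogc : Real.log c = -Real.log (∫ θ, Real.exp (-(β * V θ))) := by
    rw [eq_inv_of_mul_eq_one_left hcZ, Real.log_inv]
  have hmin (θ : Param d) : (Real.log c - K) / β ≤ V θ := by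
    have := neg_log_integral_exp_neg_le hL hβ hi θ
    rw [← hlogc, finrank_euclideanSpace_fin] at this
    rw [div_le_iff₀ hβ]
    linarith
  have hrisk := integrable_dRisk_mul R m hΨη
  have hVη : ∫ θ, V θ * η θ = (∫ θ, dRisk R Ψ m θ * η θ) + ∫ θ, g θ * η θ := by
    rw [← integral_add hrisk hgη]
    simp only [V, dObjective, add_mul]
  have hVi : Integrable fun θ => V θ * η θ := by
    simpa only [V, dObjective, add_mul] using hrisk.fun_add hgη
  have := hη.le_integral_mul hmin hVi
  rw [hVη, sub_div] at this
  linarith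

theorem risk_output_add_integral_le_of_gibbs [CompleteSpace H] (hR : ConvexOn ℝ Set.univ R)
    (hRd : Differentiable ℝ R) (hg : Continuous g) (hg0 : ∀ θ, 0 ≤ g θ)
    (hgi : Integrable fun θ => Real.exp (-g θ)) (hβ : 1 ≤ β)
    (hL : LipschitzWith L (dObjective R Ψ g m)) (hm : IsDensity m)
    (h : ∀ᵐ θ, m θ = c * Real.exp (-(β * dObjective R Ψ g m θ)))
    (hΨm : Integrable fun θ => m θ • Ψ θ) (hη : IsDensity η)
    (hΨη : Integrable fun θ => η θ • Ψ θ) (hgη : Integrable fun θ => g θ * η θ) :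
    (Integrable fun θ => (1 - 1 / β) * (g θ * m θ)) ∧
      R (output Ψ m) + ∫ θ, (1 - 1 / β) * (g θ * m θ) ≤ R (output Ψ η) + (∫ θ, g θ * η θ)
        + (Real.log (∫ θ, Real.exp (-g θ)) + L
          - Real.log (volume.real (Metric.ball (0 : Param d) 1)) + d * Real.log β) / β := by
  have hβ0 : 0 < β := one_pos.trans_le hβ
  have hc : 0 < c := pos_of_mul_pos_left ((hm.mul_integral_exp_neg_eq_one h).symm ▸ one_pos)
    (integral_nonneg fun θ => (Real.exp_pos _).le)
  obtain ⟨hgm, hgibbs⟩ := integrable_and_integral_gibbs_le hm h hβ hc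
    (integrable_dRisk_mul R m hΨm) hg.aestronglyMeasurable hg0 hgi
  have hlog := log_normalization_le hβ0 hL hm h hη hΨη hgη
  have hconv := add_fderiv_sub_le_of_convexOn hR (hRd (output Ψ m)) (output Ψ η)
  rw [map_sub, fderiv_output R m hΨη, fderiv_output R m hΨm] at hconv
  refine ⟨hgm, ?_⟩
  rw [add_div] at hgibbs
  simp only [add_div, sub_div] at hlog ⊢
  linarith

theorem objective_eq_ofReal (hR0 : ∀ ψ, 0 ≤ R ψ) (hg0 : ∀ θ, 0 ≤ g θ) (hlam : 0 ≤ lam)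
    (hη : IsDensity η) (hi : Integrable fun θ => lam * (g θ * η θ)) :
    objective R Ψ g lam η = ENNReal.ofReal (R (output Ψ η) + ∫ θ, lam * (g θ * η θ)) := by
  have hnonneg : 0 ≤ᵐ[volume] fun θ => lam * (g θ * η θ) :=
    hη.nonneg.mono fun θ hθ => mul_nonneg hlam (mul_nonneg (hg0 θ) hθ)
  rw [objective, ← lintegral_const_mul' _ _ ENNReal.ofReal_ne_top]
  simp_rw [← ENNReal.ofReal_mul hlam]
  rw [← ofReal_integral_eq_lintegral_ofReal hi hnonneg,
    ← ENNReal.ofReal_add (hR0 _) (integral_nonneg_of_ae hnonneg)]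

theorem integrable_reg_mul_of_objective_ne_top (hg : Continuous g) (hg0 : ∀ θ, 0 ≤ g θ)
    (hη : IsDensity η) (h : objective R Ψ g 1 η ≠ ⊤) : Integrable fun θ => g θ * η θ := by
  refine ⟨hg.aestronglyMeasurable.mul hη.integrable.1, ?_⟩
  rw [hasFiniteIntegral_iff_ofReal (hη.nonneg.mono fun θ hθ => mul_nonneg (hg0 θ) hθ)]
  simpa [objective, lt_top_iff_ne_top] using h

theorem iInf_objective_ne_top (R : H → ℝ) (Ψ : Param d → H) (hg : Continuous g) :
    (⨅ η : {η : Param d → ℝ // IsDensity η}, objective R Ψ g 1 η.1) ≠ ⊤ := by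
  obtain ⟨b, hb⟩ := exists_isMollifier (G := Param d) one_pos
  have hη : IsDensity b :=
    ⟨hb.integrable, ae_of_all _ hb.nonneg, hb.integral_eq_one⟩
  refine ne_top_of_le_ne_top ?_ (iInf_le _ ⟨b, hη⟩)
  have hi : Integrable fun θ => g θ * b θ :=
    (hg.mul hb.contDiff.continuous).integrable_of_hasCompactSupport hb.hasCompactSupport.mul_left
  simpa [objective] using hi.lintegral_lt_top.ne

theorem differentiable_and_lipschitzWith_dObjective (hΨ : Differentiable ℝ Ψ)
    (hg : Differentiable ℝ g) {M : ℝ} (h : ∀ᵐ θ, ‖gradient (dObjective R Ψ g m) θ‖ ≤ M) :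
    Differentiable ℝ (dObjective R Ψ g m) ∧ LipschitzWith M.toNNReal (dObjective R Ψ g m) := by
  have hd : Differentiable ℝ (dObjective R Ψ g m) :=
    ((fderiv ℝ R (output Ψ m)).differentiable.comp hΨ).add hg
  refine ⟨hd, lipschitzWith_of_ae_norm_fderiv_le hd (h.mono fun θ hθ => ?_)⟩
  rw [gradient, LinearIsometryEquiv.norm_map] at hθ
  exact hθ.trans M.le_coe_toNNReal

theorem IsStationary.objective_marginal_le [CompleteSpace H] {γ C : ℝ} {ρ : Phase d → ℝ}
    (h : IsStationary R Ψ g β γ ρ) (hR0 : ∀ ψ, 0 ≤ R ψ) (hRc : ConvexOn ℝ Set.univ R)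
    (hRd : Differentiable ℝ R) (hg0 : ∀ θ, 0 ≤ g θ) (hg : Continuous g)
    (hgi : Integrable fun θ => Real.exp (-g θ)) (hβ : 1 ≤ β) (hγ : 0 < γ)
    (hVd : Differentiable ℝ (dObjective R Ψ g (marginal ρ)))
    (hL : LipschitzWith L (dObjective R Ψ g (marginal ρ)))
    (hΨi : ∀ η : Param d → ℝ, IsDensity η → Integrable fun θ => η θ • Ψ θ)
    (hC0 : 0 ≤ C) (hC : Real.log (∫ θ, Real.exp (-g θ)) + L
      - Real.log (volume.real (Metric.ball (0 : Param d) 1)) ≤ C) (hη : IsDensity η) :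
    objective R Ψ g (1 - 1 / β) (HeavyBall.marginal ρ)
      ≤ objective R Ψ g 1 η + ENNReal.ofReal ((C + d * Real.log β) / β) := by
  by_cases htop : objective R Ψ g 1 η = ⊤
  · simp [htop]
  have hβ0 : 0 < β := one_pos.trans_le hβ
  have hρ : IsDensity ρ := h.density 0 le_rfl
  obtain ⟨c, hc⟩ :=
    (h.isWeakStationary hβ0.ne').exists_marginal_ae_eq hβ0 (by positivity) hVd hL hρ
  have hgη := integrable_reg_mul_of_objective_ne_top hg hg0 hη htop
  obtain ⟨hgm, hle⟩ := risk_output_add_integral_le_of_gibbs hRc hRd hg hg0 hgi hβ hL hρ.marginal hc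
    (hΨi _ hρ.marginal) hη (hΨi _ hη) hgη
  have hlam : 0 ≤ 1 - 1 / β := sub_nonneg.2 (div_le_one_of_le₀ hβ hβ0.le)
  have hη0 : 0 ≤ R (output Ψ η) + ∫ θ, g θ * η θ :=
    add_nonneg (hR0 _) (integral_nonneg_of_ae (hη.nonneg.mono fun θ hθ => mul_nonneg (hg0 θ) hθ))
  have hlog := Real.log_nonneg hβ
  rw [objective_eq_ofReal hR0 hg0 hlam hρ.marginal hgm,
    objective_eq_ofReal hR0 hg0 zero_le_one hη (by simpa only [one_mul] using hgη)]
  simp only [one_mul]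
  rw [← ENNReal.ofReal_add hη0 (by positivity)]
  refine ENNReal.ofReal_le_ofReal (hle.trans ?_)
  gcongr

end Objective

section FullRegularization

variable {d : ℕ} {H : Type*} [NormedAddCommGroup H] [InnerProductSpace ℝ H]
  {R : H → ℝ} {Ψ : Param d → H} {g : Param d → ℝ}

theorem ofReal_mul_objective_one_le {lam : ℝ} (hlam : lam ≤ 1) (ρ : Param d → ℝ) :
    ENNReal.ofReal lam * objective R Ψ g 1 ρ ≤ objective R Ψ g lam ρ := by
  rw [objective, objective, mul_add, ENNReal.ofReal_one, one_mul]
  gcongr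
  exact mul_le_of_le_one_left' (ENNReal.ofReal_le_one.2 hlam)

theorem objective_one_le_of_objective_le {lam a : ℝ} (hlam0 : 0 < lam) (hlam1 : lam ≤ 1)
    {ρ : Param d → ℝ} (h : objective R Ψ g lam ρ ≤ ENNReal.ofReal a) :
    objective R Ψ g 1 ρ ≤ ENNReal.ofReal (lam⁻¹ * a) := by
  have hmul := (ofReal_mul_objective_one_le hlam1 ρ).trans h
  rwa [mul_comm, ← ENNReal.le_div_iff_mul_le (Or.inl (by simpa using hlam0))
    (Or.inl ENNReal.ofReal_ne_top), ← ENNReal.ofReal_div_of_pos hlam0, div_eq_inv_mul] at hmul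

theorem tendsto_inv_one_sub_mul_add_log_div (i C D : ℝ) :
    Tendsto (fun β : ℝ => (1 - 1 / β)⁻¹ * (i + (C + D * Real.log β) / β)) atTop (𝓝 i) := by
  have hinv : Tendsto (fun β : ℝ => 1 / β) atTop (𝓝 0) := by
    simpa using tendsto_inv_atTop_zero (𝕜 := ℝ)
  have hlog : Tendsto (fun β : ℝ => Real.log β / β) atTop (𝓝 0) :=
    Real.isLittleO_log_id_atTop.tendsto_div_nhds_zero
  have hprod := ((hinv.const_sub 1).inv₀ (by norm_num)).mul
    (((hinv.const_mul C).add (hlog.const_mul D)).const_add i)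
  simpa using hprod.congr fun β => by ring

theorem exists_forall_objective_one_le {I : ℝ≥0∞} (hI : I ≠ ⊤) {C D ε : ℝ} (hC : 0 ≤ C)
    (hD : 0 ≤ D) (hε : 0 < ε) :
    ∃ β₀ : ℝ, 1 ≤ β₀ ∧ ∀ β : ℝ, β₀ ≤ β → ∀ ρ : Param d → ℝ,
      objective R Ψ g (1 - 1 / β) ρ ≤ I + ENNReal.ofReal ((C + D * Real.log β) / β) →
        objective R Ψ g 1 ρ ≤ I + ENNReal.ofReal ε := by
  lift I to NNReal using hI
  obtain ⟨b, hb⟩ := eventually_atTop.1 ((tendsto_inv_one_sub_mul_add_log_div I C D).eventually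
    (eventually_le_nhds (lt_add_of_pos_right (I : ℝ) hε)))
  refine ⟨max b 2, one_le_two.trans (le_max_right _ _), fun β hβ ρ hρ => ?_⟩
  have hβ1 : 1 < β := one_lt_two.trans_le ((le_max_right _ _).trans hβ)
  have hβ0 : 0 < β := one_pos.trans hβ1
  have hlam0 : 0 < 1 - 1 / β := sub_pos.2 ((div_lt_one hβ0).2 hβ1)
  have hlam1 : 1 - 1 / β ≤ 1 := sub_le_self _ (by positivity)
  have hlog := Real.log_nonneg hβ1.le
  rw [← ENNReal.ofReal_coe_nnreal, ← ENNReal.ofReal_add I.coe_nonneg (by positivity)] at hρ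
  rw [← ENNReal.ofReal_coe_nnreal, ← ENNReal.ofReal_add I.coe_nonneg hε.le]
  exact (objective_one_le_of_objective_le hlam0 hlam1 hρ).trans
    (ENNReal.ofReal_le_ofReal (hb β ((le_max_left _ _).trans hβ)))

end FullRegularization

end HeavyBall

end

open HeavyBall in
theorem theorem4_general {d : ℕ} {H : Type*} [NormedAddCommGroup H] [InnerProductSpace ℝ H]
    [CompleteSpace H] {R : H → ℝ} {Ψ : Param d → H} {g : Param d → ℝ}
    (hR0 : ∀ ψ, 0 ≤ R ψ) (hRc : ConvexOn ℝ Set.univ R) (hRd : Differentiable ℝ R)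
    (hΨd : Differentiable ℝ Ψ)
    (hΨi : ∀ η : Param d → ℝ, IsDensity η → Integrable fun θ => η θ • Ψ θ)
    (hgrad : ∃ L : ℝ, ∀ η : Param d → ℝ, IsDensity η →
      ∀ᵐ θ, ‖gradient (dObjective R Ψ g η) θ‖ ≤ L)
    (hg0 : ∀ θ, 0 ≤ g θ) (hgd : Differentiable ℝ g)
    (hgi : Integrable fun θ => Real.exp (-g θ)) :
    (∃ C : ℝ, 0 ≤ C ∧ ∀ β : ℝ, 1 ≤ β → ∀ γ : ℝ, 0 < γ → ∀ ρ : Phase d → ℝ,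
      IsStationary R Ψ g β γ ρ → objective R Ψ g (1 - 1 / β) (marginal ρ)
        ≤ (⨅ η : {η : Param d → ℝ // IsDensity η}, objective R Ψ g 1 η.1)
          + ENNReal.ofReal ((C + d * Real.log β) / β)) ∧
    (∀ ε : ℝ, 0 < ε → ∃ β₀ : ℝ, 1 ≤ β₀ ∧ ∀ β : ℝ, β₀ ≤ β → ∀ γ : ℝ, 0 < γ → ∀ ρ : Phase d → ℝ,
      IsStationary R Ψ g β γ ρ → objective R Ψ g 1 (marginal ρ)
        ≤ (⨅ η : {η : Param d → ℝ // IsDensity η}, objective R Ψ g 1 η.1)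
          + ENNReal.ofReal ε) := by
  obtain ⟨L, hL⟩ := hgrad
  set C := max (Real.log (∫ θ, Real.exp (-g θ)) + L.toNNReal
    - Real.log (volume.real (Metric.ball (0 : Param d) 1))) 0
  have hC : 0 ≤ C := le_max_right _ _
  have hbound (β : ℝ) (hβ : 1 ≤ β) (γ : ℝ) (hγ : 0 < γ) (ρ : Phase d → ℝ)
      (hρ : IsStationary R Ψ g β γ ρ) : objective R Ψ g (1 - 1 / β) (marginal ρ)
        ≤ (⨅ η : {η : Param d → ℝ // IsDensity η}, objective R Ψ g 1 η.1)
          + ENNReal.ofReal ((C + d * Real.log β) / β) := by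
    obtain ⟨hVd, hVL⟩ := differentiable_and_lipschitzWith_dObjective hΨd hgd
      (hL _ (hρ.density 0 le_rfl).marginal)
    rw [ENNReal.iInf_add]
    exact le_iInf fun η => hρ.objective_marginal_le hR0 hRc hRd hg0 hgd.continuous hgi hβ hγ hVd
      hVL hΨi hC (le_max_left _ _) η.2
  refine ⟨⟨C, hC, hbound⟩, fun ε hε => ?_⟩
  obtain ⟨β₀, hβ₀, h⟩ := exists_forall_objective_one_le (R := R) (Ψ := Ψ) (g := g)
    (iInf_objective_ne_top R Ψ hgd.continuous) hC d.cast_nonneg hε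
  exact ⟨β₀, hβ₀, fun β hβ γ hγ ρ hρ => h β hβ _ (hbound β (hβ₀.trans hβ) γ hγ ρ hρ)⟩

theorem theorem4 {d : ℕ} {H : Type*} [NormedAddCommGroup H] [InnerProductSpace ℝ H]
    [CompleteSpace H] (R : H → ℝ) (Ψ : HeavyBall.Param d → H) (g : HeavyBall.Param d → ℝ)
    (hA : HeavyBall.Assumptions R Ψ g) :
    (∃ C : ℝ, 0 ≤ C ∧ ∀ β : ℝ, 1 ≤ β → ∀ γ : ℝ, 0 < γ → ∀ ρ : HeavyBall.Phase d → ℝ,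
      HeavyBall.IsStationary R Ψ g β γ ρ →
        HeavyBall.objective R Ψ g (1 - 1 / β) (HeavyBall.marginal ρ)
          ≤ (⨅ η : {η : HeavyBall.Param d → ℝ // HeavyBall.IsDensity η},
              HeavyBall.objective R Ψ g 1 η.1)
            + ENNReal.ofReal ((C + d * Real.log β) / β)) ∧
    (∀ ε : ℝ, 0 < ε → ∃ β₀ : ℝ, 1 ≤ β₀ ∧ ∀ β : ℝ, β₀ ≤ β → ∀ γ : ℝ, 0 < γ →
      ∀ ρ : HeavyBall.Phase d → ℝ, HeavyBall.IsStationary R Ψ g β γ ρ →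
        HeavyBall.objective R Ψ g 1 (HeavyBall.marginal ρ)
          ≤ (⨅ η : {η : HeavyBall.Param d → ℝ // HeavyBall.IsDensity η},
              HeavyBall.objective R Ψ g 1 η.1)
            + ENNReal.ofReal ε) :=
  theorem4_general hA.risk_nonneg hA.risk_convex hA.risk_differentiable hA.feature_differentiable
    (fun η hη => hA.feature_integrable η hη.integrable) hA.gradient_bounded hA.reg_nonneg
    hA.reg_differentiable (by simpa only [one_mul] using hA.reg_integrable 1 one_pos)
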